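/- **Setting.** A game graph $G=(V=V^0\sqcup V^1,E)$ is a finite directed graph whose vertices are divided between players $0$ and $1$ and in which every vertex has an outgoing edge; $n=|V|$. A play is an infinite path $\rho=v_0v_1\ldots$ of $G$. A strategy of player $a$ maps each history in $V^*V^a$ to a successor of its last vertex; $\rho$ is compliant with it if it obeys it at all visited vertices of $V^a$. For an objective $\Phi\subseteq V^\omega$, $\mathcal L(\Phi)$ is the set of plays in $\Phi$; $\langle\langle a\rangle\rangle\Phi$ is the set of vertices $v$ from which some strategy of player $a$ has all its compliant plays from $v$ in $\Phi$; $\langle\langle 0,1\rangle\rangle\Phi$ is the set of vertices from which the play of some strategy profile is in $\Phi$. For $P:V\to\mathbb N$ with $P_j=P^{-1}(j)$, $\mathit{Parity}(P)$ says that for every odd $a$, if $P_a$ is visited infinitely often, then so is $P_b$ for some even $b>a$. A template $\Lambda\lhd(S,D,\mathcal H)$ consists of sets $S,D\subseteq E$ and a set $\mathcal H$ of pairs $(R,H_\ell)$ with $R\subseteq V$ and $H_\ell$ a set of sets $H\subseteq E$ (live-groups). A play satisfies it if it never takes an edge of $S$ (safety), takes each edge of $D$ only finitely often (co-live), and, for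 all $(R,H_\ell)\in\mathcal H$, if it visits $R$ infinitely often, then for every $H\in H_\ell$ whose set of sources is visited infinitely often it takes edges of $H$ infinitely often (conditional live-groups). The conjunction of templates is the componentwise union. A strategy follows $\Lambda$ if all plays compliant with it satisfy $\Lambda$. A contracted strategy-mask (CSM) for player $i$ is a pair $(\Psi,\Pi)$ of templates such that all edges occurring in $\Psi$ have their source in $V^{1-i}$ and all edges occurring in $\Pi$ have their source in $V^i$. It is adequately permissive for $(G,\Phi)$ if it is (i) sufficient: from every $v\in\langle\langle 0,1\rangle\rangle\Phi$, for every player-$i$ strategy following $\Pi$ and every player-$(1-i)$ strategy following $\Psi$, the resulting play from $v$ is in $\Phi$; (ii) implementable: $\langle\langle 1-i\rangle\rangle\Psi=V$ and $\langle\langle i\rangle\rangle\Pi=V$; (iii) permissive: $\mathcal L(\Phi)\subseteq\mathcal L(\Psi)$. **The procedure ParityTemp$(G,P,i)$.** For $X\subseteq V$, $G|_X$ is the induced subgraph, and cooperative regions in $G|_X$ are the sets of vertices from which some infinite path of $G|_X$ satisfies the objective. Let $\mathrm{pre}(U)$ be the set of predecessors of $U$; let $\mathrm{cpre}^a(U)$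 be the set of vertices of player $a$ with some successor in $U$ and of vertices of player $1-a$ with all successors in $U$; let $A^a_0(U)=U$, $A^a_{j+1}(U)=\mathrm{cpre}^a(A^a_j(U))\cup A^a_j(U)$, and $\mathrm{attr}^a(U)=\bigcup_jA^a_j(U)\setminus U$, all in the current graph. - $\mathrm{Live}(G|_X,I,i)$ starts with $U=I$ and, while $U\ne X$: adds to $H_\ell^{s}$, for each $j\ge 0$, the live-group of all edges from $V^i\cap A^i_{j+1}(U)$ to $A^i_j(U)$; replaces $U$ by $U\cup\mathrm{attr}^i(U)$; adds to $H_\ell^{a}$ the live-group of all edges from $V^{1-i}\cap\mathrm{cpre}^{1-i}(U)$ to $U$; replaces $U$ by $U\cup\mathrm{cpre}^{1-i}(U)$. - $\mathrm{CoLive}(G|_X,I)$ starts with $U$ the cooperative region of "always in $I$" and collects the edges of $G|_X$ from $U$ to $X\setminus U$; while $U\neq X$, it collects the edges inside $\mathrm{pre}(U)\setminus U$, replaces $U$ by $U\cup\mathrm{pre}(U)$, and collects the edges from $U$ to $X\setminus U$. - $\mathrm{ComputeSets}(X,P)$: let $d$ be the largest priority in $X$ ($0$ if $X=\emptyset$).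 If $d$ is odd, let $W_{\neg d}$ be the cooperative region of $\mathit{Parity}(P)$ in $G|_{X\setminus P_d}$, and add the edges of $\mathrm{CoLive}(G|_X,W_{\neg d})$ with source in $V^{1-i}$ (resp. $V^i$) to the co-live edges of $\Psi$ (resp. $\Pi$). If $d$ is even, let $W_d$ be the cooperative region of "visit $P_d$ infinitely often" in $G|_X$, $W_{\neg d}=X\setminus W_d$, and, for every odd priority $l$ occurring in $X$, with $(H^s_\ell,H^a_\ell)=\mathrm{Live}(G|_{W_d},W_d\cap(P_{l+1}\cup P_{l+3}\cup\dots\cup P_d),i)$, add $(W_d\cap P_l,H_\ell^a)$ to the conditional live-groups of $\Psi$ and $(W_d\cap P_l,H_\ell^s)$ to those of $\Pi$. If $d>0$, recurse on $W_{\neg d}$ with priority $d$ merged into priority $0$. - $\mathrm{ParityTemp}(G,P,i)$ computes $Z^*$, the cooperative region of $\mathit{Parity}(P)$ in $G$, and returns the templates $(\Psi,\Pi)$ of $\mathrm{ComputeSets}(Z^*,P)$ together with, as unsafe edges, the edges from $Z^*$ to $V\setminus Z^*$ with source in $V^{1-i}$ (for $\Psi$) and in $V^i$ (for $\Pi$).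 **Theorem.** For every game graph $G$, every $P:V\to\mathbb N$ and every player $i\in\{0,1\}$, the pair $(\Psi_i,\Pi_i)=\mathrm{ParityTemp}(G,P,i)$ is a CSM for player $i$ that is adequately permissive for $(G,\mathit{Parity}(P))$. Moreover $\mathrm{ParityTemp}$ is computed in time $\mathcal O(n^4)$: there are a random access machine program (arrays of natural numbers; unit cost for assignments, tests, array accesses, addition, truncated subtraction, comparison and the last bit of a number) and a constant $C$ such that, for every game graph $G$ on $\{0,\dots,n-1\}$ (given by owners and adjacency matrix), every $P$ (given by its list of values) and every $i$, the program halts after at most $C(n^4+1)$ steps with output $\mathrm{ParityTemp}(G,P,i)$. -/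

import Mathlib

universe u

/-! ## Game graphs, plays, strategies -/

/-- A game graph on the vertex set `V`: every vertex belongs to one of the players `0`, `1`, and
every vertex has an outgoing edge. (Finiteness of `V` is assumed where it is used.) -/
structure GameGraph (V : Type u) where
  owner : V → Fin 2
  Adj : V → V → Prop
  total : ∀ v, ∃ w, Adj v w

/-- The vertex set `A` is visited infinitely often. -/
def InfOften {V : Type u} (A : Set V) (ρ : ℕ → V) : Prop :=
  ∀ N, ∃ k, N ≤ k ∧ ρ k ∈ A

/-- Edges of `H` are taken infinitely often. -/
def InfOftenEdge {V : Type u} (H : Set (V × V)) (ρ : ℕ → V) : Prop :=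
  ∀ N, ∃ k, N ≤ k ∧ (ρ k, ρ (k + 1)) ∈ H

/-- The parity objective: whenever an odd priority is seen infinitely often, so is some larger
even priority. -/
def Parity {V : Type u} (P : V → ℕ) : Set (ℕ → V) :=
  {ρ | ∀ a, Odd a → InfOften {v | P v = a} ρ →
    ∃ b, a < b ∧ Even b ∧ InfOften {v | P v = b} ρ}

namespace GameGraph

variable {V : Type u}

def IsPlay (G : GameGraph V) (ρ : ℕ → V) : Prop :=
  ∀ k, G.Adj (ρ k) (ρ (k + 1))

/-- The plays of `G` that satisfy `Φ`. -/
def Lang (G : GameGraph V) (Φ : Set (ℕ → V)) : Set (ℕ → V) :=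
  {ρ | G.IsPlay ρ ∧ ρ ∈ Φ}

/-- A strategy of player `a`: `move h v` is the successor chosen at the vertex `v` of player `a`
after the history `h` (the vertices visited before `v`). The values at vertices of the other player
are never used. -/
structure Strategy (G : GameGraph V) (a : Fin 2) where
  move : List V → V → V
  valid : ∀ h v, G.owner v = a → G.Adj v (move h v)

/-- `ρ` is compliant with the strategy `σ`. -/
def Strategy.Compliant {G : GameGraph V} {a : Fin 2} (σ : G.Strategy a) (ρ : ℕ → V) : Prop :=
  ∀ k, G.owner (ρ k) = a → ρ (k + 1) = σ.move ((List.range k).map ρ) (ρ k)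

/-- The winning region of player `a` for the objective `Φ`. -/
def winRegion (G : GameGraph V) (a : Fin 2) (Φ : Set (ℕ → V)) : Set V :=
  {v | ∃ σ : G.Strategy a, ∀ ρ, G.IsPlay ρ → ρ 0 = v → σ.Compliant ρ → ρ ∈ Φ}

/-- The cooperative winning region for the objective `Φ`. -/
def coopWinRegion (G : GameGraph V) (Φ : Set (ℕ → V)) : Set V :=
  {v | ∃ (σ₀ : G.Strategy 0) (σ₁ : G.Strategy 1),
    ∀ ρ, G.IsPlay ρ → ρ 0 = v → σ₀.Compliant ρ → σ₁.Compliant ρ → ρ ∈ Φ}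

end GameGraph

/-! ## Templates and contracted strategy-masks -/

/-- The data `(S, D, ℋ)` of a template: unsafe edges, co-live edges, and conditional live-groups
`(R, Hℓ)`, where `Hℓ` is a set of live-groups. -/
@[ext]
structure Template (V : Type u) where
  S : Set (V × V)
  D : Set (V × V)
  H : Set (Set V × Set (Set (V × V)))

namespace Template

variable {V : Type u}

/-- Unsafe edges are never taken. -/
def safetyLang (S : Set (V × V)) : Set (ℕ → V) :=
  {ρ | ∀ k, (ρ k, ρ (k + 1)) ∉ S}

/-- Each co-live edge is taken only finitely often. -/
def coLiveLang (D : Set (V × V)) : Set (ℕ → V) :=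
  {ρ | ∀ e ∈ D, ∃ N, ∀ k, N ≤ k → (ρ k, ρ (k + 1)) ≠ e}

/-- The live-group template: for each group `A`, if sources of `A` are visited infinitely often then
edges of `A` are taken infinitely often. -/
def liveLang (L : Set (Set (V × V))) : Set (ℕ → V) :=
  {ρ | ∀ A ∈ L, InfOften (Prod.fst '' A) ρ → InfOftenEdge A ρ}

/-- The conditional live-group template. -/
def condLang (H : Set (Set V × Set (Set (V × V)))) : Set (ℕ → V) :=
  {ρ | ∀ c ∈ H, InfOften c.1 ρ → ρ ∈ liveLang c.2}

/-- The composed template. -/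
def lang (T : Template V) : Set (ℕ → V) :=
  safetyLang T.S ∩ coLiveLang T.D ∩ condLang T.H

/-- All edges that occur in the template. -/
def edges (T : Template V) : Set (V × V) :=
  {e | e ∈ T.S ∨ e ∈ T.D ∨ ∃ c ∈ T.H, ∃ A ∈ c.2, e ∈ A}

/-- Conjunction of templates. -/
def conj (T T' : Template V) : Template V :=
  ⟨T.S ∪ T'.S, T.D ∪ T'.D, T.H ∪ T'.H⟩

/-- The template consists of edges of `G` whose sources belong to player `a`. -/
def ControlledBy (T : Template V) (G : GameGraph V) (a : Fin 2) : Prop :=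
  ∀ e ∈ T.edges, G.Adj e.1 e.2 ∧ G.owner e.1 = a

end Template

namespace GameGraph

variable {V : Type u}

/-- A strategy follows a template if all plays compliant with it satisfy the template. -/
def Strategy.Follows {G : GameGraph V} {a : Fin 2} (σ : G.Strategy a) (T : Template V) : Prop :=
  ∀ ρ, G.IsPlay ρ → σ.Compliant ρ → ρ ∈ T.lang

/-- `(M.1, M.2)` is a contracted strategy-mask `(Ψ, Π)` for player `i`: `Ψ` is an assumption
template (over edges of the other player), `Π` a strategy template (over edges of player `i`). -/
def IsCSM (G : GameGraph V) (i : Fin 2) (M : Template V × Template V) : Prop :=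
  M.1.ControlledBy G (1 - i) ∧ M.2.ControlledBy G i

/-- The vertices from which the contracted strategy-mask `(Ψ, Π)` is winning for player `i`. -/
def csmWinRegion (G : GameGraph V) (i : Fin 2) (Φ : Set (ℕ → V)) (M : Template V × Template V) :
    Set V :=
  {v | ∀ (σ : G.Strategy i) (τ : G.Strategy (1 - i)), σ.Follows M.2 → τ.Follows M.1 →
    ∀ ρ, G.IsPlay ρ → ρ 0 = v → σ.Compliant ρ → τ.Compliant ρ → ρ ∈ Φ}

/-- Adequate permissiveness of `(Ψ, Π)` for player `i` and the objective `Φ`. -/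
structure AdequatelyPermissive (G : GameGraph V) (i : Fin 2) (Φ : Set (ℕ → V))
    (M : Template V × Template V) : Prop where
  sufficient : G.coopWinRegion Φ ⊆ G.csmWinRegion i Φ M
  implementable : G.winRegion (1 - i) M.1.lang = Set.univ ∧ G.winRegion i M.2.lang = Set.univ
  permissive : G.Lang Φ ⊆ G.Lang M.1.lang

/-! ## The procedure `ParityTemp`

Restricted graphs `G|_X` are represented by the vertex set `X`. -/

/-- The edges of `G|_X`. -/
def edgesIn (G : GameGraph V) (X : Set V) : Set (V × V) :=
  {e | e.1 ∈ X ∧ e.2 ∈ X ∧ G.Adj e.1 e.2}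

/-- The cooperative winning region of `G|_X` for `Φ`. As `G|_X` may have dead ends, it is described
through infinite paths. -/
def coopRegionIn (G : GameGraph V) (X : Set V) (Φ : Set (ℕ → V)) : Set V :=
  {v | ∃ ρ, ρ 0 = v ∧ (∀ k, (ρ k, ρ (k + 1)) ∈ G.edgesIn X) ∧ ρ ∈ Φ}

/-- Predecessors of `U` in `G|_X`. -/
def pre (G : GameGraph V) (X U : Set V) : Set V :=
  {v | ∃ w ∈ U, (v, w) ∈ G.edgesIn X}

/-- Controllable predecessors of `U` for player `a` in `G|_X`. -/
def cpre (G : GameGraph V) (X : Set V) (a : Fin 2) (U : Set V) : Set V :=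
  {v | v ∈ X ∧ ((G.owner v = a ∧ ∃ w ∈ U, (v, w) ∈ G.edgesIn X) ∨
    (G.owner v = 1 - a ∧ ∀ w, (v, w) ∈ G.edgesIn X → w ∈ U))}

/-- The vertices of `G|_X` from which player `a` can force a visit to `U` in at most `j` steps. -/
def cpreIter (G : GameGraph V) (X : Set V) (a : Fin 2) (U : Set V) : ℕ → Set V
  | 0 => U
  | j + 1 => G.cpre X a (cpreIter G X a U j) ∪ cpreIter G X a U j

/-- The attractor of `U` for player `a` in `G|_X` (without `U`). -/
def attr (G : GameGraph V) (X : Set V) (a : Fin 2) (U : Set V) : Set V :=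
  (⋃ j, G.cpreIter X a U (j + 1)) \ U

/-- The live-groups of the attractor computation, one for each step, over edges of player `a`. -/
def attrGroups (G : GameGraph V) (X : Set V) (a : Fin 2) (U : Set V) : Set (Set (V × V)) :=
  {A | ∃ j, A = {e | e ∈ G.edgesIn X ∧ G.owner e.1 = a ∧
    e.1 ∈ G.cpreIter X a U (j + 1) ∧ e.2 ∈ G.cpreIter X a U j}}

/-- The value of the variable `U` of the procedure `Live` for `G|_X` and the target `I` after `k`
iterations of its loop: an attractor step of player `i`, then a one-step controllable predecessor
of the other player. -/
def liveIter (G : GameGraph V) (X : Set V) (i : Fin 2) (I : Set V) : ℕ → Set V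
  | 0 => I
  | k + 1 =>
    let U := liveIter G X i I k ∪ G.attr X i (liveIter G X i I k)
    U ∪ G.cpre X (1 - i) U

/-- The live-groups for player `i` returned by `Live`. The loop runs while `U ≠ X`. -/
def liveStrat (G : GameGraph V) (X : Set V) (i : Fin 2) (I : Set V) : Set (Set (V × V)) :=
  {A | ∃ k, G.liveIter X i I k ≠ X ∧ A ∈ G.attrGroups X i (G.liveIter X i I k)}

/-- The live-groups for the other player returned by `Live`. -/
def liveAssump (G : GameGraph V) (X : Set V) (i : Fin 2) (I : Set V) : Set (Set (V × V)) :=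
  {A | ∃ k, G.liveIter X i I k ≠ X ∧
    ∃ U, U = G.liveIter X i I k ∪ G.attr X i (G.liveIter X i I k) ∧
      A = {e | e ∈ G.edgesIn X ∧ G.owner e.1 = 1 - i ∧ e.1 ∈ G.cpre X (1 - i) U ∧ e.2 ∈ U}}

/-- The value of the variable `U` of the procedure `CoLive` for `G|_X` and the set `I` after `k`
iterations: it starts with the cooperative safety region of `I`. -/
def coLiveIter (G : GameGraph V) (X I : Set V) : ℕ → Set V
  | 0 => G.coopRegionIn X {ρ | ∀ k, ρ k ∈ I}
  | k + 1 => coLiveIter G X I k ∪ G.pre X (coLiveIter G X I k)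

/-- The edges collected by `CoLive`: edges that leave some `U`, and edges inside the set of vertices
newly added to some `U`. (Once `U = X` there are no such edges.) -/
def coLiveEdges (G : GameGraph V) (X I : Set V) : Set (V × V) :=
  {e | e ∈ G.edgesIn X ∧ ∃ k,
    (e.1 ∈ G.coLiveIter X I k ∧ e.2 ∉ G.coLiveIter X I k) ∨
    (e.1 ∈ G.pre X (G.coLiveIter X I k) \ G.coLiveIter X I k ∧
      e.2 ∈ G.pre X (G.coLiveIter X I k) \ G.coLiveIter X I k)}

/-- The largest priority in `X` (`0` if `X` is empty). -/
noncomputable def maxPrio (P : V → ℕ) (X : Set V) : ℕ :=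
  sSup (P '' X)

/-- The vertex set on which `ComputeSets` recurses: with `d` the largest priority, the
cooperative parity region of the graph without priority `d` if `d` is odd, and the complement of the
cooperative Büchi region of priority `d` if `d` is even. -/
noncomputable def restSet (G : GameGraph V) (X : Set V) (P : V → ℕ) : Set V :=
  if Odd (maxPrio P X) then
    G.coopRegionIn (X \ {v | P v = maxPrio P X}) (Parity P)
  else
    X \ G.coopRegionIn X {ρ | InfOften {v | P v = maxPrio P X} ρ}

/-- Priority `d` is merged into priority `0`. -/
def mergePrio (P : V → ℕ) (d : ℕ) : V → ℕ :=
  fun v => if P v = d then 0 else P v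

/-- The templates (assumption template, strategy template) that `ComputeSets` adds before it
recurses. For odd `d` these are co-live edges; for even `d` one conditional live-group for each
occurring odd priority `l`, with condition `W_d ∩ P_l` and target the even priorities above `l`. -/
noncomputable def levelTemplates (G : GameGraph V) (i : Fin 2) (X : Set V) (P : V → ℕ) :
    Template V × Template V :=
  if Odd (maxPrio P X) then
    (⟨∅, {e | e ∈ G.coLiveEdges X (G.restSet X P) ∧ G.owner e.1 = 1 - i}, ∅⟩,
     ⟨∅, {e | e ∈ G.coLiveEdges X (G.restSet X P) ∧ G.owner e.1 = i}, ∅⟩)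
  else
    let W := X \ G.restSet X P
    (⟨∅, ∅, {c | ∃ l ∈ P '' X, Odd l ∧
        c = ({v | v ∈ W ∧ P v = l}, G.liveAssump W i {v | v ∈ W ∧ Even (P v) ∧ l < P v})}⟩,
     ⟨∅, ∅, {c | ∃ l ∈ P '' X, Odd l ∧
        c = ({v | v ∈ W ∧ P v = l}, G.liveStrat W i {v | v ∈ W ∧ Even (P v) ∧ l < P v})}⟩)

theorem restSet_subset (G : GameGraph V) (X : Set V) (P : V → ℕ) : G.restSet X P ⊆ X := by
  intro v hv
  unfold restSet at hv
  split_ifs at hv with h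
  · obtain ⟨ρ, rfl, hρ, -⟩ := hv
    exact (hρ 0).1.1
  · exact hv.1

theorem maxPrio_mergePrio_lt [Finite V] (G : GameGraph V) (X : Set V) (P : V → ℕ)
    (h : 0 < maxPrio P X) :
    maxPrio (mergePrio P (maxPrio P X)) (G.restSet X P) < maxPrio P X := by
  rcases (mergePrio P (maxPrio P X) '' G.restSet X P).eq_empty_or_nonempty with he | hne
  · rw [maxPrio, he]
    simpa using h
  · obtain ⟨v, hv, hv'⟩ := Nat.sSup_mem hne (Set.toFinite _).bddAbove
    rw [maxPrio, ← hv', mergePrio]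
    split_ifs with hd
    · exact h
    · exact lt_of_le_of_ne
        (le_csSup (Set.toFinite _).bddAbove ⟨v, G.restSet_subset X P hv, rfl⟩) hd

/-- The recursive procedure `ComputeSets` on `G|_X`. -/
noncomputable def computeSets [Finite V] (G : GameGraph V) (i : Fin 2) (X : Set V) (P : V → ℕ) :
    Template V × Template V :=
  if h : 0 < maxPrio P X then
    let r := computeSets G i (G.restSet X P) (mergePrio P (maxPrio P X))
    ((G.levelTemplates i X P).1.conj r.1, (G.levelTemplates i X P).2.conj r.2)
  else
    G.levelTemplates i X P
termination_by maxPrio P X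
decreasing_by exact G.maxPrio_mergePrio_lt X P h

/-- The edges of player `a` that leave `Z`. -/
def unsafeEdges (G : GameGraph V) (Z : Set V) (a : Fin 2) : Set (V × V) :=
  {e | G.Adj e.1 e.2 ∧ G.owner e.1 = a ∧ e.1 ∈ Z ∧ e.2 ∉ Z}

/-- The contracted strategy-mask `(Ψ, Π)` for player `i` returned by `ParityTemp`. -/
noncomputable def parityTemp [Finite V] (G : GameGraph V) (P : V → ℕ) (i : Fin 2) :
    Template V × Template V :=
  let Z := G.coopRegionIn Set.univ (Parity P)
  let r := G.computeSets i Z P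
  ((⟨G.unsafeEdges Z (1 - i), ∅, ∅⟩ : Template V).conj r.1,
   (⟨G.unsafeEdges Z i, ∅, ∅⟩ : Template V).conj r.2)

end GameGraph

/-! ## Random access machine with unit costs

A program uses finitely many arrays of natural numbers with (up to) three indices; a scalar variable
is an array read at index `(0, 0, 0)`. Every operation (constant, array access, addition, truncated
subtraction, comparison, last bit of a number, assignment, test) costs one step. -/

namespace Ram

/-- `s a i j k` is the entry of the array with number `a` at index `(i, j, k)`. -/
abbrev Store := ℕ → ℕ → ℕ → ℕ → ℕ

inductive Term where
  | lit (c : ℕ)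
  | get (a : ℕ) (i j k : Term)
  | add (x y : Term)
  | sub (x y : Term)
  | eq (x y : Term)
  | lt (x y : Term)
  | bit (x : Term)

namespace Term

def val (s : Store) : Term → ℕ
  | lit c => c
  | get a i j k => s a (i.val s) (j.val s) (k.val s)
  | add x y => x.val s + y.val s
  | sub x y => x.val s - y.val s
  | eq x y => if x.val s = y.val s then 1 else 0
  | lt x y => if x.val s < y.val s then 1 else 0
  | bit x => x.val s % 2

/-- The number of steps for evaluating a term. -/
def cost : Term → ℕ
  | lit _ => 1
  | get _ i j k => i.cost + j.cost + k.cost + 1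
  | add x y => x.cost + y.cost + 1
  | sub x y => x.cost + y.cost + 1
  | eq x y => x.cost + y.cost + 1
  | lt x y => x.cost + y.cost + 1
  | bit x => x.cost + 1

end Term

/-- Programs: `set a i j k x` is the assignment `a[i, j, k] := x`; tests succeed on nonzero
values. -/
inductive Prog where
  | skip
  | set (a : ℕ) (i j k x : Term)
  | seq (p q : Prog)
  | ite (c : Term) (p q : Prog)
  | loop (c : Term) (p : Prog)

def Store.update (s : Store) (a i j k x : ℕ) : Store :=
  fun a' i' j' k' => if a' = a ∧ i' = i ∧ j' = j ∧ k' = k then x else s a' i' j' k'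

/-- `Runs p s t s'`: started in the store `s`, the program `p` halts after `t` steps in the
store `s'`. -/
inductive Runs : Prog → Store → ℕ → Store → Prop
  | skip (s : Store) : Runs .skip s 1 s
  | set (s : Store) (a : ℕ) (i j k x : Term) :
      Runs (.set a i j k x) s (i.cost + j.cost + k.cost + x.cost + 1)
        (s.update a (i.val s) (j.val s) (k.val s) (x.val s))
  | seq {p q : Prog} {s s' s'' : Store} {t t' : ℕ} :
      Runs p s t s' → Runs q s' t' s'' → Runs (.seq p q) s (t + t') s''
  | ite_true {c : Term} {p q : Prog} {s s' : Store} {t : ℕ} :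
      c.val s ≠ 0 → Runs p s t s' → Runs (.ite c p q) s (c.cost + 1 + t) s'
  | ite_false {c : Term} {p q : Prog} {s s' : Store} {t : ℕ} :
      c.val s = 0 → Runs q s t s' → Runs (.ite c p q) s (c.cost + 1 + t) s'
  | loop_true {c : Term} {p : Prog} {s s' s'' : Store} {t t' : ℕ} :
      c.val s ≠ 0 → Runs p s t s' → Runs (.loop c p) s' t' s'' →
      Runs (.loop c p) s (c.cost + 1 + t + t') s''
  | loop_false {c : Term} {p : Prog} {s : Store} :
      c.val s = 0 → Runs (.loop c p) s (c.cost + 1) s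

open Classical in
/-- The initial store: array `0` holds the number of vertices, `1` the player `i`, `2` the owner of
each vertex, `3` the adjacency matrix, `4` the priority of each vertex; all other entries
are `0`. -/
noncomputable def input {n : ℕ} (G : GameGraph (Fin n)) (P : Fin n → ℕ) (i : Fin 2) : Store :=
  fun a x y z =>
    if z ≠ 0 then 0
    else if a = 0 then (if x = 0 ∧ y = 0 then n else 0)
    else if a = 1 then (if x = 0 ∧ y = 0 then i.val else 0)
    else if a = 2 then (if h : x < n ∧ y = 0 then (G.owner ⟨x, h.1⟩).val else 0)
    else if a = 3 then
      (if h : x < n ∧ y < n then (if G.Adj ⟨x, h.1⟩ ⟨y, h.2⟩ then 1 else 0) else 0)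
    else if a = 4 then (if h : x < n ∧ y = 0 then P ⟨x, h.1⟩ else 0)
    else 0

/-- The template stored in the arrays `b, …, b + 6`: matrices of the unsafe edges (`b`) and of
the co-live edges (`b + 1`); the number `K` of conditional live-groups (`b + 2`) and the condition
set of each of them (`b + 3`); the number `M` of live-groups (`b + 4`), for each of them the index of
the conditional live-group that contains it (`b + 5`) and the matrix of its edges (`b + 6`). -/
def readTemplate (n : ℕ) (s : Store) (b : ℕ) : Template (Fin n) where
  S := {e | s b e.1 e.2 0 ≠ 0}
  D := {e | s (b + 1) e.1 e.2 0 ≠ 0}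
  H := {c | ∃ k < s (b + 2) 0 0 0,
    c = ({v : Fin n | s (b + 3) k v 0 ≠ 0},
      {A | ∃ g < s (b + 4) 0 0 0, s (b + 5) g 0 0 = k ∧
        A = {e : Fin n × Fin n | s (b + 6) g e.1 e.2 ≠ 0}})}

/-- The output `(Ψ, Π)` in a final store. -/
def output (n : ℕ) (s : Store) : Template (Fin n) × Template (Fin n) :=
  (readTemplate n s 5, readTemplate n s 12)

end Ram

/-! Everything rests on a recursion over induced subgraphs `X` with the invariant `CoopClosed`:
every vertex of `X` starts a parity path inside `X`. It holds for the cooperative region `Z` and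
passes to the rest of each level (`CoopClosed.restSet`). On paths inside the rest the largest
priority `d` is not seen infinitely often, so merging it into `0` does not change the objective.

Sufficiency (`mem_parity_of_computeSets`). At an odd level the sets `U` of CoLive form layers around
the rest. Edges that are not co-live lead from every layer to a lower one and never leave the rest,
so a path that finally avoids co-live edges ends up in the rest. At an even level the rest is closed
under successors, so a path either enters it for good or stays in `W` forever. In the second case
the live-groups of both players pull the path back, one attractor layer after the other, to the even
priorities above each recurring odd one (`infOften_target`).

Permissiveness (`mem_lang_of_mem_parity`). At an odd level a parity path is finally inside the rest,
where no edge is co-live for this level. At an even level it recurs to the target of every condition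
that is met. It then keeps entering, or finally never leaves, each attractor-closed `U`, and only
the other player can enter such a set from outside (`mem_liveLang_liveAssump`).

Implementability (`computeSets_compatible`, `winRegion_lang_eq_univ`). No edge of a live-group is
unsafe or co-live in the same template, and every vertex has an edge that is neither. A strategy
that takes each allowed edge of a vertex again and again follows the template.

Running time. Call a vertex good if its priority is even and it lies on a cycle without larger
priorities. Both kinds of cooperative regions are then backward reachability from good vertices.
Good vertices are computed once, by `n` reachability queries of cubic cost, and `GoodInv.restSet`
shows that they remain correct at all levels. A level costs `(n + 1) ^ 3 * (2 * |W| + 1)` up to a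
constant, where `W` is the set that it removes. These sets are disjoint, and each level gives
priority `0` to a further vertex, so the levels together are quartic (`levelPot_restSet`). -/

/-! ## Infinite sequences over a finite set -/

section Sequences

variable {V : Type u}

/-- The sequence is eventually in the set. -/
def EventuallyIn (X : Set V) (ρ : ℕ → V) : Prop :=
  ∃ N, ∀ k, N ≤ k → ρ k ∈ X

theorem InfOften.mono {A B : Set V} {ρ : ℕ → V} (hA : InfOften A ρ) (h : A ⊆ B) :
    InfOften B ρ := fun N => by
  obtain ⟨k, hk, hk'⟩ := hA N
  exact ⟨k, hk, h hk'⟩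

theorem not_infOften {A : Set V} {ρ : ℕ → V} : ¬ InfOften A ρ ↔ EventuallyIn Aᶜ ρ := by
  simp [InfOften, EventuallyIn]

theorem EventuallyIn.mono {A B : Set V} {ρ : ℕ → V} (hA : EventuallyIn A ρ) (h : A ⊆ B) :
    EventuallyIn B ρ := by
  obtain ⟨N, hN⟩ := hA
  exact ⟨N, fun k hk => h (hN k hk)⟩

theorem InfOften.inter {A B : Set V} {ρ : ℕ → V} (hA : InfOften A ρ)
    (hB : EventuallyIn B ρ) : InfOften (A ∩ B) ρ := by
  intro N
  obtain ⟨M, hM⟩ := hB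
  obtain ⟨k, hk, hk'⟩ := hA (max N M)
  exact ⟨k, by omega, hk', hM k (by omega)⟩

theorem InfOften.exists_mem {A : Set V} {ρ : ℕ → V} (hA : InfOften A ρ) : ∃ k, ρ k ∈ A := by
  obtain ⟨k, -, h⟩ := hA 0
  exact ⟨k, h⟩

/-- Each vertex of `A` has a bound on its visits, and finitely many bounds have a maximum. This is
the pigeonhole principle behind all arguments on recurring vertices and edges. -/
theorem exists_eventually_ne_of_finite [Finite V] {A : Set V} {ρ : ℕ → V}
    (h : ∀ v ∈ A, ¬ InfOften {v} ρ) : ¬ InfOften A ρ := by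
  have h' : ∀ v, ∃ N, v ∈ A → ∀ k, N ≤ k → ρ k ≠ v := fun v => by
    by_cases hv : v ∈ A
    · obtain ⟨N, hN⟩ := not_infOften.1 (h v hv)
      exact ⟨N, fun _ k hk => hN k hk⟩
    · exact ⟨0, fun h => absurd h hv⟩
  choose N hN using h'
  obtain ⟨M, hM⟩ := (Set.finite_range N).bddAbove
  intro hA
  obtain ⟨k, hk, hk'⟩ := hA M
  exact hN (ρ k) hk' k ((hM ⟨_, rfl⟩).trans hk) rfl

theorem InfOften.exists_vertex [Finite V] {A : Set V} {ρ : ℕ → V} (hA : InfOften A ρ) :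
    ∃ v ∈ A, InfOften {v} ρ := by
  by_contra! h
  exact exists_eventually_ne_of_finite h hA

theorem infOften_shift {A : Set V} {ρ : ℕ → V} (N : ℕ) :
    InfOften A (fun k => ρ (k + N)) ↔ InfOften A ρ := by
  constructor
  · intro h M
    obtain ⟨k, hk, hk'⟩ := h M
    exact ⟨k + N, by omega, hk'⟩
  · intro h M
    obtain ⟨k, hk, hk'⟩ := h (M + N)
    refine ⟨k - N, by omega, ?_⟩
    simpa [Nat.sub_add_cancel (show N ≤ k by omega)] using hk'

/-- The objective does not depend on finite prefixes. -/
def TailClosed (Φ : Set (ℕ → V)) : Prop :=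
  ∀ ρ N, (fun k => ρ (k + N)) ∈ Φ ↔ ρ ∈ Φ

theorem tailClosed_infOften (A : Set V) : TailClosed {ρ | InfOften A ρ} :=
  fun _ N => infOften_shift N

theorem tailClosed_parity (P : V → ℕ) : TailClosed (Parity P) := fun ρ N => by
  simp only [Parity, Set.mem_ofPred_eq, infOften_shift]

/-- On sequences that satisfy the parity objective, the largest priority seen infinitely often
is even. -/
theorem exists_even_max_of_mem_parity [Finite V] {P : V → ℕ} {ρ : ℕ → V} (h : ρ ∈ Parity P) :
    ∃ v, Even (P v) ∧ InfOften {v} ρ ∧ EventuallyIn {w | P w ≤ P v} ρ := by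
  have hne : {v | InfOften {v} ρ}.Nonempty := by
    obtain ⟨v, -, hv⟩ := InfOften.exists_vertex (A := Set.univ) (ρ := ρ) (fun N => ⟨N, le_rfl, trivial⟩)
    exact ⟨v, hv⟩
  obtain ⟨v, hv, hmax⟩ := Set.exists_max_image _ P (Set.toFinite {v | InfOften {v} ρ}) hne
  refine ⟨v, ?_, hv, ?_⟩
  · by_contra ho
    obtain ⟨b, hb, -, hb'⟩ := h (P v) (Nat.not_even_iff_odd.1 ho) (hv.mono (by simp))
    obtain ⟨w, hw, hw'⟩ := hb'.exists_vertex
    have := hmax w hw'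
    simp only [Set.mem_ofPred_eq] at hw
    omega
  · have : ¬ InfOften {w | P v < P w} ρ := by
      refine exists_eventually_ne_of_finite fun w hw hw' => ?_
      have := hmax w hw'
      simp only [Set.mem_ofPred_eq] at hw
      omega
    exact (not_infOften.1 this).mono fun w hw => by simpa using hw

/-- A recurring odd priority is met after the bound `P v` has set in, and it differs from `P v` by
parity. So `P v` is the larger even priority. -/
theorem mem_parity_of_even_max {P : V → ℕ} {ρ : ℕ → V} {v : V} (he : Even (P v))
    (hv : InfOften {v} ρ) (hle : EventuallyIn {w | P w ≤ P v} ρ) : ρ ∈ Parity P := by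
  intro a ha hinf
  refine ⟨P v, ?_, he, hv.mono (by simp)⟩
  obtain ⟨k, hk, hk'⟩ := (hinf.inter hle).exists_mem
  simp only [Set.mem_ofPred_eq] at hk hk'
  rcases (hk ▸ hk' : a ≤ P v).lt_or_eq with h | h
  · exact h
  · exact absurd he (Nat.not_even_iff_odd.2 (h ▸ ha))

end Sequences

theorem owner_eq_or {V : Type u} (G : GameGraph V) (a : Fin 2) (v : V) :
    G.owner v = a ∨ G.owner v = 1 - a := by
  generalize G.owner v = b
  revert a b; decide

namespace GameGraph

variable {V : Type u} {G : GameGraph V}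

/-! ## Cooperative regions -/

/-- `ρ` is an infinite path of `G|_X`. -/
def PathIn (G : GameGraph V) (X : Set V) (ρ : ℕ → V) : Prop :=
  ∀ k, (ρ k, ρ (k + 1)) ∈ G.edgesIn X

theorem PathIn.mem {X : Set V} {ρ : ℕ → V} (h : G.PathIn X ρ) (k : ℕ) : ρ k ∈ X := (h k).1

theorem PathIn.shift {X : Set V} {ρ : ℕ → V} (h : G.PathIn X ρ) (N : ℕ) :
    G.PathIn X (fun k => ρ (k + N)) := fun k => by
  have := h (k + N)
  rwa [show k + N + 1 = k + 1 + N by omega] at this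

theorem PathIn.mono {X Y : Set V} {ρ : ℕ → V} (h : G.PathIn X ρ) (hY : ∀ k, ρ k ∈ Y) :
    G.PathIn Y ρ := fun k => ⟨hY _, hY _, (h k).2.2⟩

theorem IsPlay.pathIn {X : Set V} {ρ : ℕ → V} (h : G.IsPlay ρ) (hX : ∀ k, ρ k ∈ X) :
    G.PathIn X ρ := fun k => ⟨hX _, hX _, h k⟩

theorem edgesIn_mono {X Y : Set V} (h : X ⊆ Y) : G.edgesIn X ⊆ G.edgesIn Y :=
  fun _ he => ⟨h he.1, h he.2.1, he.2.2⟩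

theorem mem_coopRegionIn_of_pathIn {X : Set V} {Φ : Set (ℕ → V)} (hΦ : TailClosed Φ) {ρ : ℕ → V}
    (h : G.PathIn X ρ) (hρ : ρ ∈ Φ) (k : ℕ) : ρ k ∈ G.coopRegionIn X Φ :=
  ⟨fun j => ρ (j + k), by simp, h.shift k, (hΦ ρ k).2 hρ⟩

theorem coopRegionIn_subset {X : Set V} {Φ : Set (ℕ → V)} : G.coopRegionIn X Φ ⊆ X := by
  rintro _ ⟨ρ, rfl, h, -⟩
  exact (h 0).1

/-- Prepending the edge to a witness gives a witness, since tail-closed objectives ignore the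
additional first vertex. -/
theorem coopRegionIn_of_edge {X : Set V} {Φ : Set (ℕ → V)} (hΦ : TailClosed Φ) {v w : V}
    (he : (v, w) ∈ G.edgesIn X) (hw : w ∈ G.coopRegionIn X Φ) : v ∈ G.coopRegionIn X Φ := by
  obtain ⟨ρ, rfl, h, hρ⟩ := hw
  refine ⟨fun k => Nat.casesOn k v ρ, rfl, ?_, ?_⟩
  · rintro (_ | k)
    · exact he
    · exact h k
  · exact (hΦ _ 1).1 hρ

/-- All suffixes of a witness are witnesses, so it never leaves its region. This is why the
recursion can work in induced subgraphs in spite of possible dead ends. -/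
theorem pathIn_coopRegionIn {X : Set V} {Φ : Set (ℕ → V)} (hΦ : TailClosed Φ) {ρ : ℕ → V}
    (h : G.PathIn X ρ) (hρ : ρ ∈ Φ) : G.PathIn (G.coopRegionIn X Φ) ρ :=
  h.mono (mem_coopRegionIn_of_pathIn hΦ h hρ)

/-- From every vertex of `X`, the parity objective can be satisfied within `X`. -/
def CoopClosed (G : GameGraph V) (X : Set V) (P : V → ℕ) : Prop :=
  ∀ v ∈ X, ∃ ρ, ρ 0 = v ∧ G.PathIn X ρ ∧ ρ ∈ Parity P

theorem coopClosed_coopRegionIn (X : Set V) (P : V → ℕ) :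
    G.CoopClosed (G.coopRegionIn X (Parity P)) P := by
  rintro v ⟨ρ, rfl, h, hρ⟩
  exact ⟨ρ, rfl, pathIn_coopRegionIn (tailClosed_parity P) h hρ, hρ⟩

theorem CoopClosed.exists_edge {X : Set V} {P : V → ℕ} (h : G.CoopClosed X P) {v : V}
    (hv : v ∈ X) : ∃ w, (v, w) ∈ G.edgesIn X := by
  obtain ⟨ρ, rfl, hρ, -⟩ := h v hv
  exact ⟨_, hρ 0⟩

/-! ## The levels of `ComputeSets` -/

section Levels

variable {X : Set V} {P : V → ℕ}

theorem le_maxPrio [Finite V] {v : V} (hv : v ∈ X) : P v ≤ maxPrio P X :=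
  le_csSup (Set.toFinite _).bddAbove ⟨v, hv, rfl⟩

theorem exists_eq_maxPrio [Finite V] (h : 0 < maxPrio P X) : ∃ v ∈ X, P v = maxPrio P X := by
  rcases (P '' X).eq_empty_or_nonempty with he | hne
  · simp [maxPrio, he] at h
  · obtain ⟨v, hv, hv'⟩ := Nat.sSup_mem hne (Set.toFinite _).bddAbove
    exact ⟨v, hv, hv'⟩

theorem maxPrio_le [Finite V] {d : ℕ} (h : ∀ v ∈ X, P v ≤ d) : maxPrio P X ≤ d := by
  rcases Nat.eq_zero_or_pos (maxPrio P X) with h0 | h0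
  · omega
  · obtain ⟨v, hv, hv'⟩ := exists_eq_maxPrio h0
    exact hv' ▸ h v hv

theorem restSet_odd (h : Odd (maxPrio P X)) :
    G.restSet X P = G.coopRegionIn (X \ {v | P v = maxPrio P X}) (Parity P) := if_pos h

theorem restSet_even (h : ¬ Odd (maxPrio P X)) :
    G.restSet X P = X \ G.coopRegionIn X {ρ | InfOften {v | P v = maxPrio P X} ρ} := if_neg h

/-- The vertices settled at an even level. -/
theorem diff_restSet_even (h : ¬ Odd (maxPrio P X)) :
    X \ G.restSet X P = G.coopRegionIn X {ρ | InfOften {v | P v = maxPrio P X} ρ} := by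
  rw [restSet_even h, Set.sdiff_sdiff_cancel_left coopRegionIn_subset]

/-- The Büchi region is closed under predecessors within `X`, so its complement is closed under
successors. -/
theorem mem_restSet_of_edge (h : ¬ Odd (maxPrio P X)) {v w : V} (he : (v, w) ∈ G.edgesIn X)
    (hv : v ∈ G.restSet X P) : w ∈ G.restSet X P := by
  rw [restSet_even h] at hv ⊢
  exact ⟨he.2.1, fun hw => hv.2 (coopRegionIn_of_edge (tailClosed_infOften _) he hw)⟩

theorem PathIn.mem_restSet (h : ¬ Odd (maxPrio P X)) {ρ : ℕ → V} (hρ : G.PathIn X ρ) {N : ℕ}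
    (hN : ρ N ∈ G.restSet X P) : ∀ k, N ≤ k → ρ k ∈ G.restSet X P := by
  intro k hk
  induction k, hk using Nat.le_induction with
  | base => exact hN
  | succ k _ ih => exact mem_restSet_of_edge h (hρ k) ih

/-- Such a path would witness that its own first vertex belongs to the Büchi region, which was
removed. -/
theorem PathIn.not_infOften_max (h : ¬ Odd (maxPrio P X)) {ρ : ℕ → V}
    (hρ : G.PathIn (G.restSet X P) ρ) : ¬ InfOften {v | P v = maxPrio P X} ρ := by
  intro hinf
  have h0 := hρ.mem 0
  rw [restSet_even h] at h0
  exact h0.2 ⟨ρ, rfl, hρ.mono fun k => G.restSet_subset X P (hρ.mem k), hinf⟩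

theorem mergePrio_of_ne {d : ℕ} {v : V} (h : P v ≠ d) : mergePrio P d v = P v := if_neg h

/-- Priority `0` is excluded because it collects the original zeros together with the merged
vertices. -/
theorem mergePrio_eq_iff {d a : ℕ} {v : V} (ha : a ≠ 0) :
    mergePrio P d v = a ↔ P v = a ∧ a ≠ d := by
  unfold mergePrio
  split_ifs with h
  · constructor
    · intro h'; omega
    · rintro ⟨h', h''⟩; omega
  · constructor
    · rintro rfl; exact ⟨rfl, h⟩
    · exact And.left

theorem restSet_ne_max_of_odd (h : Odd (maxPrio P X)) {v : V} (hv : v ∈ G.restSet X P) :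
    P v ≠ maxPrio P X := by
  rw [restSet_odd h] at hv
  exact (coopRegionIn_subset hv).2

theorem PathIn.not_infOften_maxPrio {ρ : ℕ → V} (hρ : G.PathIn (G.restSet X P) ρ) :
    ¬ InfOften {v | P v = maxPrio P X} ρ := by
  by_cases h : Odd (maxPrio P X)
  · intro hinf
    obtain ⟨k, hk⟩ := hinf.exists_mem
    exact restSet_ne_max_of_odd h (hρ.mem k) hk
  · exact hρ.not_infOften_max h

/-- On paths of the rest, merging the largest priority does not change the parity objective. -/
theorem PathIn.mem_parity_mergePrio_iff {ρ : ℕ → V} (hρ : G.PathIn (G.restSet X P) ρ) :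
    ρ ∈ Parity (mergePrio P (maxPrio P X)) ↔ ρ ∈ Parity P := by
  have hd := hρ.not_infOften_maxPrio
  have key : ∀ a, a ≠ 0 → (InfOften {v | mergePrio P (maxPrio P X) v = a} ρ ↔
      InfOften {v | P v = a} ρ) := by
    intro a ha
    simp only [mergePrio_eq_iff ha]
    by_cases h : a = maxPrio P X
    · simp only [h, ne_eq, not_true_eq_false, and_false, hd, iff_false]
      intro h
      obtain ⟨k, hk⟩ := h.exists_mem
      exact hk
    · simp [h]
  unfold Parity
  simp only [Set.mem_ofPred_eq]
  refine forall_congr' fun a => forall_congr' fun ha => ?_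
  -- The objective never looks at priority `0`: `a` is odd, and `b` is larger than `a`.
  rw [key a (by rintro rfl; simp at ha)]
  refine imp_congr Iff.rfl (exists_congr fun b => and_congr_right fun hb => and_congr_right fun _ => ?_)
  rw [key b (by omega)]

/-- At an odd level the path that puts a vertex into the rest stays there. At an even level the old
witness stays there, because the rest is closed under successors. -/
theorem CoopClosed.restSet (h : G.CoopClosed X P) :
    G.CoopClosed (G.restSet X P) (mergePrio P (maxPrio P X)) := by
  intro v hv
  by_cases hd : Odd (maxPrio P X)
  · have hv' := hv
    rw [restSet_odd hd] at hv'
    obtain ⟨ρ, rfl, hρ, hp⟩ := hv'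
    have := pathIn_coopRegionIn (tailClosed_parity P) hρ hp
    rw [← restSet_odd hd] at this
    exact ⟨ρ, rfl, this, this.mem_parity_mergePrio_iff.2 hp⟩
  · obtain ⟨ρ, rfl, hρ, hp⟩ := h v (G.restSet_subset X P hv)
    have := hρ.mono fun k => hρ.mem_restSet hd hv k (Nat.zero_le k)
    exact ⟨ρ, rfl, this, this.mem_parity_mergePrio_iff.2 hp⟩

/-- The largest priority drops in every recursive call. As in the recursion itself, nothing is
provided for the rest when the largest priority is `0`. -/
theorem computeSets_induction [Finite V] (G : GameGraph V) {motive : Set V → (V → ℕ) → Prop}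
    (h : ∀ X P, (0 < maxPrio P X → motive (G.restSet X P) (mergePrio P (maxPrio P X))) →
      motive X P) (X : Set V) (P : V → ℕ) : motive X P := by
  induction hm : maxPrio P X using Nat.strong_induction_on generalizing X P with
  | _ m ih =>
    refine h X P fun h0 => ih _ ?_ _ _ rfl
    rw [← hm]
    exact G.maxPrio_mergePrio_lt X P h0

end Levels

end GameGraph

namespace GameGraph

variable {V : Type u} {G : GameGraph V}

/-! ## Co-live edges -/

section CoLive

variable {X : Set V} {P : V → ℕ}

theorem coLiveIter_mono {I : Set V} : Monotone (G.coLiveIter X I) :=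
  monotone_nat_of_le_succ fun _ => Set.subset_union_left

/-- By closedness each vertex of the rest has an infinite path inside it, so the safety region with
which CoLive starts is all of the rest. -/
theorem coLiveIter_zero (h : G.CoopClosed X P) :
    G.coLiveIter X (G.restSet X P) 0 = G.restSet X P := by
  ext v
  constructor
  · rintro ⟨ρ, rfl, -, h'⟩
    exact h' 0
  · intro hv
    obtain ⟨ρ, rfl, hρ, -⟩ := h.restSet v hv
    exact ⟨ρ, rfl, hρ.mono fun k => G.restSet_subset X P (hρ.mem k), hρ.mem⟩

/-- Walking backwards along the path costs one round of CoLive per edge. -/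
theorem mem_coLiveIter_of_path {I : Set V} {ρ : ℕ → V} (hρ : G.PathIn X ρ) {N : ℕ}
    (hN : ρ N ∈ G.coLiveIter X I 0) : ρ 0 ∈ G.coLiveIter X I N := by
  have : ∀ j, j ≤ N → ρ (N - j) ∈ G.coLiveIter X I j := by
    intro j hj
    induction j with
    | zero => exact hN
    | succ j ih =>
      refine Or.inr ⟨_, ih (by omega), ?_⟩
      have := hρ (N - (j + 1))
      rwa [show N - (j + 1) + 1 = N - j by omega] at this
  simpa using this N le_rfl

/-- There is no even priority above the largest one to answer a recurring odd maximum. -/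
theorem eventually_ne_max_of_mem_parity [Finite V] (hd : Odd (maxPrio P X)) {ρ : ℕ → V}
    (hρ : G.PathIn X ρ) (hp : ρ ∈ Parity P) : EventuallyIn {v | P v = maxPrio P X}ᶜ ρ := by
  rw [← not_infOften]
  intro hinf
  obtain ⟨b, hb, -, hb'⟩ := hp _ hd hinf
  obtain ⟨k, hk⟩ := hb'.exists_mem
  have := le_maxPrio (P := P) (hρ.mem k)
  simp only [Set.mem_ofPred_eq] at hk
  omega

/-- After the last visit to the largest priority the remaining path is a parity path of the graph
without it, so all its vertices belong to the region that defines the rest. -/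
theorem eventuallyIn_restSet_of_mem_parity [Finite V] (hd : Odd (maxPrio P X)) {ρ : ℕ → V}
    (hρ : G.PathIn X ρ) (hp : ρ ∈ Parity P) : EventuallyIn (G.restSet X P) ρ := by
  obtain ⟨N, hN⟩ := eventually_ne_max_of_mem_parity hd hρ hp
  refine ⟨N, fun k hk => ?_⟩
  rw [restSet_odd hd]
  have h1 : G.PathIn (X \ {v | P v = maxPrio P X}) fun j => ρ (j + N) :=
    (hρ.shift N).mono fun j => ⟨hρ.mem _, hN _ (by omega)⟩
  have := mem_coopRegionIn_of_pathIn (tailClosed_parity P) h1 ((tailClosed_parity P ρ N).2 hp)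
    (k - N)
  simpa [Nat.sub_add_cancel hk] using this

theorem exists_mem_coLiveIter [Finite V] (h : G.CoopClosed X P) (hd : Odd (maxPrio P X)) {v : V}
    (hv : v ∈ X) : ∃ k, v ∈ G.coLiveIter X (G.restSet X P) k := by
  obtain ⟨ρ, rfl, hρ, hp⟩ := h v hv
  obtain ⟨N, hN⟩ := eventuallyIn_restSet_of_mem_parity hd hρ hp
  exact ⟨N, mem_coLiveIter_of_path hρ (by rw [coLiveIter_zero h]; exact hN N le_rfl)⟩

theorem mem_coLiveIter_of_not_coLive {I : Set V} {e : V × V} (he : e ∈ G.edgesIn X)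
    (he' : e ∉ G.coLiveEdges X I) {k : ℕ} (hk : e.1 ∈ G.coLiveIter X I k) :
    e.2 ∈ G.coLiveIter X I k := by
  by_contra h
  exact he' ⟨he, k, Or.inl ⟨hk, h⟩⟩

/-- Not leaving the set of round `k + 1` and not staying among the vertices added in that round
leaves only the set of round `k`. -/
theorem mem_coLiveIter_pred_of_not_coLive {I : Set V} {e : V × V} (he : e ∈ G.edgesIn X)
    (he' : e ∉ G.coLiveEdges X I) {k : ℕ} (hk : e.1 ∈ G.coLiveIter X I (k + 1))
    (hk' : e.1 ∉ G.coLiveIter X I k) : e.2 ∈ G.coLiveIter X I k := by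
  by_contra h
  have h1 := hk.resolve_left hk'
  have h2 := (mem_coLiveIter_of_not_coLive he he' hk).resolve_left h
  exact he' ⟨he, k, Or.inr ⟨⟨h1, hk'⟩, h2, h⟩⟩

/-- The layer index is a rank: it falls at every step until layer `0` is reached, and layer `0` is
never left. -/
theorem eventuallyIn_of_not_coLive {I : Set V} {ρ : ℕ → V} (hρ : G.PathIn X ρ)
    (h : ∀ k, (ρ k, ρ (k + 1)) ∉ G.coLiveEdges X I) {k : ℕ} {N : ℕ}
    (hk : ρ N ∈ G.coLiveIter X I k) : EventuallyIn (G.coLiveIter X I 0) ρ := by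
  induction k generalizing N with
  | zero =>
    refine ⟨N, fun m hm => ?_⟩
    induction m, hm using Nat.le_induction with
    | base => exact hk
    | succ m _ ih => exact mem_coLiveIter_of_not_coLive (hρ m) (h m) ih
  | succ k ih =>
    by_cases hk' : ρ N ∈ G.coLiveIter X I k
    · exact ih hk'
    · exact ih (mem_coLiveIter_pred_of_not_coLive (hρ N) (h N) hk hk')

/-- The edge is the one that brought `v` into the first layer set containing it. Its target lies in
an earlier set, so it neither leaves a set `U` nor joins two new vertices. -/
theorem exists_edge_not_coLive {I : Set V} {v : V} (hv : ∃ k, v ∈ G.coLiveIter X I k)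
    (hv' : v ∉ G.coLiveIter X I 0) : ∃ w, (v, w) ∈ G.edgesIn X ∧ (v, w) ∉ G.coLiveEdges X I := by
  classical
  obtain ⟨k, hk⟩ : ∃ k, Nat.find hv = k + 1 := Nat.exists_eq_succ_of_ne_zero fun h0 =>
    hv' (h0 ▸ Nat.find_spec hv)
  have h1 : v ∈ G.coLiveIter X I (k + 1) := hk ▸ Nat.find_spec hv
  have h2 : ∀ j, v ∈ G.coLiveIter X I j → k + 1 ≤ j := fun j hj => hk ▸ Nat.find_min' hv hj
  have h3 : v ∉ G.coLiveIter X I k := fun h => by have := h2 k h; omega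
  obtain ⟨w, hw, he⟩ := h1.resolve_left h3
  refine ⟨w, he, ?_⟩
  rintro ⟨-, j, ⟨hj, hj'⟩ | ⟨⟨hj, hj'⟩, -, hj''⟩⟩
  · exact hj' (coLiveIter_mono (by have := h2 j hj; omega) hw)
  · have := h2 (j + 1) (Or.inr hj)
    exact hj'' (coLiveIter_mono (by omega) hw)

/-- The rest is contained in every set `U` of CoLive, so its vertices are never new and edges inside
it leave no `U`. -/
theorem not_coLive_of_mem_restSet (h : G.CoopClosed X P) {e : V × V}
    (h1 : e.1 ∈ G.restSet X P) (h2 : e.2 ∈ G.restSet X P) :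
    e ∉ G.coLiveEdges X (G.restSet X P) := by
  rw [← coLiveIter_zero h] at h1 h2
  rintro ⟨-, j, ⟨-, hj⟩ | ⟨⟨-, hj⟩, -⟩⟩
  · exact hj (coLiveIter_mono (Nat.zero_le j) h2)
  · exact hj (coLiveIter_mono (Nat.zero_le j) h1)

end CoLive

/-! ## Live-groups -/

section LiveGroups

variable {X T : Set V} {i : Fin 2}

theorem cpre_subset {a : Fin 2} {U : Set V} : G.cpre X a U ⊆ X := fun _ h => h.1

theorem cpreIter_mono {a : Fin 2} {U : Set V} : Monotone (G.cpreIter X a U) :=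
  monotone_nat_of_le_succ fun _ => Set.subset_union_right

/-- The attractor omits its target and starts with step `j + 1`. With the target restored it is the
union of the whole increasing sequence, which is easier to use. -/
theorem union_attr (a : Fin 2) (U : Set V) :
    U ∪ G.attr X a U = ⋃ j, G.cpreIter X a U j := by
  ext v
  simp only [attr, Set.mem_union, Set.mem_sdiff, Set.mem_iUnion]
  constructor
  · rintro (h | ⟨⟨j, h⟩, -⟩)
    · exact ⟨0, h⟩
    · exact ⟨j + 1, h⟩
  · rintro ⟨j, h⟩
    by_cases hv : v ∈ U
    · exact Or.inl hv
    · exact Or.inr ⟨⟨j, cpreIter_mono (Nat.le_succ j) h⟩, hv⟩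

theorem cpreIter_subset {a : Fin 2} {U : Set V} (hU : U ⊆ X) (j : ℕ) :
    G.cpreIter X a U j ⊆ X := by
  induction j with
  | zero => exact hU
  | succ j ih => exact Set.union_subset cpre_subset ih

theorem union_attr_subset {a : Fin 2} {U : Set V} (hU : U ⊆ X) : U ∪ G.attr X a U ⊆ X := by
  rw [union_attr]
  exact Set.iUnion_subset (cpreIter_subset hU)

theorem liveIter_subset (hT : T ⊆ X) (k : ℕ) : G.liveIter X i T k ⊆ X := by
  induction k with
  | zero => exact hT
  | succ k ih => exact Set.union_subset (union_attr_subset ih) cpre_subset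

theorem liveIter_mono : Monotone (G.liveIter X i T) :=
  monotone_nat_of_le_succ fun _ _ h => Or.inl (Or.inl h)

/-- A vertex outside an attractor that has an edge into it belongs to the other player. -/
theorem owner_of_edge_into_attr {U : Set V} {v w : V} (he : (v, w) ∈ G.edgesIn X)
    (hv : v ∉ U ∪ G.attr X i U) (hw : w ∈ U ∪ G.attr X i U) : G.owner v = 1 - i := by
  rw [union_attr] at hv hw
  refine (owner_eq_or G i v).resolve_left fun ho => hv ?_
  obtain ⟨j, hj⟩ := Set.mem_iUnion.1 hw
  exact Set.mem_iUnion.2 ⟨j + 1, Or.inl ⟨he.1, Or.inl ⟨ho, w, hj, he⟩⟩⟩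

theorem exists_crossing {U : Set V} {ρ : ℕ → V} {k m : ℕ} (hkm : k ≤ m) (hk : ρ k ∉ U)
    (hm : ρ m ∈ U) : ∃ j, k ≤ j ∧ j < m ∧ ρ j ∉ U ∧ ρ (j + 1) ∈ U := by
  induction m, hkm using Nat.le_induction with
  | base => exact absurd hm hk
  | succ m hkm ih =>
    by_cases h : ρ m ∈ U
    · obtain ⟨j, h1, h2, h3⟩ := ih h
      exact ⟨j, h1, by omega, h3⟩
    · exact ⟨m, hkm, by omega, h, hm⟩

/-- Every vertex of `X` has a path within `X` to `T`. -/
def AllReach (G : GameGraph V) (X T : Set V) : Prop :=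
  ∀ v ∈ X, ∃ ρ, ρ 0 = v ∧ G.PathIn X ρ ∧ ∃ k, ρ k ∈ T

/-- Consider the first edge found to enter the current set on a path to the target. Its source is in
the attractor of player `i`, or it belongs to the other player and this very edge makes it a
controllable predecessor. -/
theorem exists_mem_liveIter_succ (hr : G.AllReach X T) (hT : T ⊆ X) {k : ℕ}
    (h : G.liveIter X i T k ≠ X) : ∃ v ∈ G.liveIter X i T (k + 1), v ∉ G.liveIter X i T k := by
  have hs := liveIter_subset (G := G) (i := i) hT k
  obtain ⟨v, hv, hv'⟩ := Set.exists_of_ssubset (hs.ssubset_of_ne h)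
  obtain ⟨ρ, rfl, hρ, m, hm⟩ := hr v hv
  obtain ⟨j, -, -, h1, h2⟩ := exists_crossing (Nat.zero_le m) hv'
    (liveIter_mono (Nat.zero_le k) hm)
  refine ⟨ρ j, ?_, h1⟩
  by_cases ha : ρ j ∈ G.liveIter X i T k ∪ G.attr X i (G.liveIter X i T k)
  · exact Or.inl ha
  · exact Or.inr ⟨hρ.mem j, Or.inl ⟨owner_of_edge_into_attr (hρ j) ha (Or.inl h2), _,
      Or.inl h2, hρ j⟩⟩

theorem exists_liveIter_eq [Finite V] (hr : G.AllReach X T) (hT : T ⊆ X) :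
    ∃ k, G.liveIter X i T k = X := by
  by_contra! h
  have : ∀ k, k ≤ (G.liveIter X i T k).ncard := by
    intro k
    induction k with
    | zero => exact Nat.zero_le _
    | succ k ih =>
      obtain ⟨v, hv, hv'⟩ := exists_mem_liveIter_succ hr hT (h k)
      exact ih.trans_lt (Set.ncard_lt_ncard
        ((Set.ssubset_iff_of_subset (liveIter_mono (Nat.le_succ k))).2 ⟨v, hv, hv'⟩)
        (Set.toFinite _))
  have h1 := this (X.ncard + 1)
  have h2 := Set.ncard_le_ncard (liveIter_subset (G := G) (i := i) hT (X.ncard + 1))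
    (Set.toFinite _)
  omega

theorem infOften_snd {A : Set (V × V)} {B : Set V} {ρ : ℕ → V} (h : InfOftenEdge A ρ)
    (hB : ∀ e ∈ A, e.2 ∈ B) : InfOften B ρ := fun N => by
  obtain ⟨k, hk, hk'⟩ := h N
  exact ⟨k + 1, by omega, hB _ hk'⟩

/-- One controllable predecessor recurs. If it belongs to `a`, it is a source of the group, so the
group forces edges into `B`. Otherwise all its edges within `X` lead to `B`, and the path takes one
of them. Stated for a general group `A`, this serves both players. -/
theorem infOften_of_infOften_cpre [Finite V] {a : Fin 2} {B : Set V} {A : Set (V × V)} {ρ : ℕ → V}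
    (hρ : G.PathIn X ρ) (h : InfOften (G.cpre X a B) ρ)
    (hA : InfOften (Prod.fst '' A) ρ → InfOftenEdge A ρ)
    (hA1 : ∀ e ∈ G.edgesIn X, G.owner e.1 = a → e.1 ∈ G.cpre X a B → e.2 ∈ B → e ∈ A)
    (hA2 : ∀ e ∈ A, e.2 ∈ B) : InfOften B ρ := by
  obtain ⟨v, hv, hinf⟩ := h.exists_vertex
  rcases hv.2 with ⟨ho, w, hw, he⟩ | ⟨-, hall⟩
  · refine infOften_snd (hA (hinf.mono ?_)) hA2
    rintro _ rfl
    exact ⟨(_, w), hA1 _ he ho hv hw, rfl⟩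
  · intro N
    obtain ⟨k, hk, rfl⟩ := hinf N
    exact ⟨k + 1, by omega, hall _ (hρ k)⟩

theorem infOften_of_infOften_cpreIter [Finite V] {a : Fin 2} {U : Set V} {ρ : ℕ → V}
    (hρ : G.PathIn X ρ) (hl : ρ ∈ Template.liveLang (G.attrGroups X a U)) {j : ℕ}
    (h : InfOften (G.cpreIter X a U j) ρ) : InfOften U ρ := by
  induction j with
  | zero => exact h
  | succ j ih =>
    apply ih
    obtain ⟨v, hv, hinf⟩ := h.exists_vertex
    rcases hv with hv | hv
    · refine infOften_of_infOften_cpre hρ (a := a)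
        (hinf.mono (Set.singleton_subset_iff.2 hv)) (hl _ ⟨j, rfl⟩) ?_ ?_
      · exact fun e he ho hc hB => ⟨he, ho, Or.inl hc, hB⟩
      · exact fun e he => he.2.2.2
    · exact hinf.mono (Set.singleton_subset_iff.2 hv)

/-- One round of Live is undone in reverse order: first the group of the other player, then the
attractor groups of player `i`. -/
theorem infOften_liveIter [Finite V] {ρ : ℕ → V} (hρ : G.PathIn X ρ)
    (hs : ρ ∈ Template.liveLang (G.liveStrat X i T))
    (ha : ρ ∈ Template.liveLang (G.liveAssump X i T)) {k : ℕ} (hk : G.liveIter X i T k ≠ X)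
    (h : InfOften (G.liveIter X i T (k + 1)) ρ) : InfOften (G.liveIter X i T k) ρ := by
  have hU : InfOften (G.liveIter X i T k ∪ G.attr X i (G.liveIter X i T k)) ρ := by
    obtain ⟨v, hv, hinf⟩ := h.exists_vertex
    rcases hv with hv | hv
    · exact hinf.mono (Set.singleton_subset_iff.2 hv)
    · refine infOften_of_infOften_cpre hρ (hinf.mono (Set.singleton_subset_iff.2 hv))
        (ha _ ⟨k, hk, _, rfl, rfl⟩) ?_ ?_
      · exact fun e he ho hc hB => ⟨he, ho, hc, hB⟩
      · exact fun e he => he.2.2.2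
  rw [union_attr] at hU
  obtain ⟨v, hv, hinf⟩ := hU.exists_vertex
  obtain ⟨j, hj⟩ := Set.mem_iUnion.1 hv
  exact infOften_of_infOften_cpreIter hρ (fun A hA => hs A ⟨k, hk, hA⟩)
    (hinf.mono (Set.singleton_subset_iff.2 hj))

/-- Plays that satisfy the live-groups visit the target infinitely often. -/
theorem infOften_target [Finite V] (hr : G.AllReach X T) (hT : T ⊆ X) {ρ : ℕ → V}
    (hρ : G.PathIn X ρ) (hs : ρ ∈ Template.liveLang (G.liveStrat X i T))
    (ha : ρ ∈ Template.liveLang (G.liveAssump X i T)) : InfOften T ρ := by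
  classical
  have hex := exists_liveIter_eq (i := i) hr hT
  have key : ∀ k, k ≤ Nat.find hex → InfOften (G.liveIter X i T k) ρ → InfOften T ρ := by
    intro k
    induction k with
    | zero => exact fun _ h => h
    | succ k ih =>
      exact fun hk h => ih (by omega) (infOften_liveIter hρ hs ha (Nat.find_min hex (by omega)) h)
  refine key _ le_rfl ?_
  rw [Nat.find_spec hex]
  exact fun N => ⟨N, le_rfl, hρ.mem N⟩

/-- Plays that visit the target infinitely often satisfy the assumed live-groups. -/
theorem mem_liveLang_liveAssump {ρ : ℕ → V} (hρ : G.PathIn X ρ) (h : InfOften T ρ) :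
    ρ ∈ Template.liveLang (G.liveAssump X i T) := by
  rintro A ⟨k, -, U, hU, rfl⟩ hsrc
  have hTU : InfOften U ρ := h.mono <| hU ▸
    (liveIter_mono (Nat.zero_le k)).trans Set.subset_union_left
  intro N
  -- If `U` is left again and again, it is entered again and again, and every entering edge belongs
  -- to the group because its source lies outside an attractor of player `i`. Otherwise all late
  -- edges end in `U`, and any late visit to a source takes an edge of the group.
  by_cases hev : InfOften Uᶜ ρ
  · obtain ⟨m, hm, hm'⟩ := hev N
    obtain ⟨m', hm'', hmU⟩ := hTU m
    obtain ⟨j, hj, -, h1, h2⟩ := exists_crossing hm'' hm' hmU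
    have ho : G.owner (ρ j) = 1 - i := by
      subst hU
      exact owner_of_edge_into_attr (hρ j) h1 h2
    exact ⟨j, by omega, hρ j, ho, ⟨hρ.mem j, Or.inl ⟨ho, _, h2, hρ j⟩⟩, h2⟩
  · obtain ⟨M, hM⟩ := not_infOften.1 hev
    obtain ⟨m, hm, e, he, hem⟩ := hsrc (max N M)
    refine ⟨m, by omega, hρ m, hem ▸ he.2.1, hem ▸ he.2.2.1, ?_⟩
    simpa using hM (m + 1) (by omega)

theorem liveStrat_edge {A : Set (V × V)} (hA : A ∈ G.liveStrat X i T) {e : V × V} (he : e ∈ A) :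
    e ∈ G.edgesIn X ∧ G.owner e.1 = i := by
  obtain ⟨k, -, j, rfl⟩ := hA
  exact ⟨he.1, he.2.1⟩

theorem liveAssump_edge {A : Set (V × V)} (hA : A ∈ G.liveAssump X i T) {e : V × V} (he : e ∈ A) :
    e ∈ G.edgesIn X ∧ G.owner e.1 = 1 - i := by
  obtain ⟨k, -, U, -, rfl⟩ := hA
  exact ⟨he.1, he.2.1⟩

end LiveGroups

end GameGraph

/-! ### Templates under shifts and inclusion -/

namespace Template

variable {V : Type u}

theorem coLiveLang_shift {D : Set (V × V)} {ρ : ℕ → V} (h : ρ ∈ coLiveLang D) (N : ℕ) :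
    (fun k => ρ (k + N)) ∈ coLiveLang D := fun e he => by
  obtain ⟨M, hM⟩ := h e he
  refine ⟨M, fun k hk => ?_⟩
  have := hM (k + N) (by omega)
  rwa [show k + N + 1 = k + 1 + N by omega] at this

theorem infOftenEdge_shift {A : Set (V × V)} {ρ : ℕ → V} (N : ℕ) :
    InfOftenEdge A (fun k => ρ (k + N)) ↔ InfOftenEdge A ρ := by
  have := infOften_shift (A := A) (ρ := fun k => (ρ k, ρ (k + 1))) N
  simp only [InfOften, InfOftenEdge, add_right_comm _ N 1] at this ⊢
  exact this

theorem condLang_shift {H : Set (Set V × Set (Set (V × V)))} {ρ : ℕ → V} (N : ℕ) :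
    (fun k => ρ (k + N)) ∈ condLang H ↔ ρ ∈ condLang H := by
  simp only [condLang, liveLang, Set.mem_ofPred_eq, infOften_shift, infOftenEdge_shift]

/-- There are only finitely many edges, so the individual bounds can be replaced by a common one. -/
theorem coLiveLang_iff [Finite V] {D : Set (V × V)} {ρ : ℕ → V} :
    ρ ∈ coLiveLang D ↔ ∃ N, ∀ k, N ≤ k → (ρ k, ρ (k + 1)) ∉ D := by
  constructor
  · intro h
    have : ¬ InfOften D fun k => (ρ k, ρ (k + 1)) :=
      exists_eventually_ne_of_finite fun e he => not_infOften.2 (h e he)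
    exact not_infOften.1 this
  · rintro ⟨N, hN⟩ e he
    exact ⟨N, fun k hk h => hN k hk (h ▸ he)⟩

theorem coLiveLang_anti {D D' : Set (V × V)} (h : D ⊆ D') : coLiveLang D' ⊆ coLiveLang D :=
  fun _ hρ e he => hρ e (h he)

theorem condLang_anti {H H' : Set (Set V × Set (Set (V × V)))} (h : H ⊆ H') :
    condLang H' ⊆ condLang H :=
  fun _ hρ c hc => hρ c (h hc)

end Template

/-! ### Sufficiency, permissiveness and compatibility of `computeSets` -/

namespace GameGraph

open Template

variable {V : Type u} {G : GameGraph V} {X : Set V} {P : V → ℕ} {i : Fin 2}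

theorem computeSets_of_pos [Finite V] (h : 0 < maxPrio P X) :
    G.computeSets i X P =
      ((G.levelTemplates i X P).1.conj
          (G.computeSets i (G.restSet X P) (mergePrio P (maxPrio P X))).1,
        (G.levelTemplates i X P).2.conj
          (G.computeSets i (G.restSet X P) (mergePrio P (maxPrio P X))).2) := by
  rw [computeSets, dif_pos h]

theorem computeSets_of_zero [Finite V] (h : ¬ 0 < maxPrio P X) :
    G.computeSets i X P = G.levelTemplates i X P := by
  rw [computeSets, dif_neg h]

theorem computeSets_coLive [Finite V] :
    (G.levelTemplates i X P).1.D ⊆ (G.computeSets i X P).1.D ∧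
    (G.levelTemplates i X P).2.D ⊆ (G.computeSets i X P).2.D ∧
    (G.levelTemplates i X P).1.H ⊆ (G.computeSets i X P).1.H ∧
    (G.levelTemplates i X P).2.H ⊆ (G.computeSets i X P).2.H := by
  by_cases h : 0 < maxPrio P X
  · rw [computeSets_of_pos h]
    exact ⟨Set.subset_union_left, Set.subset_union_left, Set.subset_union_left,
      Set.subset_union_left⟩
  · rw [computeSets_of_zero h]
    simp

/-- The target of the conditional live-group for the odd priority `l`. -/
def evenTarget (W : Set V) (P : V → ℕ) (l : ℕ) : Set V :=
  {v | v ∈ W ∧ Even (P v) ∧ l < P v}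

/-- A Büchi witness meets the largest priority `d` inside `W`. Since `d` is even and an occurring
odd `l` is at most `d`, it lies strictly above `l` and is a valid target. -/
theorem allReach_evenTarget [Finite V] (hd : ¬ Odd (maxPrio P X)) {l : ℕ} (hl : l ∈ P '' X)
    (hl' : Odd l) : G.AllReach (X \ G.restSet X P)
      (evenTarget (X \ G.restSet X P) P l) := by
  intro v hv
  rw [diff_restSet_even hd] at hv ⊢
  obtain ⟨ρ, rfl, hρ, hinf⟩ := hv
  have := pathIn_coopRegionIn (tailClosed_infOften _) hρ hinf
  refine ⟨ρ, rfl, this, ?_⟩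
  obtain ⟨k, hk⟩ := InfOften.exists_mem hinf
  simp only [Set.mem_ofPred_eq] at hk
  obtain ⟨x, hx, rfl⟩ := hl
  refine ⟨k, this.mem k, hk ▸ Nat.not_odd_iff_even.1 hd, hk ▸ lt_of_le_of_ne (le_maxPrio hx) ?_⟩
  intro h
  exact hd (h ▸ hl')

/-- A single visit to the rest of an even level is final. -/
theorem pathIn_tail_even (hd : ¬ Odd (maxPrio P X)) {ρ : ℕ → V} (hρ : G.PathIn X ρ) :
    G.PathIn (X \ G.restSet X P) ρ ∨ ∃ N, G.PathIn (G.restSet X P) fun k => ρ (k + N) := by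
  by_cases h : ∃ N, ρ N ∈ G.restSet X P
  · obtain ⟨N, hN⟩ := h
    exact Or.inr ⟨N, (hρ.shift N).mono fun k => hρ.mem_restSet hd hN _ (by omega)⟩
  · push Not at h
    exact Or.inl (hρ.mono fun k => ⟨hρ.mem k, h k⟩)

theorem levelTemplates_of_odd (hd : Odd (maxPrio P X)) : G.levelTemplates i X P =
    (⟨∅, {e | e ∈ G.coLiveEdges X (G.restSet X P) ∧ G.owner e.1 = 1 - i}, ∅⟩,
     ⟨∅, {e | e ∈ G.coLiveEdges X (G.restSet X P) ∧ G.owner e.1 = i}, ∅⟩) := if_pos hd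

theorem levelTemplates_of_even (hd : ¬ Odd (maxPrio P X)) : G.levelTemplates i X P =
    (⟨∅, ∅, {c | ∃ l ∈ P '' X, Odd l ∧
        c = ({v | v ∈ X \ G.restSet X P ∧ P v = l}, G.liveAssump (X \ G.restSet X P) i
          (evenTarget (X \ G.restSet X P) P l))}⟩,
     ⟨∅, ∅, {c | ∃ l ∈ P '' X, Odd l ∧
        c = ({v | v ∈ X \ G.restSet X P ∧ P v = l}, G.liveStrat (X \ G.restSet X P) i
          (evenTarget (X \ G.restSet X P) P l))}⟩) := if_neg hd

theorem evenTarget_subset {W : Set V} {l : ℕ} : evenTarget W P l ⊆ W := fun _ h => h.1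

theorem computeSets_rest_anti [Finite V] (h : 0 < maxPrio P X) :
    (G.computeSets i (G.restSet X P) (mergePrio P (maxPrio P X))).1.D ⊆
      (G.computeSets i X P).1.D ∧
    (G.computeSets i (G.restSet X P) (mergePrio P (maxPrio P X))).2.D ⊆
      (G.computeSets i X P).2.D ∧
    (G.computeSets i (G.restSet X P) (mergePrio P (maxPrio P X))).1.H ⊆
      (G.computeSets i X P).1.H ∧
    (G.computeSets i (G.restSet X P) (mergePrio P (maxPrio P X))).2.H ⊆
      (G.computeSets i X P).2.H := by
  rw [computeSets_of_pos h]
  exact ⟨Set.subset_union_right, Set.subset_union_right, Set.subset_union_right,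
    Set.subset_union_right⟩

/-- If only priority `0` occurs, every path in `X` sees it all the time, and closedness provides a
path from each vertex. -/
theorem restSet_eq_empty_of_zero [Finite V] (h : G.CoopClosed X P) (h0 : ¬ 0 < maxPrio P X) :
    G.restSet X P = ∅ := by
  have hd : maxPrio P X = 0 := by omega
  rw [restSet_even (by simp [hd]), Set.sdiff_eq_empty]
  intro v hv
  obtain ⟨ρ, rfl, hρ, -⟩ := h v hv
  refine ⟨ρ, rfl, hρ, fun N => ⟨N, le_rfl, ?_⟩⟩
  have := le_maxPrio (P := P) (hρ.mem N)
  simp only [Set.mem_ofPred_eq]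
  omega

/-- Paths in `X` that satisfy the templates of `ComputeSets` satisfy the parity objective. -/
theorem mem_parity_of_computeSets [Finite V] (i : Fin 2) (X : Set V) (P : V → ℕ) :
    G.CoopClosed X P → ∀ ρ, G.PathIn X ρ → ρ ∈ coLiveLang (G.computeSets i X P).1.D →
      ρ ∈ coLiveLang (G.computeSets i X P).2.D → ρ ∈ condLang (G.computeSets i X P).1.H →
      ρ ∈ condLang (G.computeSets i X P).2.H → ρ ∈ Parity P := by
  induction X, P using computeSets_induction G with
  | h X P ih =>
  intro hX ρ hρ hD1 hD2 hH1 hH2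
  -- Common end of both cases: a suffix inside the rest satisfies the recursive templates, and the
  -- conclusion returns through the merging of priorities and the invariance under prefixes.
  have rest : ∀ N, 0 < maxPrio P X → G.PathIn (G.restSet X P) (fun k => ρ (k + N)) →
      ρ ∈ Parity P := by
    intro N h0 hN
    obtain ⟨s1, s2, s3, s4⟩ := computeSets_rest_anti (G := G) (i := i) h0
    rw [← tailClosed_parity P ρ N, ← hN.mem_parity_mergePrio_iff]
    exact ih h0 hX.restSet _ hN (coLiveLang_shift (coLiveLang_anti s1 hD1) N)
      (coLiveLang_shift (coLiveLang_anti s2 hD2) N)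
      ((condLang_shift N).2 (condLang_anti s3 hH1)) ((condLang_shift N).2 (condLang_anti s4 hH2))
  obtain ⟨t1, t2, t3, t4⟩ := computeSets_coLive (G := G) (i := i) (X := X) (P := P)
  by_cases hd : Odd (maxPrio P X)
  · rw [levelTemplates_of_odd hd] at t1 t2
    obtain ⟨N1, h1⟩ := coLiveLang_iff.1 (coLiveLang_anti t1 hD1)
    obtain ⟨N2, h2⟩ := coLiveLang_iff.1 (coLiveLang_anti t2 hD2)
    -- Every co-live edge of the level is forbidden to one of the two players, so past both bounds
    -- none is taken.
    have hD : ∀ k, (ρ (k + max N1 N2), ρ (k + 1 + max N1 N2)) ∉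
        G.coLiveEdges X (G.restSet X P) := by
      intro k hk
      rw [show k + 1 + max N1 N2 = k + max N1 N2 + 1 by omega] at hk
      rcases owner_eq_or G i (ρ (k + max N1 N2)) with ho | ho
      · exact h2 _ (by omega) ⟨hk, ho⟩
      · exact h1 _ (by omega) ⟨hk, ho⟩
    obtain ⟨k, hk⟩ := exists_mem_coLiveIter hX hd (hρ.mem (0 + max N1 N2))
    obtain ⟨N, hN⟩ := eventuallyIn_of_not_coLive (hρ.shift _) hD hk
    rw [coLiveIter_zero hX] at hN
    refine rest (N + max N1 N2) (hd.pos) ((hρ.shift _).mono fun k => ?_)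
    have := hN (k + N) (by omega)
    simpa only [add_assoc] using this
  · rcases pathIn_tail_even hd hρ with hW | ⟨N, hN⟩
    · intro l hl hinf
      obtain ⟨k, hk⟩ := hinf.exists_mem
      have hl' : l ∈ P '' X := ⟨_, hρ.mem k, hk⟩
      rw [levelTemplates_of_even hd] at t3 t4
      have hinf' : InfOften {v | v ∈ X \ G.restSet X P ∧ P v = l} ρ := fun N => by
        obtain ⟨k, hk, hk'⟩ := hinf N
        exact ⟨k, hk, hW.mem k, hk'⟩
      have h1 := condLang_anti t3 hH1 _ ⟨l, hl', hl, rfl⟩ hinf'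
      have h2 := condLang_anti t4 hH2 _ ⟨l, hl', hl, rfl⟩ hinf'
      obtain ⟨v, hv, hv'⟩ := (infOften_target (allReach_evenTarget hd hl' hl) evenTarget_subset hW
        h2 h1).exists_vertex
      exact ⟨P v, hv.2.2, hv.2.1, hv'.mono (by simp)⟩
    · by_cases h0 : 0 < maxPrio P X
      · exact rest N h0 hN
      · have := hN.mem 0
        rw [restSet_eq_empty_of_zero hX h0] at this
        exact absurd this id

/-- All conditions, edges and owners in the result of `ComputeSets`. -/
theorem computeSets_subset [Finite V] (i : Fin 2) (X : Set V) (P : V → ℕ) :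
    (G.computeSets i X P).1.S = ∅ ∧ (G.computeSets i X P).2.S = ∅ ∧
    (∀ e ∈ (G.computeSets i X P).1.D, e ∈ G.edgesIn X ∧ G.owner e.1 = 1 - i) ∧
    (∀ e ∈ (G.computeSets i X P).2.D, e ∈ G.edgesIn X ∧ G.owner e.1 = i) ∧
    (∀ c ∈ (G.computeSets i X P).1.H, c.1 ⊆ X ∧ ∀ A ∈ c.2, ∀ e ∈ A,
      e ∈ G.edgesIn X ∧ G.owner e.1 = 1 - i) ∧
    (∀ c ∈ (G.computeSets i X P).2.H, c.1 ⊆ X ∧ ∀ A ∈ c.2, ∀ e ∈ A,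
      e ∈ G.edgesIn X ∧ G.owner e.1 = i) := by
  induction X, P using computeSets_induction G with
  | h X P ih =>
  have lev : (G.levelTemplates i X P).1.S = ∅ ∧ (G.levelTemplates i X P).2.S = ∅ ∧
      (∀ e ∈ (G.levelTemplates i X P).1.D, e ∈ G.edgesIn X ∧ G.owner e.1 = 1 - i) ∧
      (∀ e ∈ (G.levelTemplates i X P).2.D, e ∈ G.edgesIn X ∧ G.owner e.1 = i) ∧
      (∀ c ∈ (G.levelTemplates i X P).1.H, c.1 ⊆ X ∧ ∀ A ∈ c.2, ∀ e ∈ A,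
        e ∈ G.edgesIn X ∧ G.owner e.1 = 1 - i) ∧
      (∀ c ∈ (G.levelTemplates i X P).2.H, c.1 ⊆ X ∧ ∀ A ∈ c.2, ∀ e ∈ A,
        e ∈ G.edgesIn X ∧ G.owner e.1 = i) := by
    by_cases hd : Odd (maxPrio P X)
    · rw [levelTemplates_of_odd hd]
      exact ⟨rfl, rfl, fun e he => ⟨he.1.1, he.2⟩, fun e he => ⟨he.1.1, he.2⟩,
        fun c hc => absurd hc id, fun c hc => absurd hc id⟩
    · rw [levelTemplates_of_even hd]
      refine ⟨rfl, rfl, fun e he => absurd he id, fun e he => absurd he id, ?_, ?_⟩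
      · rintro c ⟨l, -, -, rfl⟩
        refine ⟨fun v hv => hv.1.1, fun A hA e he => ?_⟩
        have := liveAssump_edge hA he
        exact ⟨edgesIn_mono Set.sdiff_subset this.1, this.2⟩
      · rintro c ⟨l, -, -, rfl⟩
        refine ⟨fun v hv => hv.1.1, fun A hA e he => ?_⟩
        have := liveStrat_edge hA he
        exact ⟨edgesIn_mono Set.sdiff_subset this.1, this.2⟩
  by_cases h0 : 0 < maxPrio P X
  · rw [computeSets_of_pos h0]
    obtain ⟨l1, l2, l3, l4, l5, l6⟩ := lev
    obtain ⟨r1, r2, r3, r4, r5, r6⟩ := ih h0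
    have hs := G.restSet_subset X P
    have hs' := edgesIn_mono (G := G) hs
    refine ⟨by simp [conj, l1, r1], by simp [conj, l2, r2], ?_, ?_, ?_, ?_⟩
    · rintro e (he | he)
      exacts [l3 e he, ⟨hs' (r3 e he).1, (r3 e he).2⟩]
    · rintro e (he | he)
      exacts [l4 e he, ⟨hs' (r4 e he).1, (r4 e he).2⟩]
    · rintro c (hc | hc)
      exacts [l5 c hc, ⟨(r5 c hc).1.trans hs, fun A hA e he =>
        ⟨hs' ((r5 c hc).2 A hA e he).1, ((r5 c hc).2 A hA e he).2⟩⟩]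
    · rintro c (hc | hc)
      exacts [l6 c hc, ⟨(r6 c hc).1.trans hs, fun A hA e he =>
        ⟨hs' ((r6 c hc).2 A hA e he).1, ((r6 c hc).2 A hA e he).2⟩⟩]
  · rw [computeSets_of_zero h0]
    exact lev

/-- Taking such an edge requires a visit to `Y`, and there are no late visits. -/
theorem coLiveLang_of_edgesIn {D : Set (V × V)} {Y : Set V} (hD : D ⊆ G.edgesIn Y) {ρ : ℕ → V}
    (h : EventuallyIn Yᶜ ρ) : ρ ∈ coLiveLang D := by
  intro e he
  obtain ⟨N, hN⟩ := h
  exact ⟨N, fun k hk heq => hN k hk (by rw [← heq] at he; exact (hD he).1)⟩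

/-- Paths in `X` that satisfy the parity objective satisfy the assumption template of
`ComputeSets`. -/
theorem mem_lang_of_mem_parity [Finite V] (i : Fin 2) (X : Set V) (P : V → ℕ) :
    G.CoopClosed X P → ∀ ρ, G.PathIn X ρ → ρ ∈ Parity P →
      ρ ∈ coLiveLang (G.computeSets i X P).1.D ∧ ρ ∈ condLang (G.computeSets i X P).1.H := by
  induction X, P using computeSets_induction G with
  | h X P ih =>
  intro hX ρ hρ hp
  have rest : ∀ N, 0 < maxPrio P X → G.PathIn (G.restSet X P) (fun k => ρ (k + N)) →
      ρ ∈ coLiveLang (G.computeSets i (G.restSet X P) (mergePrio P (maxPrio P X))).1.D ∧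
      ρ ∈ condLang (G.computeSets i (G.restSet X P) (mergePrio P (maxPrio P X))).1.H := by
    intro N h0 hN
    have := ih h0 hX.restSet _ hN
      (hN.mem_parity_mergePrio_iff.2 ((tailClosed_parity P ρ N).2 hp))
    refine ⟨?_, (condLang_shift N).1 this.2⟩
    obtain ⟨M, hM⟩ := coLiveLang_iff.1 this.1
    refine coLiveLang_iff.2 ⟨M + N, fun k hk => ?_⟩
    have := hM (k - N) (by omega)
    rwa [show k - N + 1 + N = k + 1 by omega, show k - N + N = k by omega] at this
  have comb : ρ ∈ coLiveLang (G.levelTemplates i X P).1.D →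
      ρ ∈ condLang (G.levelTemplates i X P).1.H →
      (0 < maxPrio P X →
        ρ ∈ coLiveLang (G.computeSets i (G.restSet X P) (mergePrio P (maxPrio P X))).1.D ∧
        ρ ∈ condLang (G.computeSets i (G.restSet X P) (mergePrio P (maxPrio P X))).1.H) →
      ρ ∈ coLiveLang (G.computeSets i X P).1.D ∧ ρ ∈ condLang (G.computeSets i X P).1.H := by
    intro h1 h2 h3
    by_cases h0 : 0 < maxPrio P X
    · rw [computeSets_of_pos h0]
      obtain ⟨h3, h4⟩ := h3 h0
      constructor
      · rintro e (he | he)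
        exacts [h1 e he, h3 e he]
      · rintro c (hc | hc)
        exacts [h2 c hc, h4 c hc]
    · rw [computeSets_of_zero h0]
      exact ⟨h1, h2⟩
  by_cases hd : Odd (maxPrio P X)
  · obtain ⟨N, hN⟩ := eventuallyIn_restSet_of_mem_parity hd hρ hp
    refine comb ?_ ?_ fun h0 => rest N h0 ((hρ.shift N).mono fun k => hN _ (by omega))
    · rw [levelTemplates_of_odd hd]
      refine coLiveLang_iff.2 ⟨N, fun k hk he => ?_⟩
      exact not_coLive_of_mem_restSet (e := (ρ k, ρ (k + 1))) hX (hN k hk)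
        (hN (k + 1) (by omega)) he.1
    · rw [levelTemplates_of_odd hd]
      exact fun c hc => absurd hc id
  · refine comb ?_ ?_ ?_
    · rw [levelTemplates_of_even hd]
      exact fun e he => absurd he id
    · rw [levelTemplates_of_even hd]
      rintro c ⟨l, hl, hl', rfl⟩ hinf
      rcases pathIn_tail_even hd hρ with hW | ⟨N, hN⟩
      -- The condition means that `l` recurs, and the parity objective answers with a recurring even
      -- priority above `l`, which on a path in `W` lies in the target.
      · refine mem_liveLang_liveAssump hW ?_
        obtain ⟨b, hb, hb', hb''⟩ := hp l hl' (hinf.mono fun v hv => hv.2)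
        intro N
        obtain ⟨k, hk, hk'⟩ := hb'' N
        simp only [Set.mem_ofPred_eq] at hk'
        exact ⟨k, hk, hW.mem k, hk' ▸ hb', hk' ▸ hb⟩
      · obtain ⟨k, hk, hk'⟩ := hinf N
        have := hN.mem (k - N)
        rw [Nat.sub_add_cancel hk] at this
        exact absurd this hk'.1.2
    · intro h0
      rcases pathIn_tail_even hd hρ with hW | ⟨N, hN⟩
      · obtain ⟨-, -, r3, -, r5, -⟩ := computeSets_subset (G := G) i (G.restSet X P)
          (mergePrio P (maxPrio P X))
        -- On a path that stays in `W`, everything imposed by the recursion holds vacuously, as its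
        -- edges and conditions lie in the rest.
        have hev : EventuallyIn (G.restSet X P)ᶜ ρ := ⟨0, fun k _ => (hW.mem k).2⟩
        refine ⟨coLiveLang_of_edgesIn (fun e he => (r3 e he).1) hev, fun c hc hinf => ?_⟩
        exact absurd (hinf.mono (r5 c hc).1) (not_infOften.2 hev)
      · exact rest N h0 hN

/-- Within `X`, every vertex has an edge that is not co-live, and edges of live-groups are not
co-live. -/
theorem computeSets_compatible [Finite V] (i : Fin 2) (X : Set V) (P : V → ℕ) :
    G.CoopClosed X P →
    (∀ v ∈ X, ∃ w, (v, w) ∈ G.edgesIn X ∧ (v, w) ∉ (G.computeSets i X P).1.D ∧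
      (v, w) ∉ (G.computeSets i X P).2.D) ∧
    (∀ c ∈ (G.computeSets i X P).1.H, ∀ A ∈ c.2, ∀ e ∈ A, e ∉ (G.computeSets i X P).1.D) ∧
    (∀ c ∈ (G.computeSets i X P).2.H, ∀ A ∈ c.2, ∀ e ∈ A, e ∉ (G.computeSets i X P).2.D) := by
  induction X, P using computeSets_induction G with
  | h X P ih =>
  intro hX
  by_cases h0 : 0 < maxPrio P X
  · obtain ⟨ih1, ih2, ih3⟩ := ih h0 hX.restSet
    obtain ⟨-, -, r3, r4, r5, r6⟩ := computeSets_subset (G := G) i (G.restSet X P)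
      (mergePrio P (maxPrio P X))
    rw [computeSets_of_pos h0]
    by_cases hd : Odd (maxPrio P X)
    · rw [levelTemplates_of_odd hd]
      have key : ∀ e ∈ G.edgesIn (G.restSet X P), e ∉ G.coLiveEdges X (G.restSet X P) :=
        fun e he => not_coLive_of_mem_restSet hX he.1 he.2.1
      refine ⟨fun v hv => ?_, ?_, ?_⟩
      · by_cases hv' : v ∈ G.restSet X P
        · obtain ⟨w, hw, h1, h2⟩ := ih1 v hv'
          refine ⟨w, edgesIn_mono (G.restSet_subset X P) hw, ?_, ?_⟩
          · rintro (h | h)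
            exacts [key _ hw h.1, h1 h]
          · rintro (h | h)
            exacts [key _ hw h.1, h2 h]
        -- Outside the rest only the co-live edges of this level matter: those of the recursion have
        -- their sources in the rest.
        · obtain ⟨w, hw, h⟩ := exists_edge_not_coLive (exists_mem_coLiveIter hX hd hv)
            (by rwa [coLiveIter_zero hX])
          refine ⟨w, hw, ?_, ?_⟩
          · rintro (h' | h')
            exacts [h h'.1, hv' (r3 _ h').1.1]
          · rintro (h' | h')
            exacts [h h'.1, hv' (r4 _ h').1.1]
      · rintro c (hc | hc) A hA e he
        · exact absurd hc id
        · rintro (h | h)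
          exacts [key e ((r5 c hc).2 A hA e he).1 h.1, ih2 c hc A hA e he h]
      · rintro c (hc | hc) A hA e he
        · exact absurd hc id
        · rintro (h | h)
          exacts [key e ((r6 c hc).2 A hA e he).1 h.1, ih3 c hc A hA e he h]
    · rw [levelTemplates_of_even hd]
      refine ⟨fun v hv => ?_, ?_, ?_⟩
      · by_cases hv' : v ∈ G.restSet X P
        · obtain ⟨w, hw, h1, h2⟩ := ih1 v hv'
          refine ⟨w, edgesIn_mono (G.restSet_subset X P) hw, ?_, ?_⟩
          · rintro (h | h)
            exacts [absurd h id, h1 h]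
          · rintro (h | h)
            exacts [absurd h id, h2 h]
        · obtain ⟨w, hw⟩ := hX.exists_edge hv
          refine ⟨w, hw, ?_, ?_⟩
          · rintro (h | h)
            exacts [absurd h id, hv' (r3 _ h).1.1]
          · rintro (h | h)
            exacts [absurd h id, hv' (r4 _ h).1.1]
      · rintro c (hc | hc) A hA e he
        -- Live-groups of this level start in `W`, co-live edges of the recursion in the rest, so
        -- they cannot meet.
        · obtain ⟨l, -, -, rfl⟩ := hc
          rintro (h | h)
          exacts [absurd h id, (liveAssump_edge hA he).1.1.2 (r3 e h).1.1]
        · rintro (h | h)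
          exacts [absurd h id, ih2 c hc A hA e he h]
      · rintro c (hc | hc) A hA e he
        · obtain ⟨l, -, -, rfl⟩ := hc
          rintro (h | h)
          exacts [absurd h id, (liveStrat_edge hA he).1.1.2 (r4 e h).1.1]
        · rintro (h | h)
          exacts [absurd h id, ih3 c hc A hA e he h]
  · have hd : ¬ Odd (maxPrio P X) := fun h => h0 h.pos
    rw [computeSets_of_zero h0, levelTemplates_of_even hd]
    refine ⟨fun v hv => ?_, fun _ _ _ _ _ _ => id, fun _ _ _ _ _ _ => id⟩
    obtain ⟨w, hw⟩ := hX.exists_edge hv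
    exact ⟨w, hw, id, id⟩

/-! ## Implementing templates -/

/-- The strategy below only remembers how often the current vertex occurs in the history. In terms
of `Nat.count` this number can be inverted by `Nat.nth`. -/
theorem count_map_range [DecidableEq V] (ρ : ℕ → V) (v : V) (k : ℕ) :
    ((List.range k).map ρ).count v = Nat.count (fun j => ρ j = v) k := by
  induction k with
  | zero => rfl
  | succ k ih =>
    rw [List.range_succ, List.map_append, List.count_append, ih, Nat.count_succ]
    simp [List.count_singleton]

/-- A template without conflicts between its edges can be implemented by a strategy that cycles
through the edges that are neither unsafe nor co-live. -/
theorem winRegion_lang_eq_univ [Finite V] {T : Template V} {p : Fin 2} (hT : T.ControlledBy G p)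
    (h1 : ∀ v, ∃ w, G.Adj v w ∧ (v, w) ∉ T.S ∧ (v, w) ∉ T.D)
    (h2 : ∀ c ∈ T.H, ∀ A ∈ c.2, ∀ e ∈ A, e ∉ T.S ∧ e ∉ T.D) :
    G.winRegion p T.lang = Set.univ := by
  classical
  have hf : ∀ v, ∃ f : ℕ → V, (∀ m, G.Adj v (f m) ∧ (v, f m) ∉ T.S ∧ (v, f m) ∉ T.D) ∧
      ∀ w, G.Adj v w → (v, w) ∉ T.S → (v, w) ∉ T.D → ∀ N, ∃ m, N ≤ m ∧ f m = w := by
    intro v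
    obtain ⟨w, hw⟩ := h1 v
    let s := {w // G.Adj v w ∧ (v, w) ∉ T.S ∧ (v, w) ∉ T.D}
    have : Nonempty s := ⟨⟨w, hw⟩⟩
    obtain ⟨g, hg⟩ := exists_surjective_nat s
    -- Forgetting the second component of a pair repeats each value of the enumeration `g`
    -- infinitely often: index `a` recurs at `Nat.pair a N` for all `N`.
    refine ⟨fun m => g m.unpair.1, fun m => (g m.unpair.1).2, fun w hw1 hw2 hw3 N => ?_⟩
    obtain ⟨a, ha⟩ := hg ⟨w, hw1, hw2, hw3⟩
    exact ⟨Nat.pair a N, Nat.right_le_pair a N, by simp [ha]⟩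
  choose f hf1 hf2 using hf
  -- On its visit number `m`, counted from `0`, the vertex `v` moves to `f v m`.
  refine Set.eq_univ_of_forall fun v₀ =>
    ⟨⟨fun h v => f v (h.count v), fun h v _ => (hf1 v _).1⟩, fun ρ hρ _ hc => ?_⟩
  have hmove : ∀ k, G.owner (ρ k) = p → ρ (k + 1) = f (ρ k) (Nat.count (fun j => ρ j = ρ k) k) := by
    intro k hk
    rw [hc k hk]
    exact congrArg _ (count_map_range ρ _ k)
  have hSD : ∀ k, (ρ k, ρ (k + 1)) ∉ T.S ∧ (ρ k, ρ (k + 1)) ∉ T.D := by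
    intro k
    by_cases hk : G.owner (ρ k) = p
    · rw [hmove k hk]
      exact (hf1 _ _).2
    · exact ⟨fun h => hk (hT _ (Or.inl h)).2, fun h => hk (hT _ (Or.inr (Or.inl h))).2⟩
  refine ⟨⟨fun k => (hSD k).1, coLiveLang_iff.2 ⟨0, fun k _ => (hSD k).2⟩⟩, ?_⟩
  intro c hcH _ A hA hinf
  obtain ⟨v, ⟨⟨v', w⟩, he, rfl⟩, hv⟩ := hinf.exists_vertex
  have hT' := hT _ (Or.inr (Or.inr ⟨c, hcH, A, hA, he⟩))
  have hinf' : {j | ρ j = v'}.Infinite := by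
    rw [Set.infinite_iff_exists_gt]
    intro N
    obtain ⟨k, hk, hk'⟩ := hv (N + 1)
    exact ⟨k, hk', hk⟩
  intro N
  obtain ⟨m, hm, hm'⟩ := hf2 v' w hT'.1 (h2 c hcH A hA _ he).1 (h2 c hcH A hA _ he).2 N
  -- At visit number `m` of `v'` the chosen successor is `w`. This visit happens at a position not
  -- smaller than `m`, hence not smaller than `N`.
  have hvis : ρ (Nat.nth (fun j => ρ j = v') m) = v' := Nat.nth_mem_of_infinite hinf' m
  refine ⟨Nat.nth (fun j => ρ j = v') m, hm.trans (Nat.le_nth fun h => absurd h hinf'), ?_⟩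
  have := hmove (Nat.nth (fun j => ρ j = v') m) (by rw [hvis]; exact hT'.2)
  rw [this, hvis, Nat.count_nth_of_infinite hinf', hm']
  exact he

/-! ## The result of `ParityTemp` is adequately permissive -/

section ParityTemp

/-- The play of the profile is constructed explicitly, which connects the region defined by
strategies with the one defined by paths. -/
theorem exists_path_of_mem_coopWinRegion {Φ : Set (ℕ → V)} {v : V} (hv : v ∈ G.coopWinRegion Φ) :
    ∃ ρ, G.IsPlay ρ ∧ ρ 0 = v ∧ ρ ∈ Φ := by
  obtain ⟨σ₀, σ₁, h⟩ := hv
  let step : List V → V → V := fun h v => if G.owner v = 0 then σ₀.move h v else σ₁.move h v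
  -- The state carries the history along with the current vertex, since strategies read both.
  let st : ℕ → List V × V := fun k => Nat.rec ([], v) (fun _ s => (s.1 ++ [s.2], step s.1 s.2)) k
  have hst : ∀ k, (st k).1 = (List.range k).map fun j => (st j).2 := by
    intro k
    induction k with
    | zero => rfl
    | succ k ih =>
      rw [List.range_succ, List.map_append, ← ih]
      rfl
  have hnext : ∀ k, (st (k + 1)).2 = step (st k).1 (st k).2 := fun _ => rfl
  have h01 : ∀ v, G.owner v = 0 ∨ G.owner v = 1 := fun v => owner_eq_or G 0 v
  have hplay : G.IsPlay fun k => (st k).2 := by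
    intro k
    simp only [hnext]
    rcases h01 (st k).2 with h0 | h0
    · simp only [step, h0, if_true]
      exact σ₀.valid _ _ h0
    · simp only [step, h0, one_ne_zero, if_false]
      exact σ₁.valid _ _ h0
  refine ⟨fun k => (st k).2, hplay, rfl, h _ hplay rfl ?_ ?_⟩
  · intro k hk
    simp only [hnext, ← hst k, step]
    exact if_pos hk
  · intro k hk
    simp only [hnext, ← hst k, step]
    exact if_neg (by rw [hk]; exact one_ne_zero)

variable [Finite V]

theorem isCSM_parityTemp (G : GameGraph V) (P : V → ℕ) (i : Fin 2) :
    G.IsCSM i (G.parityTemp P i) := by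
  obtain ⟨r1, r2, r3, r4, r5, r6⟩ := computeSets_subset (G := G) i
    (G.coopRegionIn Set.univ (Parity P)) P
  constructor
  · rintro e ((he | he) | (he | he) | ⟨c, hc | hc, A, hA, he⟩)
    · exact ⟨he.1, he.2.1⟩
    · exact absurd he (Set.eq_empty_iff_forall_notMem.1 r1 e)
    · exact absurd he id
    · exact ⟨(r3 e he).1.2.2, (r3 e he).2⟩
    · exact absurd hc id
    · exact ⟨((r5 c hc).2 A hA e he).1.2.2, ((r5 c hc).2 A hA e he).2⟩
  · rintro e ((he | he) | (he | he) | ⟨c, hc | hc, A, hA, he⟩)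
    · exact ⟨he.1, he.2.1⟩
    · exact absurd he (Set.eq_empty_iff_forall_notMem.1 r2 e)
    · exact absurd he id
    · exact ⟨(r4 e he).1.2.2, (r4 e he).2⟩
    · exact absurd hc id
    · exact ⟨((r6 c hc).2 A hA e he).1.2.2, ((r6 c hc).2 A hA e he).2⟩

theorem adequatelyPermissive_parityTemp (G : GameGraph V) (P : V → ℕ) (i : Fin 2) :
    G.AdequatelyPermissive i (Parity P) (G.parityTemp P i) := by
  have hcsm := isCSM_parityTemp G P i
  set Z := G.coopRegionIn Set.univ (Parity P) with hZ
  have hcl : G.CoopClosed Z P := coopClosed_coopRegionIn _ _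
  obtain ⟨r1, r2, r3, r4, r5, r6⟩ := computeSets_subset (G := G) i Z P
  obtain ⟨c1, c2, c3⟩ := computeSets_compatible (G := G) i Z P hcl
  -- Inside `Z` the recursion provides an edge that avoids all forbidden ones. Outside `Z` any edge
  -- will do, because forbidden edges start in `Z`.
  have hedge : ∀ v, ∃ w, G.Adj v w ∧ (v, w) ∉ (G.parityTemp P i).1.S ∧
      (v, w) ∉ (G.parityTemp P i).1.D ∧ (v, w) ∉ (G.parityTemp P i).2.S ∧
      (v, w) ∉ (G.parityTemp P i).2.D := by
    intro v
    by_cases hv : v ∈ Z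
    · obtain ⟨w, hw, h1, h2⟩ := c1 v hv
      refine ⟨w, hw.2.2, ?_, ?_, ?_, ?_⟩
      · rintro (h | h)
        exacts [h.2.2.2 hw.2.1, Set.eq_empty_iff_forall_notMem.1 r1 _ h]
      · rintro (h | h)
        exacts [absurd h id, h1 h]
      · rintro (h | h)
        exacts [h.2.2.2 hw.2.1, Set.eq_empty_iff_forall_notMem.1 r2 _ h]
      · rintro (h | h)
        exacts [absurd h id, h2 h]
    · obtain ⟨w, hw⟩ := G.total v
      refine ⟨w, hw, ?_, ?_, ?_, ?_⟩
      · rintro (h | h)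
        exacts [hv h.2.2.1, Set.eq_empty_iff_forall_notMem.1 r1 _ h]
      · rintro (h | h)
        exacts [absurd h id, hv (r3 _ h).1.1]
      · rintro (h | h)
        exacts [hv h.2.2.1, Set.eq_empty_iff_forall_notMem.1 r2 _ h]
      · rintro (h | h)
        exacts [absurd h id, hv (r4 _ h).1.1]
  refine ⟨?_, ⟨?_, ?_⟩, ?_⟩
  · intro v hv σ τ hσ hτ ρ hρ h0 hσc hτc
    obtain ⟨⟨hS2, hD2⟩, hH2⟩ := hσ ρ hρ hσc
    obtain ⟨⟨hS1, hD1⟩, hH1⟩ := hτ ρ hρ hτc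
    obtain ⟨π, hπ, rfl, hπP⟩ := exists_path_of_mem_coopWinRegion hv
    have hstart : ρ 0 ∈ Z := h0 ▸ ⟨π, rfl, hπ.pathIn fun _ => Set.mem_univ _, hπP⟩
    -- A step out of `Z` is an unsafe edge of whoever owns its source.
    have hstay : ∀ k, ρ k ∈ Z := by
      intro k
      induction k with
      | zero => exact hstart
      | succ k ih =>
        by_contra hk
        rcases owner_eq_or G i (ρ k) with ho | ho
        · exact hS2 k (Or.inl ⟨hρ k, ho, ih, hk⟩)
        · exact hS1 k (Or.inl ⟨hρ k, ho, ih, hk⟩)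
    exact mem_parity_of_computeSets i Z P hcl ρ (hρ.pathIn hstay)
      (coLiveLang_anti Set.subset_union_right hD1) (coLiveLang_anti Set.subset_union_right hD2)
      (condLang_anti Set.subset_union_right hH1) (condLang_anti Set.subset_union_right hH2)
  · refine winRegion_lang_eq_univ hcsm.1 (fun v => ?_) ?_
    · obtain ⟨w, hw, h1, h2, -⟩ := hedge v
      exact ⟨w, hw, h1, h2⟩
    · rintro c (hc | hc) A hA e he
      · exact absurd hc id
      · constructor
        · rintro (h | h)
          exacts [h.2.2.2 ((r5 c hc).2 A hA e he).1.2.1, Set.eq_empty_iff_forall_notMem.1 r1 _ h]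
        · rintro (h | h)
          exacts [absurd h id, c2 c hc A hA e he h]
  · refine winRegion_lang_eq_univ hcsm.2 (fun v => ?_) ?_
    · obtain ⟨w, hw, -, -, h1, h2⟩ := hedge v
      exact ⟨w, hw, h1, h2⟩
    · rintro c (hc | hc) A hA e he
      · exact absurd hc id
      · constructor
        · rintro (h | h)
          exacts [h.2.2.2 ((r6 c hc).2 A hA e he).1.2.1, Set.eq_empty_iff_forall_notMem.1 r2 _ h]
        · rintro (h | h)
          exacts [absurd h id, c3 c hc A hA e he h]
  · rintro ρ ⟨hρ, hp⟩
    have hZρ : G.PathIn Z ρ := pathIn_coopRegionIn (tailClosed_parity P)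
      (hρ.pathIn fun _ => Set.mem_univ _) hp
    obtain ⟨h1, h2⟩ := mem_lang_of_mem_parity i Z P hcl ρ hZρ hp
    refine ⟨hρ, ⟨fun k => ?_, ?_⟩, ?_⟩
    · rintro (h | h)
      exacts [h.2.2.2 (hZρ.mem _), Set.eq_empty_iff_forall_notMem.1 r1 _ h]
    · rintro e (he | he)
      exacts [absurd he id, h1 e he]
    · rintro c (hc | hc)
      exacts [absurd hc id, h2 c hc]

end ParityTemp

end GameGraph

/-! ## Reachability and cycles -/

section Reach

variable {V : Type u}

/-- Otherwise there would be `Nat.card V + 1` strict increases, one more than the number of vertices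
allows. -/
theorem exists_iterate_eq [Finite V] {S : ℕ → Set V} (hS : Monotone S) :
    ∃ k ≤ Nat.card V, S (k + 1) = S k := by
  by_contra! h
  have : ∀ k, k ≤ Nat.card V + 1 → k ≤ (S k).ncard := by
    intro k
    induction k with
    | zero => exact fun _ => Nat.zero_le _
    | succ k ih =>
      intro hk
      exact (ih (by omega)).trans_lt (Set.ncard_lt_ncard
        ((hS (Nat.le_succ k)).ssubset_of_ne (h k (by omega)).symm) (Set.toFinite _))
  have h1 := this _ le_rfl
  have h2 := Set.ncard_le_ncard (Set.subset_univ (S (Nat.card V + 1))) (Set.toFinite _)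
  rw [Set.ncard_univ] at h2
  omega

/-- Backward reachability is completed after as many rounds as there are vertices. -/
theorem iterate_pred_eq [Finite V] {r : V → V → Prop} {S : ℕ → Set V}
    (hS : ∀ k, S (k + 1) = {x | x ∈ S k ∨ ∃ y ∈ S k, r x y}) {n : ℕ} (hn : Nat.card V ≤ n) :
    S n = {x | ∃ y ∈ S 0, Relation.ReflTransGen r x y} := by
  have hmono : Monotone S := monotone_nat_of_le_succ fun k x hx => by
    rw [hS]; exact Or.inl hx
  obtain ⟨k, hk, hk'⟩ := exists_iterate_eq hmono
  have hstab : ∀ m, k ≤ m → S m = S k := by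
    intro m hm
    induction m, hm using Nat.le_induction with
    | base => rfl
    | succ m _ ih => rw [hS, ih, ← hS, hk']
  ext x
  constructor
  · have : ∀ m x, x ∈ S m → ∃ y ∈ S 0, Relation.ReflTransGen r x y := by
      intro m
      induction m with
      | zero => exact fun x hx => ⟨x, hx, .refl⟩
      | succ m ih =>
        intro x hx
        rw [hS] at hx
        rcases hx with hx | ⟨y, hy, hxy⟩
        · exact ih x hx
        · obtain ⟨z, hz, hyz⟩ := ih y hy
          exact ⟨z, hz, .head hxy hyz⟩
    exact this n x
  · rintro ⟨y, hy, hxy⟩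
    rw [hstab n (by omega)]
    induction hxy using Relation.ReflTransGen.head_induction_on with
    | refl => exact hmono (Nat.zero_le k) hy
    | head hab _ ih =>
      rw [← hk', hS]
      exact Or.inr ⟨_, ih, hab⟩

theorem exists_segment_of_transGen {r : V → V → Prop} {a b : V} (h : Relation.TransGen r a b) :
    ∃ m, 0 < m ∧ ∃ f : ℕ → V, f 0 = a ∧ f m = b ∧ ∀ k < m, r (f k) (f (k + 1)) := by
  induction h with
  | @single b h =>
    refine ⟨1, one_pos, fun k => if k = 0 then a else b, by simp, by simp, fun k hk => ?_⟩
    obtain rfl : k = 0 := by omega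
    simpa using h
  | @tail b c _ hbc ih =>
    obtain ⟨m, hm, f, h0, h1, hf⟩ := ih
    refine ⟨m + 1, by omega, fun k => if k ≤ m then f k else c, by simp [h0], by simp, ?_⟩
    intro k hk
    by_cases hkm : k < m
    · simpa [show k ≤ m by omega, show k + 1 ≤ m by omega] using hf k hkm
    · obtain rfl : k = m := by omega
      simpa [h1] using hbc

/-- The cycle is repeated by reading a segment modulo its length. At the wrap-around the segment's
end and beginning are both `v`. -/
theorem exists_periodic_of_transGen {r : V → V → Prop} {v : V} (h : Relation.TransGen r v v) :
    ∃ ρ : ℕ → V, ρ 0 = v ∧ (∀ k, r (ρ k) (ρ (k + 1))) ∧ InfOften {v} ρ := by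
  obtain ⟨m, hm, f, h0, h1, hf⟩ := exists_segment_of_transGen h
  refine ⟨fun k => f (k % m), by simpa using h0, fun k => ?_, fun N => ⟨m * N, ?_, ?_⟩⟩
  · change r (f (k % m)) (f ((k + 1) % m))
    have hk := Nat.mod_lt k hm
    have := hf _ hk
    by_cases h' : k % m + 1 = m
    · have h2 : (k + 1) % m = 0 := by
        rw [← Nat.mod_add_mod, h', Nat.mod_self]
      rw [h2, h0, ← h1]
      rwa [h'] at this
    · have h2 : (k + 1) % m = k % m + 1 := by
        rw [← Nat.mod_add_mod, Nat.mod_eq_of_lt (by omega)]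
      rwa [h2]
  · exact Nat.le_mul_of_pos_left N hm
  · simpa using h0

theorem reflTransGen_of_steps {r : V → V → Prop} {ρ : ℕ → V} {N : ℕ}
    (h : ∀ k, N ≤ k → r (ρ k) (ρ (k + 1))) {m : ℕ} (hm : N ≤ m) :
    Relation.ReflTransGen r (ρ N) (ρ m) := by
  induction m, hm using Nat.le_induction with
  | base => exact .refl
  | succ m hm ih => exact ih.tail (h m hm)

end Reach

/-! ### Cooperative regions as reachability of good vertices -/

namespace GameGraph

variable {V : Type u} {G : GameGraph V} {X : Set V} {P : V → ℕ}

/-- The vertices from which `T` can be reached in `G|_X`. -/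
def reachSet (G : GameGraph V) (X T : Set V) : Set V :=
  {v | ∃ w ∈ T, Relation.ReflTransGen (fun x y => (x, y) ∈ G.edgesIn X) v w}

/-- `v` has an even priority and lies on a cycle of `G|_X` without larger priorities. -/
def GoodIn (G : GameGraph V) (X : Set V) (P : V → ℕ) (v : V) : Prop :=
  Even (P v) ∧
    Relation.TransGen (fun x y => (x, y) ∈ G.edgesIn X ∧ P x ≤ P v ∧ P y ≤ P v) v v

theorem GoodIn.exists_path {v : V} (h : G.GoodIn X P v) :
    ∃ ρ, ρ 0 = v ∧ G.PathIn X ρ ∧ InfOften {v} ρ ∧ ∀ k, P (ρ k) ≤ P v := by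
  obtain ⟨ρ, h0, hr, hinf⟩ := exists_periodic_of_transGen h.2
  exact ⟨ρ, h0, fun k => (hr k).1, hinf, fun k => (hr k).2.1⟩

/-- Two visits to `v` after the bound has set in enclose a cycle. The second is sought from `k + 1`
on, so the cycle is not trivial. -/
theorem goodIn_of_path {v : V} (he : Even (P v)) {ρ : ℕ → V} (hρ : G.PathIn X ρ)
    (hinf : InfOften {v} ρ) (hle : EventuallyIn {w | P w ≤ P v} ρ) : G.GoodIn X P v := by
  refine ⟨he, ?_⟩
  obtain ⟨N, hN⟩ := hle
  obtain ⟨k, hk, hk'⟩ := hinf N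
  obtain ⟨m, hm, hm'⟩ := hinf (k + 1)
  have hstep : ∀ j, k ≤ j → (fun x y => (x, y) ∈ G.edgesIn X ∧ P x ≤ P v ∧ P y ≤ P v)
      (ρ j) (ρ (j + 1)) :=
    fun j hj => ⟨hρ j, hN j (by omega), hN (j + 1) (by omega)⟩
  have h1 := hstep k le_rfl
  have h2 := reflTransGen_of_steps (ρ := ρ) (N := k + 1)
    (r := fun x y => (x, y) ∈ G.edgesIn X ∧ P x ≤ P v ∧ P y ≤ P v) (fun j hj => hstep j (Nat.le_of_succ_le hj)) hm
  rw [Set.mem_singleton_iff] at hk' hm'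
  rw [hk'] at h1
  rw [hm'] at h2
  exact Relation.TransGen.head' h1 h2

theorem GoodIn.mem {v : V} (h : G.GoodIn X P v) : v ∈ X := by
  obtain ⟨ρ, rfl, hρ, -⟩ := h.exists_path
  exact hρ.mem 0

theorem mem_coopRegionIn_of_reach {Φ : Set (ℕ → V)} (hΦ : TailClosed Φ) {v w : V}
    (h : Relation.ReflTransGen (fun x y => (x, y) ∈ G.edgesIn X) v w)
    (hw : w ∈ G.coopRegionIn X Φ) : v ∈ G.coopRegionIn X Φ := by
  induction h using Relation.ReflTransGen.head_induction_on with
  | refl => exact hw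
  | head hab _ ih => exact coopRegionIn_of_edge hΦ hab ih

/-- A parity path reaches a recurring vertex of its largest recurring priority, and this vertex is
good. Conversely, a path to a good vertex can be continued by repeating its cycle. -/
theorem coopRegionIn_parity_eq [Finite V] :
    G.coopRegionIn X (Parity P) = G.reachSet X {v | G.GoodIn X P v} := by
  ext v
  constructor
  · rintro ⟨ρ, rfl, hρ, hp⟩
    obtain ⟨w, he, hinf, hle⟩ := exists_even_max_of_mem_parity hp
    refine ⟨w, goodIn_of_path he hρ hinf hle, ?_⟩
    obtain ⟨k, rfl⟩ := hinf.exists_mem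
    exact reflTransGen_of_steps (fun j _ => hρ j) (Nat.zero_le k)
  · rintro ⟨w, hw, hr⟩
    refine mem_coopRegionIn_of_reach (tailClosed_parity P) hr ?_
    obtain ⟨ρ, h0, hρ, hinf, hle⟩ := GoodIn.exists_path hw
    exact ⟨ρ, h0, hρ, mem_parity_of_even_max hw.1 hinf ⟨0, fun k _ => hle k⟩⟩

/-- For a vertex of the largest priority the bound on its cycle is automatic, so a recurring such
vertex is good. -/
theorem coopRegionIn_max_eq [Finite V] (hd : ¬ Odd (maxPrio P X)) :
    G.coopRegionIn X {ρ | InfOften {v | P v = maxPrio P X} ρ} =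
      G.reachSet X {v | G.GoodIn X P v ∧ P v = maxPrio P X} := by
  ext v
  constructor
  · rintro ⟨ρ, rfl, hρ, hp⟩
    obtain ⟨w, hw, hinf⟩ := InfOften.exists_vertex hp
    simp only [Set.mem_ofPred_eq] at hw
    refine ⟨w, ⟨goodIn_of_path (hw ▸ Nat.not_odd_iff_even.1 hd) hρ hinf
      ⟨0, fun k _ => ?_⟩, hw⟩, ?_⟩
    · simp only [Set.mem_ofPred_eq, hw]
      exact le_maxPrio (hρ k).1
    · obtain ⟨k, rfl⟩ := hinf.exists_mem
      exact reflTransGen_of_steps (fun j _ => hρ j) (Nat.zero_le k)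
  · rintro ⟨w, hw, hr⟩
    refine mem_coopRegionIn_of_reach (tailClosed_infOften _) hr ?_
    obtain ⟨ρ, h0, hρ, hinf, hle⟩ := GoodIn.exists_path hw.1
    exact ⟨ρ, h0, hρ, hinf.mono (by simpa using hw.2)⟩

/-- `C` consists of the vertices of `X` that are good in `G|_X`, apart from vertices
outside `X`. -/
def GoodInv (G : GameGraph V) (C X : Set V) (P : V → ℕ) : Prop :=
  ∀ v ∈ X, v ∈ C ↔ G.GoodIn X P v

/-- The cycle of a good vertex, repeated forever, is a parity path and therefore stays in the
cooperative region. -/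
theorem goodInv_coopRegionIn [Finite V] :
    G.GoodInv {v | G.GoodIn Set.univ P v} (G.coopRegionIn Set.univ (Parity P)) P := by
  intro v _
  constructor
  · intro h
    obtain ⟨ρ, h0, hρ, hinf, hle⟩ := GoodIn.exists_path h
    have hp := mem_parity_of_even_max h.1 hinf ⟨0, fun k _ => hle k⟩
    exact goodIn_of_path h.1 (pathIn_coopRegionIn (tailClosed_parity P) hρ hp) hinf
      ⟨0, fun k _ => hle k⟩
  · intro h
    obtain ⟨ρ, h0, hρ, hinf, hle⟩ := GoodIn.exists_path h
    exact goodIn_of_path h.1 (hρ.mono fun _ => Set.mem_univ _) hinf ⟨0, fun k _ => hle k⟩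

/-- The cycle of a good vertex with priority below the maximum never meets the maximum, so it
survives the removal of that priority. -/
theorem GoodInv.restSet_odd [Finite V] {C : Set V} (h : G.GoodInv C X P)
    (hd : Odd (maxPrio P X)) : G.restSet X P = G.reachSet (X \ {v | P v = maxPrio P X})
      {v | v ∈ C ∧ v ∈ X ∧ P v ≠ maxPrio P X} := by
  rw [GameGraph.restSet_odd hd, coopRegionIn_parity_eq]
  congr 1
  ext v
  constructor
  · intro hv
    obtain ⟨ρ, h0, hρ, hinf, hle⟩ := GoodIn.exists_path hv
    have hvX := GoodIn.mem hv
    exact ⟨(h v hvX.1).2 (goodIn_of_path hv.1 (hρ.mono fun k => (hρ.mem k).1) hinf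
      ⟨0, fun k _ => hle k⟩), hvX.1, hvX.2⟩
  · rintro ⟨hC, hvX, hne⟩
    have hv := (h v hvX).1 hC
    obtain ⟨ρ, h0, hρ, hinf, hle⟩ := GoodIn.exists_path hv
    refine goodIn_of_path hv.1 (hρ.mono fun k => ⟨hρ.mem k, ?_⟩) hinf ⟨0, fun k _ => hle k⟩
    have := le_maxPrio (P := P) hvX
    have := hle k
    simp only [Set.mem_ofPred_eq]
    omega

theorem GoodInv.diff_restSet_even [Finite V] {C : Set V} (h : G.GoodInv C X P)
    (hd : ¬ Odd (maxPrio P X)) : X \ G.restSet X P = G.reachSet X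
      {v | v ∈ C ∧ v ∈ X ∧ P v = maxPrio P X} := by
  rw [GameGraph.diff_restSet_even hd, coopRegionIn_max_eq hd]
  congr 1
  ext v
  constructor
  · rintro ⟨hv, hv'⟩
    exact ⟨(h v hv.mem).2 hv, hv.mem, hv'⟩
  · rintro ⟨hv, hv', hv''⟩
    exact ⟨(h v hv').1 hv, hv''⟩

/-- This makes a single computation of the good vertices sufficient. The cycle of a good vertex of
the rest stays in the rest: at an odd level it is a parity path without the largest priority, at an
even level the rest is closed under successors. The vertex cannot have the largest priority, or its
cycle would see it forever. Conversely, on a path in the rest the merged and the original priorities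
finally agree. -/
theorem GoodInv.restSet [Finite V] {C : Set V} (h : G.GoodInv C X P) :
    G.GoodInv C (G.restSet X P) (mergePrio P (maxPrio P X)) := by
  intro v hv
  have hvX := G.restSet_subset X P hv
  rw [h v hvX]
  constructor
  · intro hg
    obtain ⟨ρ, h0, hρ, hinf, hle⟩ := hg.exists_path
    have hlt : P v ≠ maxPrio P X → ∀ k, P (ρ k) ≠ maxPrio P X :=
      fun hne k => by
        have := le_maxPrio (P := P) hvX
        have := hle k
        omega
    have hpath : G.PathIn (G.restSet X P) ρ := by
      by_cases hd : Odd (maxPrio P X)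
      · rw [GameGraph.restSet_odd hd]
        exact pathIn_coopRegionIn (tailClosed_parity P)
          (hρ.mono fun k => ⟨hρ.mem k, hlt (restSet_ne_max_of_odd hd hv) k⟩)
          (mem_parity_of_even_max hg.1 hinf ⟨0, fun k _ => hle k⟩)
      · exact hρ.mono fun k => hρ.mem_restSet hd (h0 ▸ hv) k (Nat.zero_le k)
    have hne : P v ≠ maxPrio P X := fun heq =>
      hpath.not_infOften_maxPrio (hinf.mono (by simpa using heq))
    have hv' : mergePrio P (maxPrio P X) v = P v := mergePrio_of_ne hne
    refine goodIn_of_path (hv' ▸ hg.1) hpath hinf ⟨0, fun k _ => ?_⟩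
    simp only [Set.mem_ofPred_eq, hv', mergePrio_of_ne (hlt hne k)]
    exact hle k
  · intro hg
    obtain ⟨ρ, h0, hρ, hinf, hle⟩ := hg.exists_path
    obtain ⟨N, hN⟩ := not_infOften.1 hρ.not_infOften_maxPrio
    have hN' : ∀ k, N ≤ k → mergePrio P (maxPrio P X) (ρ k) = P (ρ k) :=
      fun k hk => mergePrio_of_ne (hN k hk)
    have hv' : mergePrio P (maxPrio P X) v = P v := by
      obtain ⟨k, hk, rfl⟩ := hinf N
      exact hN' k hk
    refine goodIn_of_path (hv' ▸ hg.1) (hρ.mono fun k => G.restSet_subset X P (hρ.mem k)) hinf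
      ⟨N, fun k hk => ?_⟩
    have := hle k
    rwa [hN' k hk, hv'] at this

end GameGraph

/-! ## Reasoning about programs -/

namespace Ram

/-- The cost of executing every instruction of the program once. -/
def Prog.wt : Prog → ℕ
  | .skip => 1
  | .set _ i j k x => i.cost + j.cost + k.cost + x.cost + 1
  | .seq p q => p.wt + q.wt
  | .ite c p q => c.cost + 1 + (p.wt + q.wt)
  | .loop c p => c.cost + 1 + p.wt

/-- Started in `s`, the program `p` halts in a store that satisfies `Q`, and the number of steps is
bounded by a multiple of `B` that depends only on the program. -/
def Ends (p : Prog) (s : Store) (B : ℕ) (Q : Store → Prop) : Prop :=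
  ∃ t s', Runs p s t s' ∧ t ≤ p.wt * B ∧ Q s'

theorem Ends.mono {p : Prog} {s : Store} {B B' : ℕ} {Q Q' : Store → Prop} (h : Ends p s B Q)
    (hB : B ≤ B') (hQ : ∀ s', Q s' → Q' s') : Ends p s B' Q' := by
  obtain ⟨t, s', hr, ht, hs⟩ := h
  exact ⟨t, s', hr, ht.trans (Nat.mul_le_mul_left _ hB), hQ s' hs⟩

/-- The weights of the two programs add up while the factor `B` is shared, so composing any fixed
number of blocks does not change the bound. -/
theorem Ends.seq {p q : Prog} {s : Store} {B : ℕ} {Q R : Store → Prop} (h : Ends p s B Q)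
    (h' : ∀ s', Q s' → Ends q s' B R) : Ends (.seq p q) s B R := by
  obtain ⟨t, s', hr, ht, hs⟩ := h
  obtain ⟨t', s'', hr', ht', hs'⟩ := h' s' hs
  refine ⟨t + t', s'', hr.seq hr', ?_, hs'⟩
  rw [Prog.wt, add_mul]
  omega

theorem Ends.skip {s : Store} {B : ℕ} {Q : Store → Prop} (hB : 1 ≤ B) (h : Q s) :
    Ends .skip s B Q :=
  ⟨1, s, .skip s, by simpa [Prog.wt] using hB, h⟩

theorem Ends.set {s : Store} {a B : ℕ} {i j k x : Term} {Q : Store → Prop} (hB : 1 ≤ B)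
    (h : Q (s.update a (i.val s) (j.val s) (k.val s) (x.val s))) :
    Ends (.set a i j k x) s B Q :=
  ⟨_, _, .set s a i j k x, Nat.le_mul_of_pos_right _ hB, h⟩

theorem Ends.ite {c : Term} {p q : Prog} {s : Store} {B : ℕ} {Q : Store → Prop} (hB : 1 ≤ B)
    (hp : c.val s ≠ 0 → Ends p s B Q) (hq : c.val s = 0 → Ends q s B Q) :
    Ends (.ite c p q) s B Q := by
  have hc := Nat.le_mul_of_pos_right (c.cost + 1) hB
  by_cases h : c.val s = 0
  · obtain ⟨t, s', hr, ht, hs⟩ := hq h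
    refine ⟨_, s', .ite_false h hr, ?_, hs⟩
    rw [Prog.wt, add_mul, add_mul p.wt]
    omega
  · obtain ⟨t, s', hr, ht, hs⟩ := hp h
    refine ⟨_, s', .ite_true h hr, ?_, hs⟩
    rw [Prog.wt, add_mul, add_mul p.wt]
    omega

/-- While loops with an invariant `I` and a potential `pot` that pays for the iterations. -/
theorem Ends.loop {γ : Type*} {c : Term} {p : Prog} (I : γ → Store → Prop) (pot : γ → ℕ)
    (h : ∀ g s, I g s → c.val s ≠ 0 → ∃ B, 1 ≤ B ∧ Ends p s B fun s' =>
      ∃ g', I g' s' ∧ B + pot g' ≤ pot g) (g : γ) (s : Store) (hI : I g s) :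
    Ends (.loop c p) s (pot g + 1) fun s' => ∃ g', I g' s' ∧ c.val s' = 0 := by
  induction hm : pot g using Nat.strong_induction_on generalizing g s with
  | _ m ih =>
    by_cases hc : c.val s = 0
    · refine ⟨_, s, .loop_false hc, ?_, g, hI, hc⟩
      rw [Prog.wt, add_mul]
      have := Nat.le_mul_of_pos_right (c.cost + 1) (Nat.succ_pos m)
      exact this.trans (Nat.le_add_right _ _)
    · obtain ⟨B, hB, t, s', hr, ht, g', hg', hle⟩ := h g s hI hc
      -- Since `B` is positive, paying for the iteration lowers the potential, which permits the
      -- induction.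
      obtain ⟨t', s'', hr', ht', hs''⟩ := ih (pot g') (by omega) g' s' hg' rfl
      refine ⟨_, s'', .loop_true hc hr hr', ?_, hs''⟩
      have h1 : Prog.wt (.loop c p) * (B + (pot g' + 1)) ≤ Prog.wt (.loop c p) * (m + 1) :=
        Nat.mul_le_mul_left _ (by omega)
      have h2 : c.cost + 1 + t ≤ Prog.wt (.loop c p) * B := by
        rw [Prog.wt, add_mul]
        have := Nat.le_mul_of_pos_right (c.cost + 1) hB
        omega
      rw [mul_add] at h1
      omega

/-- The scalar variable `a`. -/
abbrev Term.var (a : ℕ) : Term := .get a (.lit 0) (.lit 0) (.lit 0)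

/-- `for w < n`, where the number `n` of vertices is the scalar `0`. -/
def forP (w : ℕ) (p : Prog) : Prog :=
  .seq (.set w (.lit 0) (.lit 0) (.lit 0) (.lit 0))
    (.loop (.lt (.var w) (.var 0))
      (.seq p (.set w (.lit 0) (.lit 0) (.lit 0) (.add (.var w) (.lit 1)))))

theorem update_same (s : Store) (a i j k x : ℕ) : s.update a i j k x a i j k = x := by
  simp [Store.update]

theorem update_of_ne (s : Store) {a b : ℕ} (i j k x : ℕ) (h : b ≠ a) :
    s.update a i j k x b = s b := by
  funext i' j' k'
  simp [Store.update, h]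

theorem update_apply_of_ne (s : Store) {a i j k x i' j' k' : ℕ} (h : (i', j', k') ≠ (i, j, k)) :
    s.update a i j k x a i' j' k' = s a i' j' k' := by
  simp only [Store.update, true_and]
  refine if_neg fun h' => h ?_
  simp [h'.1, h'.2.1, h'.2.2]

/-- The potential is `B * (n - k)`, and the additional `B` covers the initialisation and the last
test. The hypothesis `hI` prevents the body from spoiling the counter or the bound. -/
theorem Ends.forP {w n B : ℕ} {p : Prog} {s : Store} (I : ℕ → Store → Prop) (hB : 1 ≤ B)
    (h0 : I 0 (s.update w 0 0 0 0))
    (hI : ∀ k s', I k s' → s' 0 0 0 0 = n ∧ s' w 0 0 0 = k)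
    (hb : ∀ k s', k < n → I k s' → Ends p s' B fun s'' =>
      I (k + 1) (s''.update w 0 0 0 (s'' w 0 0 0 + 1))) :
    Ends (forP w p) s (B * (n + 1)) (I n) := by
  refine Ends.seq (Q := I 0) (Ends.set (hB.trans (Nat.le_mul_of_pos_right _ (Nat.succ_pos n))) h0)
    fun s' hs' => ?_
  refine (Ends.loop (fun k s => k ≤ n ∧ I k s) (fun k => B * (n - k)) ?_ 0 s'
    ⟨Nat.zero_le _, hs'⟩).mono ?_ ?_
  · rintro k s ⟨hk, hs⟩ hc
    obtain ⟨hn, hk'⟩ := hI k s hs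
    have hkn : k < n := by
      by_contra hkn
      exact hc (by simp [Term.val, hn, hk', hkn])
    refine ⟨B, hB, (hb k s hkn hs).seq fun s'' hs'' => Ends.set hB ⟨k + 1, ⟨hkn, hs''⟩, ?_⟩⟩
    rw [show n - k = n - (k + 1) + 1 by omega, mul_add]
    omega
  · rw [mul_add]
    simpa using hB
  · rintro s ⟨k, ⟨hk, hs⟩, hc⟩
    obtain ⟨hn, hk'⟩ := hI k s hs
    simp only [Term.val, hn, hk'] at hc
    have : ¬ k < n := fun h => by simp [h] at hc
    obtain rfl : k = n := by omega
    exact hs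

/-- The stores agree except for the arrays in `A`. -/
def Frame (A : List ℕ) (s s' : Store) : Prop :=
  ∀ b, b ∉ A → s' b = s b

theorem Frame.refl (A : List ℕ) (s : Store) : Frame A s s := fun _ _ => rfl

theorem Frame.trans {A : List ℕ} {s s' s'' : Store} (h : Frame A s s') (h' : Frame A s' s'') :
    Frame A s s'' := fun b hb => (h' b hb).trans (h b hb)

theorem Frame.mono {A B : List ℕ} {s s' : Store} (h : Frame A s s') (hAB : A ⊆ B) :
    Frame B s s' := fun b hb => h b fun hb' => hb (hAB hb')

theorem Frame.update {A : List ℕ} {s s' : Store} (h : Frame A s s') {a i j k x : ℕ}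
    (ha : a ∈ A) : Frame A s (s'.update a i j k x) := fun b hb => by
  have hba : b ≠ a := fun hba => hb (hba ▸ ha)
  rw [update_of_ne _ _ _ _ _ hba, h b hb]

/-- The entry of an array at a triple of indices. -/
def at3 (f : ℕ → ℕ → ℕ → ℕ) (c : ℕ × ℕ × ℕ) : ℕ := f c.1 c.2.1 c.2.2

theorem at3_update_same (s : Store) (a : ℕ) (c : ℕ × ℕ × ℕ) (x : ℕ) :
    at3 (s.update a c.1 c.2.1 c.2.2 x a) c = x := update_same _ _ _ _ _ _

theorem at3_update_of_ne (s : Store) {a x : ℕ} {c c' : ℕ × ℕ × ℕ} (h : c' ≠ c) :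
    at3 (s.update a c.1 c.2.1 c.2.2 x a) c' = at3 (s a) c' := update_apply_of_ne s h

/-- A loop that assigns to pairwise different entries of the array `a`. -/
theorem Ends.fill {w a n : ℕ} {i j k e : Term} {s : Store} {cell : ℕ → ℕ × ℕ × ℕ}
    {Φ : ℕ → ℕ → Prop} (hn : s 0 0 0 0 = n) (hw : w ≠ 0) (ha : a ≠ 0) (haw : a ≠ w)
    (hc : ∀ x < n, ∀ s', Frame [a, w] s s' → s' w 0 0 0 = x →
      (i.val s', j.val s', k.val s') = cell x)
    (hinj : ∀ x < n, ∀ x' < n, cell x = cell x' → x = x')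
    (he : ∀ x < n, ∀ s', Frame [a, w] s s' → s' w 0 0 0 = x →
      at3 (s' a) (cell x) = at3 (s a) (cell x) → Φ x (e.val s')) :
    Ends (Ram.forP w (.set a i j k e)) s (n + 1)
      fun s' => Frame [a, w] s s' ∧ (∀ x < n, Φ x (at3 (s' a) (cell x))) ∧
        ∀ c, (∀ x < n, c ≠ cell x) → at3 (s' a) c = at3 (s a) c := by
  refine (Ends.forP (n := n) (B := 1) (fun m s' => (Frame [a, w] s s' ∧ s' w 0 0 0 = m) ∧
    (∀ x < n, x < m → Φ x (at3 (s' a) (cell x))) ∧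
    ∀ c, (∀ x < n, x < m → c ≠ cell x) → at3 (s' a) c = at3 (s a) c) le_rfl ?_ ?_ ?_).mono (by simp) ?_
  · refine ⟨⟨(Frame.refl _ s).update (by simp), update_same _ _ _ _ _ _⟩, fun x _ hx => by omega,
      fun c _ => ?_⟩
    rw [update_of_ne _ _ _ _ _ haw]
  · rintro m s' ⟨⟨hf, hm⟩, -⟩
    exact ⟨by rw [hf 0 (by simp [hw.symm, ha.symm]), hn], hm⟩
  · rintro m s' hmn ⟨⟨hf, hm⟩, h1, h2⟩
    apply Ends.set le_rfl
    have hcell := hc m hmn s' hf hm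
    -- As the cells are different, the current one has not been written yet. The expression may
    -- therefore read its old value.
    have hval := he m hmn s' hf hm (h2 _ fun x hx hxm heq => by
      have := hinj _ hmn _ hx heq
      omega)
    have hci : i.val s' = (cell m).1 := by rw [← hcell]
    have hcj : j.val s' = (cell m).2.1 := by rw [← hcell]
    have hck : k.val s' = (cell m).2.2 := by rw [← hcell]
    rw [hci, hcj, hck]
    refine ⟨⟨(hf.update (by simp)).update (by simp), ?_⟩, ?_, ?_⟩
    · rw [update_same, update_of_ne _ _ _ _ _ haw.symm, hm]
    · intro x hx hxm
      rw [update_of_ne _ _ _ _ _ haw]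
      rcases Nat.lt_succ_iff_lt_or_eq.1 hxm with hxm | rfl
      · rw [at3_update_of_ne]
        · exact h1 x hx hxm
        · exact fun heq => by
            have := hinj _ hx _ hmn heq
            omega
      · rwa [at3_update_same]
    · intro c hc'
      rw [update_of_ne _ _ _ _ _ haw, at3_update_of_ne _ (hc' m hmn (by omega))]
      exact h2 c fun x hx hxm => hc' x hx (by omega)
  · rintro s' ⟨⟨hf, -⟩, h1, h2⟩
    exact ⟨hf, fun x hx => h1 x hx hx, fun c hc => h2 c fun x hx _ => hc x hx⟩

/-- A nested loop that assigns to pairwise different entries of the array `a`. -/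
theorem Ends.fill₂ {w w' a n : ℕ} {i j k e : Term} {s : Store} {cell : ℕ → ℕ → ℕ × ℕ × ℕ}
    {Φ : ℕ → ℕ → ℕ → Prop} (hn : s 0 0 0 0 = n) (hw : w ≠ 0) (hw' : w' ≠ 0) (ha : a ≠ 0)
    (haw : a ≠ w) (haw' : a ≠ w') (hww : w ≠ w')
    (hc : ∀ x < n, ∀ y < n, ∀ s', Frame [a, w, w'] s s' → s' w 0 0 0 = x → s' w' 0 0 0 = y →
      (i.val s', j.val s', k.val s') = cell x y)
    (hinj : ∀ x < n, ∀ y < n, ∀ x' < n, ∀ y' < n, cell x y = cell x' y' → x = x' ∧ y = y')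
    (he : ∀ x < n, ∀ y < n, ∀ s', Frame [a, w, w'] s s' → s' w 0 0 0 = x → s' w' 0 0 0 = y →
      at3 (s' a) (cell x y) = at3 (s a) (cell x y) → Φ x y (e.val s')) :
    Ends (Ram.forP w (Ram.forP w' (.set a i j k e))) s ((n + 1) ^ 2)
      fun s' => Frame [a, w, w'] s s' ∧ (∀ x < n, ∀ y < n, Φ x y (at3 (s' a) (cell x y))) ∧
        ∀ c, (∀ x < n, ∀ y < n, c ≠ cell x y) → at3 (s' a) c = at3 (s a) c := by
  refine (Ends.forP (n := n) (B := n + 1)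
    (fun m s' => (Frame [a, w, w'] s s' ∧ s' w 0 0 0 = m) ∧
    (∀ x < n, x < m → ∀ y < n, Φ x y (at3 (s' a) (cell x y))) ∧
    ∀ c, (∀ x < n, x < m → ∀ y < n, c ≠ cell x y) → at3 (s' a) c = at3 (s a) c) (Nat.succ_pos n) ?_ ?_ ?_).mono
      (pow_two _).ge ?_
  · refine ⟨⟨(Frame.refl _ s).update (by simp), update_same _ _ _ _ _ _⟩, fun x _ hx => by omega,
      fun c _ => ?_⟩
    rw [update_of_ne _ _ _ _ _ haw]
  · rintro m s' ⟨⟨hf, hm⟩, -⟩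
    exact ⟨by rw [hf 0 (by simp [hw.symm, ha.symm, hw'.symm]), hn], hm⟩
  · rintro m s' hmn ⟨⟨hf, hm⟩, h1, h2⟩
    have hfr : ∀ s'', Frame [a, w'] s' s'' → Frame [a, w, w'] s s'' := fun s'' h =>
      hf.trans (h.mono (by simp))
    have hm' : ∀ s'', Frame [a, w'] s' s'' → s'' w 0 0 0 = m := fun s'' h => by
      rw [h w (by simp [haw.symm, hww]), hm]
    refine (Ends.fill (w := w') (a := a) (n := n) (s := s') (cell := cell m) (Φ := Φ m) ?_ hw' ha
      haw' ?_ ?_ ?_).mono le_rfl ?_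
    · rw [hf 0 (by simp [hw.symm, ha.symm, hw'.symm]), hn]
    · exact fun y hy s'' hs'' hy' => hc m hmn y hy s'' (hfr _ hs'') (hm' _ hs'') hy'
    · exact fun y hy y' hy' heq => (hinj m hmn y hy m hmn y' hy' heq).2
    · refine fun y hy s'' hs'' hy' heq => he m hmn y hy s'' (hfr _ hs'') (hm' _ hs'') hy' ?_
      rw [heq]
      refine h2 _ fun x hx hxm y' hy' heq => ?_
      have := (hinj _ hmn _ hy _ hx _ hy' heq).1
      omega
    · rintro s'' ⟨g1, g2, g3⟩
      refine ⟨⟨(hfr _ g1).update (by simp), ?_⟩, ?_, ?_⟩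
      · rw [update_same, hm' _ g1]
      · intro x hx hxm y hy
        rw [update_of_ne _ _ _ _ _ haw]
        rcases Nat.lt_succ_iff_lt_or_eq.1 hxm with hxm | rfl
        · rw [g3]
          · exact h1 x hx hxm y hy
          · intro y' hy' heq
            have := (hinj _ hx _ hy _ hmn _ hy' heq).1
            omega
        · exact g2 y hy
      · intro c hc'
        rw [update_of_ne _ _ _ _ _ haw, g3 _ fun y hy => hc' m hmn (by omega) y hy]
        exact h2 c fun x hx hxm => hc' x hx (by omega)
  · rintro s' ⟨⟨hf, -⟩, h1, h2⟩
    exact ⟨hf, fun x hx => h1 x hx hx, fun c hc => h2 c fun x hx _ => hc x hx⟩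

/-- A loop that adds up values in one entry of the array `a`. -/
theorem Ends.acc {w a n : ℕ} {i j k e : Term} {s : Store} {cell : ℕ × ℕ × ℕ}
    {Q : ℕ → Prop} (hn : s 0 0 0 0 = n) (hw : w ≠ 0) (ha : a ≠ 0) (haw : a ≠ w)
    (hc : ∀ s', Frame [a, w] s s' → (i.val s', j.val s', k.val s') = cell)
    (he : ∀ x < n, ∀ s', Frame [a, w] s s' → s' w 0 0 0 = x → (e.val s' ≠ 0 ↔ Q x)) :
    Ends (Ram.forP w (.set a i j k (.add (.get a i j k) e))) s (n + 1)
      fun s' => Frame [a, w] s s' ∧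
        (at3 (s' a) cell ≠ 0 ↔ at3 (s a) cell ≠ 0 ∨ ∃ x < n, Q x) ∧
        ∀ c, c ≠ cell → at3 (s' a) c = at3 (s a) c := by
  refine (Ends.forP (n := n) (B := 1)
    (fun m s' => (Frame [a, w] s s' ∧ s' w 0 0 0 = m) ∧
    (at3 (s' a) cell ≠ 0 ↔ at3 (s a) cell ≠ 0 ∨ ∃ x < n, x < m ∧ Q x) ∧
    ∀ c, c ≠ cell → at3 (s' a) c = at3 (s a) c) le_rfl ?_ ?_ ?_).mono (by simp) ?_
  · refine ⟨⟨(Frame.refl _ s).update (by simp), update_same _ _ _ _ _ _⟩, ?_, fun c _ => ?_⟩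
    · rw [update_of_ne _ _ _ _ _ haw]
      simp
    · rw [update_of_ne _ _ _ _ _ haw]
  · rintro m s' ⟨⟨hf, hm⟩, -⟩
    exact ⟨by rw [hf 0 (by simp [hw.symm, ha.symm]), hn], hm⟩
  · rintro m s' hmn ⟨⟨hf, hm⟩, h1, h2⟩
    refine Ends.set le_rfl ?_
    have hcell := hc s' hf
    have hci : i.val s' = cell.1 := by rw [← hcell]
    have hcj : j.val s' = cell.2.1 := by rw [← hcell]
    have hck : k.val s' = cell.2.2 := by rw [← hcell]
    simp only [Term.val, hci, hcj, hck]
    refine ⟨⟨(hf.update (by simp)).update (by simp), ?_⟩, ?_, ?_⟩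
    · rw [update_same, update_of_ne _ _ _ _ _ haw.symm, hm]
    · rw [update_of_ne _ _ _ _ _ haw, at3_update_same]
      change at3 (s' a) cell + e.val s' ≠ 0 ↔ _
      have he' := he m hmn s' hf hm
      have : at3 (s' a) cell + e.val s' ≠ 0 ↔ at3 (s' a) cell ≠ 0 ∨ e.val s' ≠ 0 := by omega
      rw [this, h1, he', or_assoc]
      refine or_congr Iff.rfl ⟨?_, ?_⟩
      · rintro (⟨x, hx, hxm, hq⟩ | hq)
        · exact ⟨x, hx, by omega, hq⟩
        · exact ⟨m, hmn, by omega, hq⟩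
      · rintro ⟨x, hx, hxm, hq⟩
        rcases Nat.lt_succ_iff_lt_or_eq.1 hxm with hxm | rfl
        · exact Or.inl ⟨x, hx, hxm, hq⟩
        · exact Or.inr hq
    · intro c hc'
      rw [update_of_ne _ _ _ _ _ haw, at3_update_of_ne _ hc']
      exact h2 c hc'
  · rintro s' ⟨⟨hf, -⟩, h1, h2⟩
    refine ⟨hf, h1.trans (or_congr Iff.rfl (exists_congr fun x => and_congr_right fun hx => ?_)), h2⟩
    simp [hx]

end Ram

namespace Ram

/-! ## Sets of vertices and edges in arrays -/

namespace Term

def neg (x : Term) : Term := eq x (lit 0)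

/-- Truth means being nonzero, so a sum of naturals is a disjunction, and loops that add up values
decide existence. -/
def or (x y : Term) : Term := add x y

def and (x y : Term) : Term := neg (or (neg x) (neg y))

/-- The entry of the array `a` at the index `x`. -/
def mem (a : ℕ) (x : Term) : Term := get a x (lit 0) (lit 0)

/-- The term has a nonzero value. -/
def Holds (s : Store) (x : Term) : Prop := x.val s ≠ 0

@[simp] theorem holds_neg {s : Store} {x : Term} : Holds s (neg x) ↔ ¬ Holds s x := by
  by_cases h : x.val s = 0 <;> simp [Holds, neg, val, h]

@[simp] theorem holds_or {s : Store} {x y : Term} : Holds s (or x y) ↔ Holds s x ∨ Holds s y := by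
  simp only [Holds, or, val]
  omega

@[simp] theorem holds_and {s : Store} {x y : Term} :
    Holds s (and x y) ↔ Holds s x ∧ Holds s y := by
  simp [and]

@[simp] theorem holds_eq {s : Store} {x y : Term} : Holds s (eq x y) ↔ x.val s = y.val s := by
  simp [Holds, val]

@[simp] theorem holds_lt {s : Store} {x y : Term} : Holds s (lt x y) ↔ x.val s < y.val s := by
  simp [Holds, val]

@[simp] theorem holds_bit {s : Store} {x : Term} : Holds s (bit x) ↔ Odd (x.val s) := by
  simp [Holds, val, Nat.odd_iff]

@[simp] theorem holds_lit_one {s : Store} : Holds s (lit 1) := by simp [Holds, val]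

theorem holds_get {s : Store} {a : ℕ} {x y z : Term} :
    Holds s (get a x y z) ↔ s a (x.val s) (y.val s) (z.val s) ≠ 0 := Iff.rfl

@[simp] theorem val_mem {s : Store} {a : ℕ} {x : Term} : val s (mem a x) = s a (x.val s) 0 0 := rfl

end Term

variable {n : ℕ}

/-- The array `a` stores the set `X` of vertices. -/
def IsSet (s : Store) (a : ℕ) (X : Set (Fin n)) : Prop :=
  ∀ v : Fin n, s a v 0 0 ≠ 0 ↔ v ∈ X

/-- The array `a` stores the set `R` of edges. -/
def IsRel (s : Store) (a : ℕ) (R : Set (Fin n × Fin n)) : Prop :=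
  ∀ v w : Fin n, s a v w 0 ≠ 0 ↔ (v, w) ∈ R

theorem IsSet.frame {A : List ℕ} {s s' : Store} {a : ℕ} {X : Set (Fin n)} (h : IsSet s a X)
    (hf : Frame A s s') (ha : a ∉ A) : IsSet s' a X := fun v => by
  rw [hf a ha]; exact h v

theorem IsRel.frame {A : List ℕ} {s s' : Store} {a : ℕ} {R : Set (Fin n × Fin n)}
    (h : IsRel s a R) (hf : Frame A s s') (ha : a ∉ A) : IsRel s' a R := fun v w => by
  rw [hf a ha]; exact h v w

/-- Loops over the vertices use the scalars `30` and `31`. -/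
abbrev vx : Term := .var 30

abbrev vy : Term := .var 31

/-- `a[x] := e` for all `x`. -/
def vecP (a : ℕ) (e : Term) : Prog := forP 30 (.set a vx (.lit 0) (.lit 0) e)

/-- `a[x] := Σ y, e` for all `x`. -/
def exP (a : ℕ) (e : Term) : Prog :=
  forP 30 (.seq (.set a vx (.lit 0) (.lit 0) (.lit 0))
    (forP 31 (.set a vx (.lit 0) (.lit 0) (.add (.get a vx (.lit 0) (.lit 0)) e))))

/-- `a := Σ x, e`. -/
def anyP (a : ℕ) (e : Term) : Prog :=
  .seq (.set a (.lit 0) (.lit 0) (.lit 0) (.lit 0))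
    (forP 30 (.set a (.lit 0) (.lit 0) (.lit 0) (.add (.get a (.lit 0) (.lit 0) (.lit 0)) e)))

/-- `a[g, x, y] := e` for all `x`, `y`. -/
def matP (a : ℕ) (g e : Term) : Prog := forP 30 (forP 31 (.set a g vx vy e))

/-- `a[g, x] := e` for all `x`. -/
def rowP (a : ℕ) (g e : Term) : Prog := forP 30 (.set a g vx (.lit 0) e)

/-- `a[x, y] := a[x, y] + e` for all `x`, `y`. -/
def orP (a : ℕ) (e : Term) : Prog :=
  forP 30 (forP 31 (.set a vx vy (.lit 0) (.or (.get a vx vy (.lit 0)) e)))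

theorem le_sq (n : ℕ) : n + 1 ≤ (n + 1) ^ 2 := Nat.le_self_pow (by decide) _

theorem one_le_pow_succ (n k : ℕ) : 1 ≤ (n + 1) ^ k := Nat.one_le_pow _ _ (Nat.succ_pos n)

/-- A single loop is linear. The quadratic bound is chosen to agree with the double loops, so that
all these blocks can be composed without adjustment. -/
theorem vecP_ends {a : ℕ} {e : Term} {s : Store} (X : Set (Fin n)) (hn : s 0 0 0 0 = n)
    (ha : a ≠ 0) (ha' : a ≠ 30)
    (he : ∀ x : Fin n, ∀ s', Frame [a, 30] s s' → vx.val s' = x → (e.Holds s' ↔ x ∈ X)) :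
    Ends (vecP a e) s ((n + 1) ^ 2) fun s' => Frame [a, 30] s s' ∧ IsSet s' a X := by
  refine (Ends.fill (n := n) (cell := fun x => (x, 0, 0))
    (Φ := fun x m => ∀ h : x < n, (m ≠ 0 ↔ (⟨x, h⟩ : Fin n) ∈ X)) hn (by decide) ha ha' ?_ ?_ ?_).mono
    (le_sq n) ?_
  · intro x hx s' _ hx'
    simp [Term.val, hx']
  · intro x _ x' _ h
    simpa using h
  · exact fun x hx s' hf hx' _ h => he ⟨x, h⟩ s' hf hx'
  · rintro s' ⟨hf, h, -⟩
    exact ⟨hf, fun v => h v v.2 v.2⟩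

theorem rowP_ends {a : ℕ} {g e : Term} {s : Store} (X : Set (Fin n)) (hn : s 0 0 0 0 = n)
    (ha : a ≠ 0) (ha' : a ≠ 30) (hg : ∀ s', Frame [a, 30] s s' → g.val s' = g.val s)
    (he : ∀ x : Fin n, ∀ s', Frame [a, 30] s s' → vx.val s' = x → (e.Holds s' ↔ x ∈ X)) :
    Ends (rowP a g e) s ((n + 1) ^ 2) fun s' => Frame [a, 30] s s' ∧
      (∀ v : Fin n, s' a (g.val s) v 0 ≠ 0 ↔ v ∈ X) ∧
      ∀ m, m ≠ g.val s → ∀ v, s' a m v 0 = s a m v 0 := by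
  refine (Ends.fill (n := n) (cell := fun x => (g.val s, x, 0))
    (Φ := fun x m => ∀ h : x < n, (m ≠ 0 ↔ (⟨x, h⟩ : Fin n) ∈ X)) hn (by decide) ha ha' ?_ ?_ ?_).mono
    (le_sq n) ?_
  · intro x hx s' hf hx'
    simp [Term.val, hx', hg s' hf]
  · intro x _ x' _ h
    simpa using h
  · exact fun x hx s' hf hx' _ h => he ⟨x, h⟩ s' hf hx'
  · rintro s' ⟨hf, h, h'⟩
    exact ⟨hf, fun v => h v v.2 v.2, fun m hm v => h' (m, v, 0) fun x _ heq => hm (by simp_all)⟩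

theorem matP_ends {a : ℕ} {g e : Term} {s : Store} (R : Set (Fin n × Fin n)) (hn : s 0 0 0 0 = n)
    (ha : a ≠ 0) (ha' : a ≠ 30) (ha'' : a ≠ 31)
    (hg : ∀ s', Frame [a, 30, 31] s s' → g.val s' = g.val s)
    (he : ∀ x y : Fin n, ∀ s', Frame [a, 30, 31] s s' → vx.val s' = x → vy.val s' = y →
      (e.Holds s' ↔ (x, y) ∈ R)) :
    Ends (matP a g e) s ((n + 1) ^ 2) fun s' =>
      Frame [a, 30, 31] s s' ∧
      (∀ v w : Fin n, s' a (g.val s) v w ≠ 0 ↔ (v, w) ∈ R) ∧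
      ∀ m, m ≠ g.val s → s' a m = s a m := by
  refine (Ends.fill₂ (n := n) (cell := fun x y => (g.val s, x, y))
    (Φ := fun x y m => ∀ (h : x < n) (h' : y < n), (m ≠ 0 ↔ ((⟨x, h⟩, ⟨y, h'⟩) : Fin n × Fin n) ∈ R))
    hn (by decide) (by decide) ha ha' ha'' (by decide) ?_ ?_ ?_).mono
    le_rfl ?_
  · intro x hx y hy s' hf hx' hy'
    simp [Term.val, hx', hy', hg s' hf]
  · intro x _ y _ x' _ y' _ h
    simpa using h
  · exact fun x hx y hy s' hf hx' hy' _ h h' => he ⟨x, h⟩ ⟨y, h'⟩ s' hf hx' hy'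
  · rintro s' ⟨hf, h, h'⟩
    refine ⟨hf, fun v w => h v v.2 w w.2 v.2 w.2, fun m hm => ?_⟩
    funext v w
    exact h' (m, v, w) fun x _ y _ heq => hm (by simp_all)

theorem orP_ends {a : ℕ} {e : Term} {s : Store} {R : Set (Fin n × Fin n)}
    (R' : Set (Fin n × Fin n)) (hR : IsRel s a R) (hn : s 0 0 0 0 = n)
    (ha : a ≠ 0) (ha' : a ≠ 30) (ha'' : a ≠ 31)
    (he : ∀ x y : Fin n, ∀ s', Frame [a, 30, 31] s s' → vx.val s' = x → vy.val s' = y →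
      (e.Holds s' ↔ (x, y) ∈ R')) :
    Ends (orP a e) s ((n + 1) ^ 2) fun s' =>
      Frame [a, 30, 31] s s' ∧ IsRel s' a (R ∪ R') := by
  refine (Ends.fill₂ (n := n) (cell := fun x y => (x, y, 0))
    (Φ := fun x y m => ∀ (h : x < n) (h' : y < n),
      (m ≠ 0 ↔ ((⟨x, h⟩, ⟨y, h'⟩) : Fin n × Fin n) ∈ R ∪ R'))
    hn (by decide) (by decide) ha ha' ha'' (by decide) ?_ ?_ ?_).mono
    le_rfl ?_
  · intro x hx y hy s' hf hx' hy'
    simp [Term.val, hx', hy']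
  · intro x _ y _ x' _ y' _ h
    simpa using h
  · intro x hx y hy s' hf hx' hy' hc h h'
    have h1 := he ⟨x, h⟩ ⟨y, h'⟩ s' hf hx' hy'
    have h2 := hR ⟨x, h⟩ ⟨y, h'⟩
    have h3 := Term.holds_or (s := s') (x := .get a vx vy (.lit 0)) (y := e)
    rw [h1] at h3
    refine h3.trans (or_congr ?_ Iff.rfl)
    rw [← h2]
    simp only [Term.holds_get, Term.val, hx', hy']
    exact iff_of_eq (congrArg (· ≠ 0) hc)
  · rintro s' ⟨hf, h, h'⟩
    exact ⟨hf, fun v w => h v v.2 w w.2 v.2 w.2⟩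

theorem anyP_ends {a : ℕ} {e : Term} {s : Store} (Q : Fin n → Prop) (hn : s 0 0 0 0 = n)
    (ha : a ≠ 0) (ha' : a ≠ 30)
    (he : ∀ x : Fin n, ∀ s', Frame [a, 30] s s' → vx.val s' = x → (e.Holds s' ↔ Q x)) :
    Ends (anyP a e) s ((n + 1) ^ 2) fun s' => Frame [a, 30] s s' ∧
      (s' a 0 0 0 ≠ 0 ↔ ∃ x, Q x) ∧
      ∀ i j k, (i, j, k) ≠ (0, 0, 0) → s' a i j k = s a i j k := by
  refine Ends.seq (Ends.set (Q := fun s' => s' = s.update a 0 0 0 0) (one_le_pow_succ n 2) rfl) ?_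
  · rintro _ rfl
    have hfr : Frame [a, 30] s (s.update a 0 0 0 0) := (Frame.refl _ s).update (by simp)
    refine (Ends.acc (n := n) (cell := (0, 0, 0)) (Q := fun x => ∃ h : x < n, Q ⟨x, h⟩) ?_ (by decide)
      ha ha' ?_ ?_).mono (le_sq n) ?_
    · rw [hfr 0 (by simp [ha.symm]), hn]
    · simp [Term.val]
    · intro x hx s' hf hx'
      have := he ⟨x, hx⟩ s' (hfr.trans hf) hx'
      simpa [hx, Term.Holds] using this
    · rintro s' ⟨hf, h1, h2⟩
      refine ⟨hfr.trans hf, ?_, ?_⟩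
      · refine h1.trans ?_
        simp only [at3, update_same, ne_eq, not_true_eq_false, false_or]
        constructor
        · rintro ⟨x, hx, _, hq⟩
          exact ⟨_, hq⟩
        · rintro ⟨x, hq⟩
          exact ⟨x, x.2, x.2, hq⟩
      · intro i j k hne
        refine (h2 (i, j, k) hne).trans ?_
        exact update_apply_of_ne s hne

theorem exP_ends {a : ℕ} {e : Term} {s : Store} (Q : Fin n → Fin n → Prop) (hn : s 0 0 0 0 = n)
    (ha : a ≠ 0) (ha' : a ≠ 30) (ha'' : a ≠ 31)
    (he : ∀ x y : Fin n, ∀ s', Frame [a, 30, 31] s s' → vx.val s' = x → vy.val s' = y →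
      (e.Holds s' ↔ Q x y)) :
    Ends (exP a e) s ((n + 1) ^ 2) fun s' => Frame [a, 30, 31] s s' ∧
      IsSet s' a {x | ∃ y, Q x y} := by
  refine (Ends.forP (n := n) (B := n + 1)
    (fun m s' => (Frame [a, 30, 31] s s' ∧ s' 30 0 0 0 = m) ∧
      ∀ x : Fin n, x < m → (s' a x 0 0 ≠ 0 ↔ ∃ y, Q x y)) (Nat.succ_pos n) ?_ ?_ ?_).mono (pow_two _).ge ?_
  · exact ⟨⟨(Frame.refl _ s).update (by simp), update_same _ _ _ _ _ _⟩, fun x hx => by omega⟩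
  · rintro m s' ⟨⟨hf, hm⟩, -⟩
    exact ⟨by rw [hf 0 (by simp [ha.symm]), hn], hm⟩
  · rintro m s' hmn ⟨⟨hf, hm⟩, h1⟩
    refine Ends.seq (Ends.set (Q := fun s'' => s'' = s'.update a m 0 0 0) (Nat.succ_pos n) ?_) ?_
    · simp [Term.val, hm]
    · rintro _ rfl
      have hfr : Frame [a, 30, 31] s (s'.update a m 0 0 0) := hf.update (by simp)
      have h30 : (s'.update a m 0 0 0) 30 0 0 0 = m := by
        rw [update_of_ne _ _ _ _ _ ha'.symm, hm]
      have h30' : ∀ s'', Frame [a, 31] (s'.update a m 0 0 0) s'' → s'' 30 0 0 0 = m :=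
        fun s'' hf' => by rw [hf' 30 (by simp [ha'.symm]), h30]
      refine (Ends.acc (n := n) (cell := (m, 0, 0))
        (Q := fun y => ∃ h : y < n, Q ⟨m, hmn⟩ ⟨y, h⟩) ?_ (by decide)
        ha ha'' ?_ ?_).mono le_rfl ?_
      · rw [hfr 0 (by simp [ha.symm]), hn]
      · intro s'' hf'
        simp [Term.val, h30' s'' hf']
      · intro y hy s'' hf' hy'
        have := he ⟨m, hmn⟩ ⟨y, hy⟩ s'' (hfr.trans (hf'.mono (by simp))) (h30' s'' hf') hy'
        simpa [hy, Term.Holds] using this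
      · rintro s'' ⟨hf', g1, g2⟩
        refine ⟨⟨(hfr.trans (hf'.mono (by simp))).update (by simp), ?_⟩, ?_⟩
        · rw [update_same, h30' s'' hf']
        · intro x hx
          rw [update_of_ne _ _ _ _ _ ha']
          rcases Nat.lt_succ_iff_lt_or_eq.1 hx with hx | hx
          · rw [← h1 x hx]
            have h2 : s'' a x 0 0 = s'.update a m 0 0 0 a x 0 0 :=
              g2 (x, 0, 0) (by simp; omega)
            rw [h2, update_apply_of_ne _ (by simp; omega)]
          · subst hx
            refine g1.trans ?_
            simp only [at3, update_same, ne_eq, not_true_eq_false, false_or]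
            constructor
            · rintro ⟨y, hy, _, hq⟩
              exact ⟨_, hq⟩
            · rintro ⟨y, hq⟩
              exact ⟨y, y.2, y.2, hq⟩
  · rintro s' ⟨⟨hf, -⟩, h1⟩
    exact ⟨hf, fun v => h1 v v.2⟩

end Ram

namespace Ram

open GameGraph

variable {n : ℕ}

/-! ## Reachability, good vertices and the largest priority -/

/-- The store contains the game graph and the player. -/
structure Env (G : GameGraph (Fin n)) (i : Fin 2) (s : Store) : Prop where
  size : s 0 0 0 0 = n
  player : s 1 0 0 0 = i.val
  owner : ∀ v : Fin n, s 2 v 0 0 = (G.owner v).val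
  adj : ∀ v w : Fin n, s 3 v w 0 ≠ 0 ↔ G.Adj v w

/-- The edge relation. -/
def edgeT (t u : Term) : Term := .get 3 t u (.lit 0)

/-- The vertex belongs to the player `i`. -/
def ownT (t : Term) : Term := .eq (.mem 2 t) (.var 1)

/-- The array `4` stores the priorities. -/
def IsPrio (s : Store) (P : Fin n → ℕ) : Prop := ∀ v : Fin n, s 4 v 0 0 = P v

section Frames

variable {G : GameGraph (Fin n)} {i : Fin 2} {s s' : Store} {A : List ℕ}

theorem Env.frame (h : Env G i s) (hf : Frame A s s') (hA : ∀ b < 4, b ∉ A) : Env G i s' where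
  size := by rw [hf 0 (hA 0 (by decide)), h.size]
  player := by rw [hf 1 (hA 1 (by decide)), h.player]
  owner v := by rw [hf 2 (hA 2 (by decide)), h.owner]
  adj v w := by rw [hf 3 (hA 3 (by decide)), h.adj]

theorem Env.holds_edge (h : Env G i s) {t u : Term} {v w : Fin n} (hv : t.val s = v)
    (hw : u.val s = w) : (edgeT t u).Holds s ↔ G.Adj v w := by
  rw [← h.adj, ← hv, ← hw]
  rfl

theorem Env.holds_own (h : Env G i s) {t : Term} {v : Fin n} (hv : t.val s = v) :
    (ownT t).Holds s ↔ G.owner v = i := by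
  simp only [ownT, Term.holds_eq, Term.val_mem, Term.val, hv, h.owner, h.player, Fin.ext_iff]

theorem IsSet.holds {a : ℕ} {X : Set (Fin n)} (h : IsSet s a X) {t : Term} {v : Fin n}
    (hv : t.val s = v) : (Term.mem a t).Holds s ↔ v ∈ X := by
  rw [← h, ← hv]
  rfl

theorem IsPrio.frame {P : Fin n → ℕ} (h : IsPrio s P) (hf : Frame A s s') (hA : 4 ∉ A) :
    IsPrio s' P := fun v => by rw [hf 4 hA, h]

theorem IsPrio.val {P : Fin n → ℕ} (h : IsPrio s P) {t : Term} {v : Fin n} (hv : t.val s = v) :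
    (Term.mem 4 t).val s = P v := by
  rw [Term.val_mem, hv, h]

end Frames

/-- The array `22` becomes the set of vertices from which the set in `28` can be reached within the
set in `27`. -/
def reachP : Prog :=
  .seq (vecP 22 (.mem 28 vx))
    (forP 32 (.seq
      (exP 23 (.and (.mem 22 vy) (.or (.eq vx vy)
        (.and (edgeT vx vy) (.and (.mem 27 vx) (.mem 27 vy))))))
      (vecP 22 (.mem 23 vx))))

theorem Ends.forPow {w n k : ℕ} {p : Prog} {s : Store} (I : ℕ → Store → Prop)
    (h0 : I 0 (s.update w 0 0 0 0))
    (hI : ∀ k s', I k s' → s' 0 0 0 0 = n ∧ s' w 0 0 0 = k)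
    (hb : ∀ m s', m < n → I m s' → Ends p s' ((n + 1) ^ k) fun s'' =>
      I (m + 1) (s''.update w 0 0 0 (s'' w 0 0 0 + 1))) :
    Ends (Ram.forP w p) s ((n + 1) ^ (k + 1)) (I n) :=
  Ends.forP I (one_le_pow_succ n k) h0 hI hb

theorem pow_succ_mono (n : ℕ) {k l : ℕ} (h : k ≤ l) : (n + 1) ^ k ≤ (n + 1) ^ l :=
  Nat.pow_le_pow_right (Nat.succ_pos n) h

/-- By `iterate_pred_eq`, `n` rounds of backward search are enough, each of quadratic cost. Array
`23` is a buffer, so that a round does not read its own output. -/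
theorem reachP_ends (n : ℕ) (G : GameGraph (Fin n)) (i : Fin 2) (s : Store)
    (T D : Set (Fin n)) (he : Env G i s) (hT : IsSet s 28 T) (hD : IsSet s 27 D) :
    Ends reachP s ((n + 1) ^ 3) fun s' =>
      Frame [22, 23, 30, 31, 32] s s' ∧ IsSet s' 22 (G.reachSet D T) := by
  let S : ℕ → Set (Fin n) := fun k => Nat.rec T
    (fun _ U => {x | x ∈ U ∨ ∃ y ∈ U, (x, y) ∈ G.edgesIn D}) k
  have hS : S n = G.reachSet D T :=
    iterate_pred_eq (S := S) (r := fun x y => (x, y) ∈ G.edgesIn D) (fun _ => rfl) (by simp)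
  refine Ends.seq ((vecP_ends T he.size (by decide) (by decide) ?_).mono
    (pow_succ_mono n (by decide)) fun _ => id) fun s₁ ⟨hf₁, h₁⟩ => ?_
  · intro x s' hf hx
    exact (hT.frame hf (by decide)).holds hx
  refine (Ends.forPow (n := n) (fun m s' => (Frame [22, 23, 30, 31, 32] s s' ∧
    s' 32 0 0 0 = m) ∧ IsSet s' 22 (S m)) ?_ ?_ ?_).mono le_rfl ?_
  · refine ⟨⟨(hf₁.mono (by simp)).update (by simp), update_same _ _ _ _ _ _⟩, ?_⟩
    exact h₁.frame (A := [32]) ((Frame.refl _ _).update (by simp)) (by decide)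
  · exact fun m s' h => ⟨(he.frame h.1.1 (by decide)).size, h.1.2⟩
  · rintro m s₂ hm ⟨⟨hf₂, hm'⟩, h₂⟩
    have he₂ := he.frame hf₂ (by decide)
    have hD₂ := hD.frame hf₂ (by decide)
    refine Ends.seq (exP_ends (fun x y => y ∈ S m ∧ (x = y ∨ (x, y) ∈ G.edgesIn D))
      he₂.size (by decide) (by decide) (by decide) ?_) fun s₃ ⟨hf₃, h₃⟩ => ?_
    · intro x y s' hf hx hy
      have h1 := h₂.frame hf (by decide)
      have h2 := hD₂.frame hf (by decide)
      have h3 := he₂.frame hf (by decide)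
      simp only [Term.holds_and, Term.holds_or, Term.holds_eq, h1.holds hy, h3.holds_edge hx hy,
        h2.holds hx, h2.holds hy, hx, hy, Fin.val_inj, edgesIn, Set.mem_ofPred_eq]
      tauto
    have he₃ := he₂.frame hf₃ (by decide)
    refine (vecP_ends (S (m + 1)) he₃.size (by decide) (by decide) ?_).mono le_rfl ?_
    · intro x s' hf hx
      rw [(h₃.frame hf (by decide)).holds hx]
      change _ ↔ x ∈ S m ∨ ∃ y ∈ S m, (x, y) ∈ G.edgesIn D
      constructor
      · rintro ⟨y, hy, rfl | hxy⟩
        · exact Or.inl hy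
        · exact Or.inr ⟨y, hy, hxy⟩
      · rintro (h | ⟨y, hy, hxy⟩)
        · exact ⟨x, h, Or.inl rfl⟩
        · exact ⟨y, hy, Or.inr hxy⟩
    · rintro s₄ ⟨hf₄, h₄⟩
      refine ⟨⟨((hf₂.trans (hf₃.mono (by simp))).trans (hf₄.mono (by simp))).update (by simp), ?_⟩,
        h₄.frame (A := [32]) ((Frame.refl _ _).update (by simp)) (by decide)⟩
      rw [update_same, hf₄ 32 (by decide), hf₃ 32 (by decide), hm']
  · rintro s' ⟨⟨hf, -⟩, h⟩
    exact ⟨hf, hS ▸ h⟩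

/-- The array `21` becomes the set of good vertices. -/
def goodP : Prog :=
  forP 33 (.seq (vecP 27 (.neg (.lt (.mem 4 (.var 33)) (.mem 4 vx))))
    (.seq (vecP 28 (.eq vx (.var 33)))
      (.seq reachP
        (.seq (anyP 29 (.and (edgeT (.var 33) vx) (.and (.mem 27 vx) (.mem 22 vx))))
          (.set 21 (.var 33) (.lit 0) (.lit 0)
            (.and (.var 29) (.neg (.bit (.mem 4 (.var 33))))))))))

/-- Splitting off the first edge of the cycle leaves one reachability query with the single target
`v`, among the vertices of priority at most `P v`. -/
theorem goodIn_univ_iff {V : Type*} {G : GameGraph V} {P : V → ℕ} {v : V} :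
    G.GoodIn Set.univ P v ↔ (∃ w, G.Adj v w ∧ P w ≤ P v ∧ w ∈ G.reachSet {x | P x ≤ P v} {v}) ∧
      ¬ Odd (P v) := by
  have hr : (fun x y => (x, y) ∈ G.edgesIn Set.univ ∧ P x ≤ P v ∧ P y ≤ P v) =
      fun x y => (x, y) ∈ G.edgesIn {x | P x ≤ P v} := by
    funext x y
    simp only [edgesIn, Set.mem_ofPred_eq, Set.mem_univ, true_and, eq_iff_iff]
    tauto
  rw [GoodIn, hr, Relation.TransGen.head'_iff, Nat.not_odd_iff_even, and_comm]
  refine and_congr (exists_congr fun w => ?_) Iff.rfl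
  simp only [edgesIn, reachSet, Set.mem_ofPred_eq, Set.mem_singleton_iff, exists_eq_left, le_refl,
    true_and]
  tauto

theorem goodP_ends (n : ℕ) (G : GameGraph (Fin n)) (i : Fin 2) (s : Store)
    (P : Fin n → ℕ) (he : Env G i s) (hP : IsPrio s P) :
    Ends goodP s ((n + 1) ^ 4) fun s' =>
      Frame [21, 22, 23, 27, 28, 29, 30, 31, 32, 33] s s' ∧
      IsSet s' 21 {v | G.GoodIn Set.univ P v} := by
  refine (Ends.forPow (n := n) (fun m s' =>
    (Frame [21, 22, 23, 27, 28, 29, 30, 31, 32, 33] s s' ∧ s' 33 0 0 0 = m) ∧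
    ∀ v : Fin n, v < m → (s' 21 v 0 0 ≠ 0 ↔ G.GoodIn Set.univ P v)) ?_ ?_ ?_).mono le_rfl ?_
  · exact ⟨⟨(Frame.refl _ s).update (by simp), update_same _ _ _ _ _ _⟩, fun v hv => by omega⟩
  · exact fun m s' h => ⟨(he.frame h.1.1 (by decide)).size, h.1.2⟩
  · rintro m s₁ hm ⟨⟨hf₁, hm₁⟩, h₁⟩
    have he₁ := he.frame hf₁ (by decide)
    have hP₁ := hP.frame hf₁ (by decide)
    let v : Fin n := ⟨m, hm⟩
    have hv : ∀ {s'}, s' 33 0 0 0 = m → Term.val s' (.var 33) = (v : ℕ) := fun h => h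
    refine Ends.seq ((vecP_ends {x | P x ≤ P v} he₁.size (by decide) (by decide) ?_).mono
      (pow_succ_mono n (by decide)) fun _ => id) fun s₂ ⟨hf₂, h₂⟩ => ?_
    · intro x s' hf hx
      have h1 := hP₁.frame hf (by decide)
      simp [h1.val hx, h1.val (hv ((congrFun₃ (hf 33 (by decide)) 0 0 0).trans hm₁))]
    have he₂ := he₁.frame hf₂ (by decide)
    have hm₂ := (congrFun₃ (hf₂ 33 (by decide)) 0 0 0).trans hm₁
    refine Ends.seq ((vecP_ends {v} he₂.size (by decide) (by decide) ?_).mono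
      (pow_succ_mono n (by decide)) fun _ => id) fun s₃ ⟨hf₃, h₃⟩ => ?_
    · intro x s' hf hx
      have hv' := hv ((congrFun₃ (hf 33 (by decide)) 0 0 0).trans hm₂)
      rw [Term.holds_eq, hv', Set.mem_singleton_iff, ← Fin.val_inj]
      rw [hx]
    have he₃ := he₂.frame hf₃ (by decide)
    have hm₃ := (congrFun₃ (hf₃ 33 (by decide)) 0 0 0).trans hm₂
    refine Ends.seq (reachP_ends n G i s₃ {v} {x | P x ≤ P v} he₃ h₃ (h₂.frame hf₃ (by decide)))
      fun s₄ ⟨hf₄, h₄⟩ => ?_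
    have he₄ := he₃.frame hf₄ (by decide)
    have hm₄ := (congrFun₃ (hf₄ 33 (by decide)) 0 0 0).trans hm₃
    have h₂' := (h₂.frame hf₃ (by decide)).frame hf₄ (by decide)
    refine Ends.seq ((anyP_ends (fun x => G.Adj v x ∧ P x ≤ P v ∧
      x ∈ G.reachSet {x | P x ≤ P v} {v}) he₄.size (by decide) (by decide) ?_).mono
      (pow_succ_mono n (by decide)) fun _ => id) fun s₅ ⟨hf₅, h₅, _⟩ => ?_
    · intro x s' hf hx
      have hv' := hv ((congrFun₃ (hf 33 (by decide)) 0 0 0).trans hm₄)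
      simp only [Term.holds_and, (he₄.frame hf (by decide)).holds_edge hv' hx,
        (h₂'.frame hf (by decide)).holds hx, (h₄.frame hf (by decide)).holds hx,
        Set.mem_ofPred_eq]
    have hm₅ := (congrFun₃ (hf₅ 33 (by decide)) 0 0 0).trans hm₄
    have hP₅ : IsPrio s₅ P := (((hP₁.frame hf₂ (by decide)).frame hf₃ (by decide)).frame hf₄
      (by decide)).frame hf₅ (by decide)
    have hfr : Frame [21, 22, 23, 27, 28, 29, 30, 31, 32, 33] s₁ s₅ :=
      (((hf₂.mono (by simp)).trans (hf₃.mono (by simp))).trans (hf₄.mono (by simp))).trans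
        (hf₅.mono (by simp))
    have h21 : s₅ 21 = s₁ 21 := by
      rw [hf₅ 21 (by decide), hf₄ 21 (by decide), hf₃ 21 (by decide), hf₂ 21 (by decide)]
    refine Ends.set (one_le_pow_succ n 3) ?_
    have hv' := hv hm₅
    rw [hv']
    refine ⟨⟨((hf₁.trans hfr).update (by simp)).update (by simp), ?_⟩, ?_⟩
    · rw [update_same, update_of_ne _ _ _ _ _ (by decide), hm₅]
    · intro x hx
      rw [update_of_ne _ _ _ _ _ (by decide)]
      rcases Nat.lt_succ_iff_lt_or_eq.1 hx with hx | hx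
      · have : s₅.update 21 v ((Term.lit 0).val s₅) ((Term.lit 0).val s₅)
            (((Term.var 29).and (.neg (.bit (.mem 4 (.var 33))))).val s₅) 21 x 0 0 =
            s₅ 21 x 0 0 := update_apply_of_ne _ (by simp [v]; omega)
        rw [this, h21]
        exact h₁ x hx
      · obtain rfl : x = v := Fin.ext hx
        have : s₅.update 21 v ((Term.lit 0).val s₅) ((Term.lit 0).val s₅)
            (((Term.var 29).and (.neg (.bit (.mem 4 (.var 33))))).val s₅) 21 v 0 0 =
            (((Term.var 29).and (.neg (.bit (.mem 4 (.var 33))))).val s₅) := update_same _ _ _ _ _ _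
        rw [this]
        change Term.Holds _ _ ↔ _
        rw [Term.holds_and, Term.holds_neg, Term.holds_bit, hP₅.val hv', goodIn_univ_iff]
        exact and_congr h₅ Iff.rfl
  · rintro s' ⟨⟨hf, -⟩, h⟩
    exact ⟨hf, fun v => h v v.2⟩

/-- The scalar `25` becomes the largest priority in the set `20`. -/
def maxP : Prog :=
  .seq (.set 25 (.lit 0) (.lit 0) (.lit 0) (.lit 0))
    (forP 30 (.ite (.and (.mem 20 vx) (.lt (.var 25) (.mem 4 vx)))
      (.set 25 (.lit 0) (.lit 0) (.lit 0) (.mem 4 vx)) .skip))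

/-- The invariant that the scalar is zero or attained agrees with the convention that the empty set
has largest priority `0`. -/
theorem maxP_ends (n : ℕ) (G : GameGraph (Fin n)) (i : Fin 2) (s : Store)
    (P : Fin n → ℕ) (X : Set (Fin n)) (he : Env G i s) (hP : IsPrio s P) (hX : IsSet s 20 X) :
    Ends maxP s ((n + 1) ^ 2) fun s' => Frame [25, 30] s s' ∧ s' 25 0 0 0 = maxPrio P X := by
  refine Ends.seq (Ends.set (Q := fun s' => Frame [25, 30] s s' ∧ s' 25 0 0 0 = 0)
    (one_le_pow_succ n 2) ⟨(Frame.refl _ s).update (by simp), update_same _ _ _ _ _ _⟩) fun s₁ ⟨hf₁, h₁⟩ => ?_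
  refine (Ends.forPow (n := n) (k := 1) (fun m s' => (Frame [25, 30] s s' ∧ s' 30 0 0 0 = m) ∧
    (∀ v ∈ X, v < m → P v ≤ s' 25 0 0 0) ∧
    (s' 25 0 0 0 = 0 ∨ ∃ v ∈ X, P v = s' 25 0 0 0)) ?_ ?_ ?_).mono le_rfl ?_
  · refine ⟨⟨hf₁.update (by simp), update_same _ _ _ _ _ _⟩, fun v _ hv => by omega, Or.inl ?_⟩
    rw [update_of_ne _ _ _ _ _ (by decide), h₁]
  · exact fun m s' h => ⟨(he.frame h.1.1 (by decide)).size, h.1.2⟩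
  · rintro m s₂ hm ⟨⟨hf₂, hm₂⟩, h₂, h₂'⟩
    let v : Fin n := ⟨m, hm⟩
    have hv : Term.val s₂ vx = (v : ℕ) := hm₂
    have hP₂ := hP.frame hf₂ (by decide)
    have hX₂ := hX.frame hf₂ (by decide)
    refine Ends.ite (one_le_pow_succ n 1) ?_ ?_
    · intro hc
      have hc' : Term.Holds s₂ _ := hc
      rw [Term.holds_and, Term.holds_lt, hX₂.holds hv, hP₂.val hv] at hc'
      refine Ends.set (one_le_pow_succ n 1) ?_
      rw [hP₂.val hv]
      have h25 : ((s₂.update 25 (Term.val s₂ (.lit 0)) (Term.val s₂ (.lit 0)) (Term.val s₂ (.lit 0))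
        (P v)).update 30 0 0 0 m.succ) 25 0 0 0 = P v := by
        rw [update_of_ne _ _ _ _ _ (by decide)]
        exact update_same _ _ _ _ _ _
      have h30 : (s₂.update 25 (Term.val s₂ (.lit 0)) (Term.val s₂ (.lit 0)) (Term.val s₂ (.lit 0))
        (P v)) 30 0 0 0 + 1 = m.succ := by
        rw [update_of_ne _ _ _ _ _ (by decide), hm₂]
      rw [h30]
      refine ⟨⟨(hf₂.update (by simp)).update (by simp), update_same _ _ _ _ _ _⟩, ?_, ?_⟩
      · intro w hw hwm
        rw [h25]
        rcases Nat.lt_succ_iff_lt_or_eq.1 hwm with hwm | hwm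
        · exact (h₂ w hw hwm).trans hc'.2.le
        · obtain rfl : w = v := Fin.ext hwm
          exact le_rfl
      · rw [h25]
        exact Or.inr ⟨v, hc'.1, rfl⟩
    · intro hc
      have hc' : ¬ Term.Holds s₂ _ := not_not_intro hc
      rw [Term.holds_and, Term.holds_lt, hX₂.holds hv, hP₂.val hv] at hc'
      refine Ends.skip (one_le_pow_succ n 1) ?_
      have h25 : (s₂.update 30 0 0 0 (s₂ 30 0 0 0 + 1)) 25 = s₂ 25 :=
        update_of_ne _ _ _ _ _ (by decide)
      rw [h25]
      refine ⟨⟨hf₂.update (by simp), ?_⟩, ?_, h₂'⟩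
      · rw [update_same, hm₂]
      · intro w hw hwm
        rcases Nat.lt_succ_iff_lt_or_eq.1 hwm with hwm | hwm
        · exact h₂ w hw hwm
        · obtain rfl : w = v := Fin.ext hwm
          exact not_lt.1 fun h => hc' ⟨hw, h⟩
  · rintro s' ⟨⟨hf, -⟩, h, h'⟩
    refine ⟨hf, le_antisymm ?_ (maxPrio_le fun v hv => h v hv v.2)⟩
    rcases h' with h' | ⟨v, hv, hv'⟩
    · omega
    · rw [← hv']
      exact le_maxPrio hv

end Ram

namespace Ram

open GameGraph

variable {n : ℕ}

/-! ## Writing conditional live-groups -/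

/-- The live-groups that belong to the conditional live-group with index `k`. -/
def groupsOf (n : ℕ) (s : Store) (b k : ℕ) : Set (Set (Fin n × Fin n)) :=
  {A | ∃ g < s (b + 4) 0 0 0, s (b + 5) g 0 0 = k ∧
    A = {e : Fin n × Fin n | s (b + 6) g e.1 e.2 ≠ 0}}

/-- The finished conditional live-groups. -/
def condsOf (n : ℕ) (s : Store) (b : ℕ) : Set (Set (Fin n) × Set (Set (Fin n × Fin n))) :=
  {c | ∃ k < s (b + 2) 0 0 0, c = ({v : Fin n | s (b + 3) k v 0 ≠ 0}, groupsOf n s b k)}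

/-- The conditional live-groups in `H` are finished; the next one has the condition `R` and so far
the live-groups `L`. -/
structure Out (s : Store) (b : ℕ) (H : Set (Set (Fin n) × Set (Set (Fin n × Fin n))))
    (R : Set (Fin n)) (L : Set (Set (Fin n × Fin n))) : Prop where
  conds : condsOf n s b = H
  cond : {v : Fin n | s (b + 3) (s (b + 2) 0 0 0) v 0 ≠ 0} = R
  groups : groupsOf n s b (s (b + 2) 0 0 0) = L
  later : ∀ k, s (b + 2) 0 0 0 < k → groupsOf n s b k = ∅

section Out

variable {s s' : Store} {b : ℕ} {H : Set (Set (Fin n) × Set (Set (Fin n × Fin n)))}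
  {R : Set (Fin n)} {L : Set (Set (Fin n × Fin n))}

theorem Out.frame {A : List ℕ} (h : Out s b H R L) (hf : Frame A s s')
    (hA : ∀ j ∈ [2, 3, 4, 5, 6], b + j ∉ A) : Out s' b H R L := by
  have h2 := hf _ (hA 2 (by decide))
  have h3 := hf _ (hA 3 (by decide))
  have hg : ∀ k, groupsOf n s' b k = groupsOf n s b k := fun k => by
    simp only [groupsOf, hf _ (hA 4 (by decide)), hf _ (hA 5 (by decide)),
      hf _ (hA 6 (by decide))]
  constructor
  · rw [← h.conds]
    simp only [condsOf, h2, h3, hg]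
  · rw [h2, h3, h.cond]
  · rw [h2, hg, h.groups]
  · intro k hk
    rw [hg]
    exact h.later k (h2 ▸ hk)

/-- Adds a live-group to the next conditional live-group. -/
def emitP (b : ℕ) (e : Term) : Prog :=
  .seq (matP (b + 6) (.var (b + 4)) e)
    (.seq (.set (b + 5) (.var (b + 4)) (.lit 0) (.lit 0) (.var (b + 2)))
      (.set (b + 4) (.lit 0) (.lit 0) (.lit 0) (.add (.var (b + 4)) (.lit 1))))

/-- Live-groups are numbered globally and only tagged with the index of their conditional
live-group. The new matrix therefore affects `groupsOf` at the current index alone. -/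
theorem emitP_ends {e : Term} (A : Set (Fin n × Fin n)) (hn : s 0 0 0 0 = n) (hb : b + 6 < 30)
    (h : Out s b H R L)
    (he : ∀ x y : Fin n, ∀ s', Frame [b + 6, 30, 31] s s' → vx.val s' = x → vy.val s' = y →
      (e.Holds s' ↔ (x, y) ∈ A)) :
    Ends (emitP b e) s ((n + 1) ^ 2) fun s' => Frame [b + 4, b + 5, b + 6, 30, 31] s s' ∧
      Out s' b H R (insert A L) := by
  refine Ends.seq (matP_ends A hn (by omega) (by omega) (by omega) ?_ he)
    fun s₁ ⟨hf₁, h₁, h₁'⟩ => ?_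
  · intro s' hf
    simp only [Term.val]
    rw [hf (b + 4) (by simp; omega)]
  refine Ends.seq (Ends.set (Q := fun s₂ => s₂ = s₁.update (b + 5) (s (b + 4) 0 0 0) 0 0
    (s (b + 2) 0 0 0)) (one_le_pow_succ n 2) ?_) ?_
  · simp only [Term.val]
    rw [hf₁ (b + 4) (by simp; omega), hf₁ (b + 2) (by simp; omega)]
  rintro s₂ rfl
  refine Ends.set (one_le_pow_succ n 2) ?_
  simp only [Term.val] at h₁ h₁' ⊢
  set M := s (b + 4) 0 0 0 with hM
  set K := s (b + 2) 0 0 0 with hK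
  set s₂ := s₁.update (b + 5) M 0 0 K with hs₂
  have hM₂ : s₂ (b + 4) 0 0 0 = M := by
    rw [hs₂, update_of_ne _ _ _ _ _ (by omega), hf₁ (b + 4) (by simp; omega)]
  rw [hM₂]
  set s₃ := s₂.update (b + 4) 0 0 0 (M + 1) with hs₃
  have hf : Frame [b + 4, b + 5, b + 6, 30, 31] s s₃ :=
    ((hf₁.mono (by simp)).update (by simp)).update (by simp)
  refine ⟨hf, ?_⟩
  have h2 : s₃ (b + 2) = s (b + 2) := hf _ (by simp; omega)
  have h3 : s₃ (b + 3) = s (b + 3) := hf _ (by simp; omega)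
  have h4 : s₃ (b + 4) 0 0 0 = M + 1 := update_same _ _ _ _ _ _
  have h5 : s₃ (b + 5) M 0 0 = K := by
    rw [hs₃, update_of_ne _ _ _ _ _ (by omega)]
    exact update_same _ _ _ _ _ _
  have h5' : ∀ g, g ≠ M → s₃ (b + 5) g 0 0 = s (b + 5) g 0 0 := fun g hg => by
    rw [hs₃, update_of_ne _ _ _ _ _ (by omega), hs₂, update_apply_of_ne _ (by simpa using hg),
      hf₁ (b + 5) (by simp; omega)]
  have h6 : s₃ (b + 6) = s₁ (b + 6) := by
    rw [hs₃, update_of_ne _ _ _ _ _ (by omega), hs₂, update_of_ne _ _ _ _ _ (by omega)]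
  have hA : {e : Fin n × Fin n | s₁ (b + 6) M e.1 e.2 ≠ 0} = A := by
    ext e
    exact h₁ e.1 e.2
  have hgr : ∀ k, groupsOf n s₃ b k = {A' | A' ∈ groupsOf n s b k ∨ (k = K ∧ A' = A)} := by
    intro k
    ext A'
    simp only [groupsOf, h4, h6, Set.mem_ofPred_eq, ← hM]
    constructor
    · rintro ⟨g, hg, hk, hA'⟩
      rcases Nat.lt_succ_iff_lt_or_eq.1 hg with hg | rfl
      · rw [h5' g hg.ne] at hk
        rw [h₁' g hg.ne] at hA'
        exact Or.inl ⟨g, hg, hk, hA'⟩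
      · exact Or.inr ⟨hk.symm.trans h5, hA'.trans hA⟩
    · rintro (⟨g, hg, hk, hA'⟩ | ⟨rfl, rfl⟩)
      · exact ⟨g, by omega, by rw [h5' g hg.ne, hk], by rw [h₁' g hg.ne, hA']⟩
      · exact ⟨M, by omega, h5, hA.symm⟩
  constructor
  · rw [← h.conds]
    ext c
    simp only [condsOf, h2, h3, Set.mem_ofPred_eq, ← hK]
    refine exists_congr fun k => and_congr_right fun hk => ?_
    rw [hgr k]
    simp [hk.ne]
  · rw [h2, h3]
    exact h.cond
  · rw [h2, hgr, ← h.groups, ← hK]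
    ext A'
    simp [or_comm]
  · intro k hk
    rw [h2, ← hK] at hk
    rw [hgr, h.later k hk]
    simp [hk.ne']

/-- Sets the condition of the next conditional live-group. -/
theorem rowP_cond_ends {e : Term} (R' : Set (Fin n)) (hn : s 0 0 0 0 = n) (hb : b + 6 < 30)
    (h : Out s b H R L)
    (he : ∀ x : Fin n, ∀ s', Frame [b + 3, 30] s s' → vx.val s' = x → (e.Holds s' ↔ x ∈ R')) :
    Ends (rowP (b + 3) (.var (b + 2)) e) s ((n + 1) ^ 2) fun s' => Frame [b + 3, 30] s s' ∧
      Out s' b H R' L := by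
  refine (rowP_ends R' hn (by omega) (by omega) ?_ he).mono le_rfl ?_
  · intro s' hf
    simp only [Term.val]
    rw [hf (b + 2) (by simp; omega)]
  · rintro s' ⟨hf, h1, h2⟩
    simp only [Term.val] at h1 h2
    refine ⟨hf, ?_⟩
    have e2 := hf (b + 2) (by simp; omega)
    have hg : ∀ k, groupsOf n s' b k = groupsOf n s b k := fun k => by
      simp only [groupsOf, hf (b + 4) (by simp; omega), hf (b + 5) (by simp; omega),
        hf (b + 6) (by simp; omega)]
    constructor
    · rw [← h.conds]
      ext c
      simp only [condsOf, e2, hg, Set.mem_ofPred_eq]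
      refine exists_congr fun k => and_congr_right fun hk => ?_
      simp only [h2 k hk.ne]
    · ext v
      rw [e2]
      exact h1 v
    · rw [e2, hg, h.groups]
    · intro k hk
      rw [hg, h.later k (e2 ▸ hk)]

/-- Finishes the next conditional live-group. -/
def finishP (b : ℕ) : Prog :=
  .set (b + 2) (.lit 0) (.lit 0) (.lit 0) (.add (.var (b + 2)) (.lit 1))

/-- After the counter moves on, the field `later` says that the next index has no live-groups yet.
Its row of conditions may contain anything, hence the unspecified `R'`. -/
theorem finishP_ends {B : ℕ} (hB : 1 ≤ B) (h : Out s b H R L) :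
    Ends (finishP b) s B fun s' => Frame [b + 2] s s' ∧
      ∃ R', Out s' b (insert (R, L) H) R' ∅ := by
  refine Ends.set hB ?_
  simp only [Term.val]
  set K := s (b + 2) 0 0 0 with hK
  set s₁ := s.update (b + 2) 0 0 0 (K + 1) with hs₁
  have hf : Frame [b + 2] s s₁ := (Frame.refl _ s).update (by simp)
  refine ⟨hf, _, ?_, rfl, ?_, ?_⟩
  all_goals
    have h2 : s₁ (b + 2) 0 0 0 = K + 1 := update_same _ _ _ _ _ _
    have h3 : s₁ (b + 3) = s (b + 3) := hf _ (by simp)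
    have hg : ∀ k, groupsOf n s₁ b k = groupsOf n s b k := fun k => by
      simp only [groupsOf, hf (b + 4) (by simp), hf (b + 5) (by simp), hf (b + 6) (by simp)]
  · rw [← h.conds, ← h.cond, ← h.groups]
    ext c
    simp only [condsOf, h2, h3, hg, Set.mem_ofPred_eq, Set.mem_insert_iff, ← hK]
    constructor
    · rintro ⟨k, hk, rfl⟩
      rcases Nat.lt_succ_iff_lt_or_eq.1 hk with hk | rfl
      · exact Or.inr ⟨k, hk, rfl⟩
      · exact Or.inl rfl
    · rintro (rfl | ⟨k, hk, rfl⟩)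
      · exact ⟨K, by omega, rfl⟩
      · exact ⟨k, by omega, rfl⟩
  · rw [h2, hg]
    exact h.later _ (by omega)
  · intro k hk
    rw [h2] at hk
    rw [hg]
    exact h.later _ (by omega)

end Out

/-! ## The procedure `Live` -/

section Sets

variable {V : Type*} {G : GameGraph V} {W T U : Set V} {i : Fin 2}

/-- The live-group of one attractor step. -/
def attrGroup (G : GameGraph V) (W : Set V) (i : Fin 2) (U : Set V) (j : ℕ) : Set (V × V) :=
  {e | e ∈ G.edgesIn W ∧ G.owner e.1 = i ∧
    e.1 ∈ G.cpreIter W i U (j + 1) ∧ e.2 ∈ G.cpreIter W i U j}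

/-- The live-group of one step of the other player. -/
def assumpGroup (G : GameGraph V) (W : Set V) (i : Fin 2) (U : Set V) : Set (V × V) :=
  {e | e ∈ G.edgesIn W ∧ G.owner e.1 = 1 - i ∧ e.1 ∈ G.cpre W (1 - i) U ∧ e.2 ∈ U}

theorem not_owner_iff {v : V} : ¬ G.owner v = i ↔ G.owner v = 1 - i := by
  generalize G.owner v = b
  revert b i
  decide

/-- In this form membership is decided by two vectors: which vertices have an edge into `U`, and
which have an edge out of it. -/
theorem mem_cpre_iff {x : V} : x ∈ G.cpre W i U ↔ x ∈ W ∧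
    ((G.owner x = i ∧ ∃ y, (x, y) ∈ G.edgesIn W ∧ y ∈ U) ∨
      (¬ G.owner x = i ∧ ¬ ∃ y, (x, y) ∈ G.edgesIn W ∧ y ∉ U)) := by
  rw [not_owner_iff, cpre, Set.mem_ofPred_eq]
  simp only [not_exists, not_and, not_not]
  refine and_congr_right fun _ => or_congr (and_congr_right fun _ => exists_congr fun y => ?_) Iff.rfl
  exact and_comm

theorem mem_cpre_sub_iff {x : V} : x ∈ G.cpre W (1 - i) U ↔ x ∈ W ∧
    ((¬ G.owner x = i ∧ ∃ y, (x, y) ∈ G.edgesIn W ∧ y ∈ U) ∨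
      (G.owner x = i ∧ ¬ ∃ y, (x, y) ∈ G.edgesIn W ∧ y ∉ U)) := by
  rw [mem_cpre_iff, ← not_owner_iff, not_not]

theorem cpreIter_eq_of_stable {j : ℕ} (h : G.cpreIter W i U (j + 1) = G.cpreIter W i U j) :
    ∀ m, j ≤ m → G.cpreIter W i U m = G.cpreIter W i U j := by
  intro m hm
  induction m, hm using Nat.le_induction with
  | base => rfl
  | succ m _ ih =>
    rw [cpreIter, ih]
    exact h

theorem union_attr_of_stable {j : ℕ} (h : G.cpreIter W i U (j + 1) = G.cpreIter W i U j) :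
    U ∪ G.attr W i U = G.cpreIter W i U j := by
  rw [union_attr]
  refine Set.Subset.antisymm (Set.iUnion_subset fun m => ?_) (Set.subset_iUnion _ j)
  rcases le_total j m with hm | hm
  · exact (cpreIter_eq_of_stable h m hm).subset
  · exact cpreIter_mono hm

/-- From the first stable step on all attractor groups coincide. The group of the step that detects
stability, `m = j`, thus represents the infinitely many remaining ones. -/
theorem attrGroups_of_stable {j : ℕ} (h : G.cpreIter W i U (j + 1) = G.cpreIter W i U j) :
    G.attrGroups W i U = {A | ∃ m < j + 1, A = attrGroup G W i U m} := by
  ext A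
  constructor
  · rintro ⟨m, rfl⟩
    by_cases hm : m < j + 1
    · exact ⟨m, hm, rfl⟩
    · refine ⟨j, by omega, ?_⟩
      rw [cpreIter_eq_of_stable h m (by omega), cpreIter_eq_of_stable h (m + 1) (by omega),
        attrGroup, h]
  · rintro ⟨m, -, rfl⟩
    exact ⟨m, rfl⟩

end Sets

theorem setVar_ends {s : Store} {a B : ℕ} {e : Term} (hB : 1 ≤ B) :
    Ends (.set a (.lit 0) (.lit 0) (.lit 0) e) s B fun s' =>
      Frame [a] s s' ∧ s' a 0 0 0 = e.val s :=
  Ends.set hB ⟨(Frame.refl _ s).update (by simp), update_same _ _ _ _ _ _⟩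

/-- The edges within the set `24`. -/
def edgeW : Term := .and (edgeT vx vy) (.and (.mem 24 vx) (.mem 24 vy))

/-- The controllable predecessors of the set `22` for the owner given by the term. -/
def cpreT (own : Term) : Term :=
  .and (.mem 24 vx) (.or (.and own (.mem 34 vx)) (.and (.neg own) (.neg (.mem 35 vx))))

/-- One attractor step; if it adds nothing, a step of the other player. -/
def liveBody : Prog :=
  .seq (exP 34 (.and edgeW (.mem 22 vy)))
  (.seq (exP 35 (.and edgeW (.neg (.mem 22 vy))))
  (.seq (vecP 36 (.or (.mem 22 vx) (cpreT (ownT vx))))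
  (.seq (emitP 12 (.and edgeW (.and (ownT vx) (.and (.mem 36 vx) (.mem 22 vy)))))
  (.seq (anyP 38 (.and (.mem 36 vx) (.neg (.mem 22 vx))))
  (.seq (.ite (.var 38)
    (.seq (vecP 22 (.mem 36 vx)) (.set 26 (.lit 0) (.lit 0) (.lit 0) (.lit 0)))
    (.seq (emitP 5 (.and edgeW (.and (.neg (ownT vx))
        (.and (cpreT (.neg (ownT vx))) (.mem 22 vy)))))
      (.seq (vecP 36 (.or (.mem 22 vx) (cpreT (.neg (ownT vx)))))
        (.seq (vecP 22 (.mem 36 vx)) (.set 26 (.lit 0) (.lit 0) (.lit 0) (.lit 1))))))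
  (anyP 37 (.and (.mem 24 vx) (.neg (.mem 22 vx)))))))))

/-- The procedure `Live` for the graph restricted to the set `24` and the target in `22`. -/
def liveP : Prog :=
  .seq (.set 26 (.lit 0) (.lit 0) (.lit 0) (.lit 1))
  (.seq (anyP 37 (.and (.mem 24 vx) (.neg (.mem 22 vx))))
    (.loop (.or (.var 37) (.neg (.var 26))) liveBody))

/-- The arrays that `liveP` changes. -/
abbrev liveArrays : List ℕ := [9, 10, 11, 16, 17, 18, 22, 26, 30, 31, 34, 35, 36, 37, 38]

/-- The invariant of the loop of `liveP`. -/
structure LiveInv (G : GameGraph (Fin n)) (i : Fin 2) (W T : Set (Fin n))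
    (H₁ H₂ : Set (Set (Fin n) × Set (Set (Fin n × Fin n)))) (R₁ R₂ : Set (Fin n)) (s₀ : Store)
    (k j : ℕ) (s : Store) : Prop where
  frame : Frame liveArrays s₀ s
  current : IsSet s 22 (G.cpreIter W i (G.liveIter W i T k) j)
  flag : s 26 0 0 0 ≠ 0 ↔ j = 0
  neq : s 37 0 0 0 ≠ 0 ↔ G.cpreIter W i (G.liveIter W i T k) j ≠ W
  before : ∀ k' < k, G.liveIter W i T k' ≠ W
  now : j ≠ 0 → G.liveIter W i T k ≠ W
  assump : Out s 5 H₁ R₁ {A | ∃ k' < k, A = assumpGroup G W i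
    (G.liveIter W i T k' ∪ G.attr W i (G.liveIter W i T k'))}
  strat : Out s 12 H₂ R₂ {A | (∃ k' < k, A ∈ G.attrGroups W i (G.liveIter W i T k')) ∨
    ∃ j' < j, A = attrGroup G W i (G.liveIter W i T k) j'}

section Live

variable {G : GameGraph (Fin n)} {i : Fin 2} {W T U : Set (Fin n)}
  {H₁ H₂ : Set (Set (Fin n) × Set (Set (Fin n × Fin n)))} {R₁ R₂ : Set (Fin n)} {s₀ s s' : Store}

theorem holds_edgeW (he : Env G i s) (hW : IsSet s 24 W) {x y : Fin n} (hx : vx.val s = x)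
    (hy : vy.val s = y) : edgeW.Holds s ↔ (x, y) ∈ G.edgesIn W := by
  simp only [edgeW, Term.holds_and, he.holds_edge hx hy, hW.holds hx, hW.holds hy, edgesIn,
    Set.mem_ofPred_eq]
  tauto

theorem holds_cpreT (he : Env G i s) (hW : IsSet s 24 W)
    (h34 : IsSet s 34 {x | ∃ y, (x, y) ∈ G.edgesIn W ∧ y ∈ U})
    (h35 : IsSet s 35 {x | ∃ y, (x, y) ∈ G.edgesIn W ∧ y ∉ U}) {x : Fin n} (hx : vx.val s = x) :
    ((cpreT (ownT vx)).Holds s ↔ x ∈ G.cpre W i U) ∧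
    ((cpreT (.neg (ownT vx))).Holds s ↔ x ∈ G.cpre W (1 - i) U) := by
  rw [mem_cpre_sub_iff, mem_cpre_iff]
  simp only [cpreT, Term.holds_and, Term.holds_or, Term.holds_neg, hW.holds hx, h34.holds hx,
    h35.holds hx, he.holds_own hx, Set.mem_ofPred_eq, not_not, and_self]

theorem neq_ends (he : Env G i s) (hW : IsSet s 24 W) (hU : IsSet s 22 U) (hUW : U ⊆ W) :
    Ends (anyP 37 (.and (.mem 24 vx) (.neg (.mem 22 vx)))) s ((n + 1) ^ 2) fun s' =>
      Frame [37, 30] s s' ∧ (s' 37 0 0 0 ≠ 0 ↔ U ≠ W) := by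
  refine (anyP_ends (fun x => x ∈ W ∧ x ∉ U) he.size (by decide) (by decide) ?_).mono le_rfl ?_
  · intro x s' hf hx
    simp only [Term.holds_and, Term.holds_neg, (hW.frame hf (by decide)).holds hx,
      (hU.frame hf (by decide)).holds hx]
  · rintro s' ⟨hf, h, -⟩
    refine ⟨hf, h.trans ⟨?_, fun hne => Set.exists_of_ssubset (hUW.ssubset_of_ne hne)⟩⟩
    rintro ⟨x, hx, hx'⟩ rfl
    exact hx' hx

/-- The weight of the remaining iterations. -/
noncomputable def livePot (G : GameGraph (Fin n)) (i : Fin 2) (W T : Set (Fin n)) (k j : ℕ) : ℕ :=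
  (n + 1) ^ 2 * (2 * (W.ncard - (G.cpreIter W i (G.liveIter W i T k) j).ncard) +
    if j = 0 then 0 else 1)

/-- The invariant of the loop of `liveP` without the test for its end. -/
structure LiveInv' (G : GameGraph (Fin n)) (i : Fin 2) (W T : Set (Fin n))
    (H₁ H₂ : Set (Set (Fin n) × Set (Set (Fin n × Fin n)))) (R₁ R₂ : Set (Fin n)) (s₀ : Store)
    (k j : ℕ) (s : Store) : Prop where
  frame : Frame liveArrays s₀ s
  current : IsSet s 22 (G.cpreIter W i (G.liveIter W i T k) j)
  flag : s 26 0 0 0 ≠ 0 ↔ j = 0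
  before : ∀ k' < k, G.liveIter W i T k' ≠ W
  now : j ≠ 0 → G.liveIter W i T k ≠ W
  assump : Out s 5 H₁ R₁ {A | ∃ k' < k, A = assumpGroup G W i
    (G.liveIter W i T k' ∪ G.attr W i (G.liveIter W i T k'))}
  strat : Out s 12 H₂ R₂ {A | (∃ k' < k, A ∈ G.attrGroups W i (G.liveIter W i T k')) ∨
    ∃ j' < j, A = attrGroup G W i (G.liveIter W i T k) j'}

/-- A new vertex lowers the doubled term by at least two units: one pays for the iteration, one for
the summand that appears when `j` becomes positive. -/
theorem livePot_grow (hT : T ⊆ W) {k j : ℕ} (h : ∃ x,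
    x ∈ G.cpreIter W i (G.liveIter W i T k) (j + 1) ∧ x ∉ G.cpreIter W i (G.liveIter W i T k) j) :
    (n + 1) ^ 2 + livePot G i W T k (j + 1) ≤ livePot G i W T k j := by
  obtain ⟨x, hx, hx'⟩ := h
  have h1 : (G.cpreIter W i (G.liveIter W i T k) j).ncard <
      (G.cpreIter W i (G.liveIter W i T k) (j + 1)).ncard :=
    Set.ncard_lt_ncard ((Set.ssubset_iff_of_subset (cpreIter_mono (Nat.le_succ j))).2
      ⟨x, hx, hx'⟩) (Set.toFinite _)
  have h2 : (G.cpreIter W i (G.liveIter W i T k) (j + 1)).ncard ≤ W.ncard :=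
    Set.ncard_le_ncard (cpreIter_subset (liveIter_subset hT k) (j + 1)) (Set.toFinite _)
  simp only [livePot]
  rw [add_comm, ← Nat.mul_succ]
  refine Nat.mul_le_mul_left _ ?_
  simp only [Nat.succ_ne_zero, if_false]
  omega

theorem liveIter_succ_of_stable {k j : ℕ} (h : G.cpreIter W i (G.liveIter W i T k) (j + 1) =
    G.cpreIter W i (G.liveIter W i T k) j) : G.liveIter W i T (k + 1) =
      G.cpreIter W i (G.liveIter W i T k) j ∪
        G.cpre W (1 - i) (G.cpreIter W i (G.liveIter W i T k) j) := by
  rw [liveIter, union_attr_of_stable h]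

/-- For positive `j` the extra summand disappears and pays for the iteration. For `j = 0` player `i`
has gained nothing in this round, so the step of the other player must add a vertex. -/
theorem livePot_stable (hT : T ⊆ W) (hr : G.AllReach W T) {k j : ℕ} (hk : G.liveIter W i T k ≠ W)
    (h : G.cpreIter W i (G.liveIter W i T k) (j + 1) = G.cpreIter W i (G.liveIter W i T k) j) :
    (n + 1) ^ 2 + livePot G i W T (k + 1) 0 ≤ livePot G i W T k j := by
  have hsub : G.cpreIter W i (G.liveIter W i T k) j ⊆ G.liveIter W i T (k + 1) :=
    liveIter_succ_of_stable h ▸ Set.subset_union_left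
  have h2 := Set.ncard_le_ncard (liveIter_subset (G := G) (i := i) hT (k + 1)) (Set.toFinite _)
  have h3 := Set.ncard_le_ncard hsub (Set.toFinite _)
  have h4 : j = 0 → (G.cpreIter W i (G.liveIter W i T k) j).ncard <
      (G.liveIter W i T (k + 1)).ncard := by
    rintro rfl
    obtain ⟨x, hx, hx'⟩ := exists_mem_liveIter_succ (i := i) hr hT hk
    exact Set.ncard_lt_ncard ((Set.ssubset_iff_of_subset hsub).2 ⟨x, hx, hx'⟩) (Set.toFinite _)
  simp only [livePot]
  rw [add_comm, ← Nat.mul_succ]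
  refine Nat.mul_le_mul_left _ ?_
  simp only [if_true]
  change (2 * (W.ncard - (G.liveIter W i T (k + 1)).ncard) + 0).succ ≤ _
  split_ifs with hj
  · have := h4 hj
    omega
  · omega

/-- The state of the loop body before its case distinction. -/
structure LiveMid (G : GameGraph (Fin n)) (i : Fin 2) (W T : Set (Fin n))
    (H₁ H₂ : Set (Set (Fin n) × Set (Set (Fin n × Fin n)))) (R₁ R₂ : Set (Fin n)) (s₀ : Store)
    (k j : ℕ) (s : Store) : Prop where
  frame : Frame liveArrays s₀ s
  current : IsSet s 22 (G.cpreIter W i (G.liveIter W i T k) j)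
  into : IsSet s 34 {x | ∃ y, (x, y) ∈ G.edgesIn W ∧ y ∈ G.cpreIter W i (G.liveIter W i T k) j}
  out : IsSet s 35 {x | ∃ y, (x, y) ∈ G.edgesIn W ∧ y ∉ G.cpreIter W i (G.liveIter W i T k) j}
  next : IsSet s 36 (G.cpreIter W i (G.liveIter W i T k) (j + 1))
  grows : s 38 0 0 0 ≠ 0 ↔ ∃ x, x ∈ G.cpreIter W i (G.liveIter W i T k) (j + 1) ∧
    x ∉ G.cpreIter W i (G.liveIter W i T k) j
  before : ∀ k' < k, G.liveIter W i T k' ≠ W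
  now : G.liveIter W i T k ≠ W
  assump : Out s 5 H₁ R₁ {A | ∃ k' < k, A = assumpGroup G W i
    (G.liveIter W i T k' ∪ G.attr W i (G.liveIter W i T k'))}
  strat : Out s 12 H₂ R₂ {A | (∃ k' < k, A ∈ G.attrGroups W i (G.liveIter W i T k')) ∨
    ∃ j' < j + 1, A = attrGroup G W i (G.liveIter W i T k) j'}

theorem setOf_or_lt_succ {α : Type*} (p : α → Prop) (f : ℕ → α) (j : ℕ) :
    {A | p A ∨ ∃ j' < j + 1, A = f j'} = insert (f j) {A | p A ∨ ∃ j' < j, A = f j'} := by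
  ext A
  constructor
  · rintro (h | ⟨j', hj, rfl⟩)
    · exact Or.inr (Or.inl h)
    · rcases Nat.lt_succ_iff_lt_or_eq.1 hj with hj | rfl
      exacts [Or.inr (Or.inr ⟨j', hj, rfl⟩), Or.inl rfl]
  · rintro (rfl | h | ⟨j', hj, rfl⟩)
    exacts [Or.inr ⟨j, Nat.lt_succ_self j, rfl⟩, Or.inl h, Or.inr ⟨j', hj.trans (Nat.lt_succ_self j), rfl⟩]

theorem setOf_lt_succ {α : Type*} (f : ℕ → α) (j : ℕ) :
    {A | ∃ j' < j + 1, A = f j'} = insert (f j) {A | ∃ j' < j, A = f j'} := by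
  simpa using setOf_or_lt_succ (fun _ => False) f j

theorem liveMid_ends {p : Prog} {k j : ℕ} {Q : Store → Prop} (he₀ : Env G i s₀)
    (hW₀ : IsSet s₀ 24 W) (h : LiveInv G i W T H₁ H₂ R₁ R₂ s₀ k j s)
    (hc : (Term.or (.var 37) (.neg (.var 26))).Holds s)
    (hp : ∀ s', LiveMid G i W T H₁ H₂ R₁ R₂ s₀ k j s' → Ends p s' ((n + 1) ^ 2) Q) :
    Ends (.seq (exP 34 (.and edgeW (.mem 22 vy)))
      (.seq (exP 35 (.and edgeW (.neg (.mem 22 vy))))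
      (.seq (vecP 36 (.or (.mem 22 vx) (cpreT (ownT vx))))
      (.seq (emitP 12 (.and edgeW (.and (ownT vx) (.and (.mem 36 vx) (.mem 22 vy)))))
      (.seq (anyP 38 (.and (.mem 36 vx) (.neg (.mem 22 vx)))) p))))) s ((n + 1) ^ 2) Q := by
  -- At the beginning of a round the flag is set, so the loop can only have been continued because
  -- the set differs from `W`.
  have hcur : G.liveIter W i T k ≠ W := by
    by_cases hj : j = 0
    · subst hj
      rw [Term.holds_or, Term.holds_neg] at hc
      exact h.neq.1 (hc.resolve_right (not_not_intro (h.flag.2 rfl)))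
    · exact h.now hj
  have he := he₀.frame h.frame (by decide)
  have hW := hW₀.frame h.frame (by decide)
  refine Ends.seq (exP_ends (fun x y => (x, y) ∈ G.edgesIn W ∧
    y ∈ G.cpreIter W i (G.liveIter W i T k) j) he.size (by decide)
    (by decide) (by decide) ?_) fun s₁ ⟨hf₁, h₁⟩ => ?_
  · intro x y s' hf hx hy
    simp only [Term.holds_and, holds_edgeW (he.frame hf (by decide)) (hW.frame hf (by decide)) hx hy,
      (h.current.frame hf (by decide)).holds hy]
  have he₁ := he.frame hf₁ (by decide)
  have hW₁ := hW.frame hf₁ (by decide)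
  have hU₁ := h.current.frame hf₁ (by decide)
  refine Ends.seq (exP_ends (fun x y => (x, y) ∈ G.edgesIn W ∧
    y ∉ G.cpreIter W i (G.liveIter W i T k) j) he₁.size (by decide)
    (by decide) (by decide) ?_) fun s₂ ⟨hf₂, h₂⟩ => ?_
  · intro x y s' hf hx hy
    simp only [Term.holds_and, Term.holds_neg, (hU₁.frame hf (by decide)).holds hy,
      holds_edgeW (he₁.frame hf (by decide)) (hW₁.frame hf (by decide)) hx hy]
  have he₂ := he₁.frame hf₂ (by decide)
  have hW₂ := hW₁.frame hf₂ (by decide)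
  have hU₂ := hU₁.frame hf₂ (by decide)
  have h34₂ := h₁.frame hf₂ (by decide)
  refine Ends.seq (vecP_ends (G.cpreIter W i (G.liveIter W i T k) (j + 1)) he₂.size (by decide)
    (by decide) ?_) fun s₃ ⟨hf₃, h₃⟩ => ?_
  · intro x s' hf hx
    rw [Term.holds_or, (hU₂.frame hf (by decide)).holds hx, (holds_cpreT (he₂.frame hf (by decide))
      (hW₂.frame hf (by decide)) (h34₂.frame hf (by decide)) (h₂.frame hf (by decide)) hx).1,
      cpreIter, Set.mem_union, or_comm]
  have he₃ := he₂.frame hf₃ (by decide)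
  have hW₃ := hW₂.frame hf₃ (by decide)
  have hU₃ := hU₂.frame hf₃ (by decide)
  have hf₀₃ : Frame [30, 31, 34, 35, 36] s s₃ :=
    ((hf₁.mono (by simp)).trans (hf₂.mono (by simp))).trans (hf₃.mono (by simp))
  refine Ends.seq (emitP_ends (attrGroup G W i (G.liveIter W i T k) j) he₃.size (by decide)
    (h.strat.frame hf₀₃ (by decide)) ?_) fun s₄ ⟨hf₄, h₄⟩ => ?_
  · intro x y s' hf hx hy
    simp only [Term.holds_and, (hU₃.frame hf (by decide)).holds hy,
      holds_edgeW (he₃.frame hf (by decide)) (hW₃.frame hf (by decide)) hx hy,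
      (he₃.frame hf (by decide)).holds_own hx, (h₃.frame hf (by decide)).holds hx, attrGroup,
      Set.mem_ofPred_eq]
  have he₄ := he₃.frame hf₄ (by decide)
  have hU₄ := hU₃.frame hf₄ (by decide)
  have h36₄ := h₃.frame hf₄ (by decide)
  refine Ends.seq (anyP_ends (fun x => x ∈ G.cpreIter W i (G.liveIter W i T k) (j + 1) ∧
    x ∉ G.cpreIter W i (G.liveIter W i T k) j)
    he₄.size (by decide) (by decide) ?_) fun s₅ ⟨hf₅, h₅, _⟩ => ?_
  · intro x s' hf hx
    simp only [Term.holds_and, Term.holds_neg, (hU₄.frame hf (by decide)).holds hx,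
      (h36₄.frame hf (by decide)).holds hx]
  refine hp s₅ ⟨?_, hU₄.frame hf₅ (by decide), ?_, ?_, h36₄.frame hf₅ (by decide), h₅, h.before,
    hcur, ?_, ?_⟩
  · exact h.frame.trans (((hf₀₃.mono (by simp)).trans (hf₄.mono (by simp))).trans
      (hf₅.mono (by simp)))
  · exact ((h34₂.frame hf₃ (by decide)).frame hf₄ (by decide)).frame hf₅ (by decide)
  · exact ((h₂.frame hf₃ (by decide)).frame hf₄ (by decide)).frame hf₅ (by decide)
  · exact ((h.assump.frame hf₀₃ (by decide)).frame hf₄ (by decide)).frame hf₅ (by decide)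
  · have : {A | (∃ k' < k, A ∈ G.attrGroups W i (G.liveIter W i T k')) ∨
        ∃ j' < j + 1, A = attrGroup G W i (G.liveIter W i T k) j'} =
        insert (attrGroup G W i (G.liveIter W i T k) j)
          {A | (∃ k' < k, A ∈ G.attrGroups W i (G.liveIter W i T k')) ∨
            ∃ j' < j, A = attrGroup G W i (G.liveIter W i T k) j'} := by
      rw [setOf_or_lt_succ]
    rw [this]
    exact h₄.frame hf₅ (by decide)

theorem liveGrow_ends {k j : ℕ} (he₀ : Env G i s₀) (h : LiveMid G i W T H₁ H₂ R₁ R₂ s₀ k j s) :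
    Ends (.seq (vecP 22 (.mem 36 vx)) (.set 26 (.lit 0) (.lit 0) (.lit 0) (.lit 0))) s
      ((n + 1) ^ 2) (LiveInv' G i W T H₁ H₂ R₁ R₂ s₀ k (j + 1)) := by
  have he := he₀.frame h.frame (by decide)
  refine Ends.seq (vecP_ends (G.cpreIter W i (G.liveIter W i T k) (j + 1)) he.size (by decide)
    (by decide) fun x s' hf hx => (h.next.frame hf (by decide)).holds hx) fun s₁ ⟨hf₁, h₁⟩ => ?_
  refine (setVar_ends (one_le_pow_succ n 2)).mono le_rfl fun s₂ ⟨hf₂, h₂⟩ => ?_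
  constructor
  · exact h.frame.trans ((hf₁.mono (by simp)).trans (hf₂.mono (by simp)))
  · exact h₁.frame hf₂ (by decide)
  · rw [h₂]
    simp [Term.val]
  · exact h.before
  · exact fun _ => h.now
  · exact (h.assump.frame hf₁ (by decide)).frame hf₂ (by decide)
  · exact (h.strat.frame hf₁ (by decide)).frame hf₂ (by decide)

theorem liveStable_ends {k j : ℕ} (he₀ : Env G i s₀) (hW₀ : IsSet s₀ 24 W)
    (h : LiveMid G i W T H₁ H₂ R₁ R₂ s₀ k j s)
    (hst : G.cpreIter W i (G.liveIter W i T k) (j + 1) = G.cpreIter W i (G.liveIter W i T k) j) :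
    Ends (.seq (emitP 5 (.and edgeW (.and (.neg (ownT vx))
        (.and (cpreT (.neg (ownT vx))) (.mem 22 vy)))))
      (.seq (vecP 36 (.or (.mem 22 vx) (cpreT (.neg (ownT vx)))))
        (.seq (vecP 22 (.mem 36 vx)) (.set 26 (.lit 0) (.lit 0) (.lit 0) (.lit 1))))) s
      ((n + 1) ^ 2) (LiveInv' G i W T H₁ H₂ R₁ R₂ s₀ (k + 1) 0) := by
  have he := he₀.frame h.frame (by decide)
  have hW := hW₀.frame h.frame (by decide)
  refine Ends.seq (emitP_ends (assumpGroup G W i (G.cpreIter W i (G.liveIter W i T k) j)) he.size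
    (by decide) h.assump ?_) fun s₁ ⟨hf₁, h₁⟩ => ?_
  · intro x y s' hf hx hy
    simp only [Term.holds_and, Term.holds_neg, (h.current.frame hf (by decide)).holds hy,
      holds_edgeW (he.frame hf (by decide)) (hW.frame hf (by decide)) hx hy,
      (he.frame hf (by decide)).holds_own hx, (holds_cpreT (he.frame hf (by decide))
      (hW.frame hf (by decide)) (h.into.frame hf (by decide)) (h.out.frame hf (by decide)) hx).2,
      not_owner_iff, assumpGroup, Set.mem_ofPred_eq]
  have he₁ := he.frame hf₁ (by decide)
  have hW₁ := hW.frame hf₁ (by decide)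
  have hU₁ := h.current.frame hf₁ (by decide)
  have h34₁ := h.into.frame hf₁ (by decide)
  have h35₁ := h.out.frame hf₁ (by decide)
  refine Ends.seq (vecP_ends (G.liveIter W i T (k + 1)) he₁.size (by decide)
    (by decide) ?_) fun s₂ ⟨hf₂, h₂⟩ => ?_
  · intro x s' hf hx
    rw [Term.holds_or, (hU₁.frame hf (by decide)).holds hx,
      (holds_cpreT (he₁.frame hf (by decide)) (hW₁.frame hf (by decide))
        (h34₁.frame hf (by decide)) (h35₁.frame hf (by decide)) hx).2, liveIter_succ_of_stable hst]
    rfl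
  have he₂ := he₁.frame hf₂ (by decide)
  refine Ends.seq (vecP_ends (G.liveIter W i T (k + 1)) he₂.size (by decide)
    (by decide) fun x s' hf hx => (h₂.frame hf (by decide)).holds hx) fun s₃ ⟨hf₃, h₃⟩ => ?_
  refine (setVar_ends (one_le_pow_succ n 2)).mono le_rfl fun s₄ ⟨hf₄, h₄⟩ => ?_
  constructor
  · exact h.frame.trans ((hf₁.mono (by simp)).trans ((hf₂.mono (by simp)).trans
      ((hf₃.mono (by simp)).trans (hf₄.mono (by simp)))))
  · exact h₃.frame hf₄ (by decide)
  · rw [h₄]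
    simp [Term.val]
  · intro k' hk'
    rcases Nat.lt_succ_iff_lt_or_eq.1 hk' with hk' | rfl
    exacts [h.before k' hk', h.now]
  · exact fun h => absurd rfl h
  · have : {A | ∃ k' < k + 1, A = assumpGroup G W i
        (G.liveIter W i T k' ∪ G.attr W i (G.liveIter W i T k'))} =
        insert (assumpGroup G W i (G.cpreIter W i (G.liveIter W i T k) j))
          {A | ∃ k' < k, A = assumpGroup G W i
            (G.liveIter W i T k' ∪ G.attr W i (G.liveIter W i T k'))} := by
      rw [setOf_lt_succ, union_attr_of_stable hst]
    rw [this]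
    exact ((h₁.frame hf₂ (by decide)).frame hf₃ (by decide)).frame hf₄ (by decide)
  -- By stability the `j + 1` groups written in this round are all its attractor groups.
  · have : {A | (∃ k' < k + 1, A ∈ G.attrGroups W i (G.liveIter W i T k')) ∨
        ∃ j' < 0, A = attrGroup G W i (G.liveIter W i T (k + 1)) j'} =
          {A | (∃ k' < k, A ∈ G.attrGroups W i (G.liveIter W i T k')) ∨
            ∃ j' < j + 1, A = attrGroup G W i (G.liveIter W i T k) j'} := by
      ext A
      simp only [Set.mem_ofPred_eq, Nat.lt_succ_iff_lt_or_eq (n := k), or_and_right,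
        exists_or, exists_eq_left, attrGroups_of_stable hst, Nat.not_lt_zero, false_and,
        exists_const, or_false]
    rw [this]
    exact (((h.strat.frame hf₁ (by decide)).frame hf₂ (by decide)).frame hf₃ (by decide)).frame
      hf₄ (by decide)

theorem liveBody_ends (he₀ : Env G i s₀) (hW₀ : IsSet s₀ 24 W) (hT : T ⊆ W)
    (hr : G.AllReach W T) {k j : ℕ} (h : LiveInv G i W T H₁ H₂ R₁ R₂ s₀ k j s)
    (hc : (Term.or (.var 37) (.neg (.var 26))).Holds s) :
    Ends liveBody s ((n + 1) ^ 2) fun s' => ∃ p : ℕ × ℕ,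
      LiveInv G i W T H₁ H₂ R₁ R₂ s₀ p.1 p.2 s' ∧
      (n + 1) ^ 2 + livePot G i W T p.1 p.2 ≤ livePot G i W T k j := by
  refine liveMid_ends he₀ hW₀ h hc fun s₁ h₁ => ?_
  refine Ends.seq (Q := fun s₂ => ∃ k' j', LiveInv' G i W T H₁ H₂ R₁ R₂ s₀ k' j' s₂ ∧
    (n + 1) ^ 2 + livePot G i W T k' j' ≤ livePot G i W T k j) ?_ ?_
  · refine Ends.ite (one_le_pow_succ n 2) (fun hch => ?_) (fun hch => ?_)
    · exact (liveGrow_ends he₀ h₁).mono le_rfl fun s₂ h₂ =>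
        ⟨k, j + 1, h₂, livePot_grow hT (h₁.grows.1 hch)⟩
    · have hst : G.cpreIter W i (G.liveIter W i T k) (j + 1) =
          G.cpreIter W i (G.liveIter W i T k) j := by
        refine Set.Subset.antisymm (fun x hx => ?_) (cpreIter_mono (Nat.le_succ j))
        by_contra hx'
        exact h₁.grows.2 ⟨x, hx, hx'⟩ hch
      exact (liveStable_ends he₀ hW₀ h₁ hst).mono le_rfl fun s₂ h₂ =>
        ⟨k + 1, 0, h₂, livePot_stable hT hr h₁.now hst⟩
  · rintro s₂ ⟨k', j', h₂, hpot⟩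
    refine (neq_ends (he₀.frame h₂.frame (by decide)) (hW₀.frame h₂.frame (by decide)) h₂.current
      (cpreIter_subset (liveIter_subset hT _) _)).mono le_rfl fun s₃ ⟨hf₃, h₃⟩ => ?_
    refine ⟨(k', j'), ⟨h₂.frame.trans (hf₃.mono (by simp)), h₂.current.frame hf₃ (by decide), ?_,
      h₃, h₂.before, h₂.now, h₂.assump.frame hf₃ (by decide), h₂.strat.frame hf₃ (by decide)⟩, hpot⟩
    rw [hf₃ 26 (by decide), h₂.flag]

/-- The flag in `26` keeps the loop running in the middle of a round even if the attractor has
already filled `W`. `Live` tests only between rounds, and each round that it starts contributes all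
its groups. -/
theorem liveP_ends (he : Env G i s) (hW : IsSet s 24 W) (hU : IsSet s 22 T) (hT : T ⊆ W)
    (hr : G.AllReach W T) (h5 : Out s 5 H₁ R₁ ∅) (h12 : Out s 12 H₂ R₂ ∅) :
    Ends liveP s ((n + 1) ^ 2 * (2 * W.ncard + 1)) fun s' => Frame liveArrays s s' ∧
      Out s' 5 H₁ R₁ (G.liveAssump W i T) ∧ Out s' 12 H₂ R₂ (G.liveStrat W i T) := by
  have hB : (n + 1) ^ 2 ≤ (n + 1) ^ 2 * (2 * W.ncard + 1) :=
    Nat.le_mul_of_pos_right _ (Nat.succ_pos _)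
  refine Ends.seq (Ends.set (Q := fun s₁ => Frame [26] s s₁ ∧ s₁ 26 0 0 0 = 1)
    ((one_le_pow_succ n 2).trans hB) ⟨(Frame.refl _ _).update (by simp), update_same _ _ _ _ _ _⟩)
    fun s₁ ⟨hf₁, h₁⟩ => ?_
  refine Ends.seq ((neq_ends (he.frame hf₁ (by decide)) (hW.frame hf₁ (by decide))
    (hU.frame hf₁ (by decide)) hT).mono hB fun _ => id) fun s₂ ⟨hf₂, h₂⟩ => ?_
  have hf : Frame liveArrays s s₂ := (hf₁.mono (by simp)).trans (hf₂.mono (by simp))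
  have hinv : LiveInv G i W T H₁ H₂ R₁ R₂ s 0 0 s₂ := by
    refine ⟨hf, (hU.frame hf₁ (by decide)).frame hf₂ (by decide), ?_, h₂, ?_, ?_, ?_, ?_⟩
    · rw [hf₂ 26 (by decide), h₁]
      simp
    · exact fun k hk => absurd hk (Nat.not_lt_zero k)
    · exact fun h => absurd rfl h
    · have := (h5.frame hf₁ (by decide)).frame hf₂
        (by decide)
      simpa using this
    · have := (h12.frame hf₁ (by decide)).frame hf₂
        (by decide)
      simpa using this
  refine (Ends.loop (fun p : ℕ × ℕ => LiveInv G i W T H₁ H₂ R₁ R₂ s p.1 p.2)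
    (fun p => livePot G i W T p.1 p.2)
    (fun p s' h hc => ⟨_, one_le_pow_succ n 2, liveBody_ends he hW hT hr h hc⟩) (0, 0) s₂
    hinv).mono ?_ ?_
  · simp only [livePot, if_true]
    rw [add_zero, mul_add, mul_one]
    refine Nat.add_le_add (Nat.mul_le_mul_left _ ?_) (one_le_pow_succ n 2)
    omega
  · rintro s₃ ⟨⟨k, j⟩, h, hc⟩
    have hc' : ¬ (Term.or (.var 37) (.neg (.var 26))).Holds s₃ := not_not_intro hc
    rw [Term.holds_or, Term.holds_neg, not_or, not_not] at hc'
    obtain rfl : j = 0 := h.flag.1 hc'.2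
    have hk : G.liveIter W i T k = W := not_not.1 fun hne => hc'.1 (h.neq.2 hne)
    -- The sets increase and have just reached `W`, so the completed rounds are exactly those that
    -- `Live` starts.
    have hiff : ∀ k', G.liveIter W i T k' ≠ W ↔ k' < k := by
      refine fun k' => ⟨fun hne => ?_, h.before k'⟩
      by_contra hle
      refine hne (Set.Subset.antisymm (liveIter_subset hT k') ?_)
      exact hk.symm.subset.trans (liveIter_mono (not_lt.1 hle))
    refine ⟨h.frame, ?_, ?_⟩
    · convert h.assump using 1
      ext A
      simp only [liveAssump, hiff, Set.mem_ofPred_eq, assumpGroup, exists_eq_left]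
    · convert h.strat using 1
      ext A
      simp only [liveStrat, hiff, Set.mem_ofPred_eq]
      simp

end Live

end Ram

/-! ### Ending CoLive after `n` rounds -/

namespace GameGraph

section CoLive

variable {n : ℕ} {G : GameGraph (Fin n)} {X : Set (Fin n)} {P : Fin n → ℕ}

/-- Every vertex of `X` enters in some round, and backward reachability is complete after `n`
rounds. -/
theorem subset_coLiveIter (h : G.CoopClosed X P) (hd : Odd (maxPrio P X)) {k : ℕ} (hk : n ≤ k) :
    X ⊆ G.coLiveIter X (G.restSet X P) k := by
  intro v hv
  obtain ⟨m, hm⟩ := exists_mem_coLiveIter h hd hv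
  have hS : ∀ m, G.coLiveIter X (G.restSet X P) (m + 1) =
      {x | x ∈ G.coLiveIter X (G.restSet X P) m ∨
        ∃ y ∈ G.coLiveIter X (G.restSet X P) m, (x, y) ∈ G.edgesIn X} := fun _ => rfl
  have h1 := iterate_pred_eq (S := G.coLiveIter X (G.restSet X P)) hS (n := k) (by simpa using hk)
  have h2 := iterate_pred_eq (S := G.coLiveIter X (G.restSet X P)) hS (n := k + m)
    (by simp only [Nat.card_eq_fintype_card, Fintype.card_fin]; omega)
  rw [h1, ← h2]
  exact coLiveIter_mono (Nat.le_add_left m k) hm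

/-- The edges that `CoLive` collects in its first `m` iterations. -/
def coLiveBefore (G : GameGraph (Fin n)) (X I : Set (Fin n)) (m : ℕ) : Set (Fin n × Fin n) :=
  {e | e ∈ G.edgesIn X ∧ ∃ k < m,
    (e.1 ∈ G.coLiveIter X I k ∧ e.2 ∉ G.coLiveIter X I k) ∨
    (e.1 ∈ G.pre X (G.coLiveIter X I k) \ G.coLiveIter X I k ∧
      e.2 ∈ G.pre X (G.coLiveIter X I k) \ G.coLiveIter X I k)}

/-- The edges that `CoLive` collects for one set `U`. -/
def coLiveStep (G : GameGraph (Fin n)) (X U : Set (Fin n)) : Set (Fin n × Fin n) :=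
  {e | e ∈ G.edgesIn X ∧ ((e.1 ∈ U ∧ e.2 ∉ U) ∨ (e.1 ∈ G.pre X U \ U ∧ e.2 ∈ G.pre X U \ U))}

theorem coLiveBefore_zero {I : Set (Fin n)} : G.coLiveBefore X I 0 = ∅ := by
  ext e
  simp [coLiveBefore]

theorem coLiveBefore_succ {I : Set (Fin n)} (m : ℕ) : G.coLiveBefore X I (m + 1) =
    G.coLiveBefore X I m ∪ G.coLiveStep X (G.coLiveIter X I m) := by
  ext e
  constructor
  · rintro ⟨he, k, hk, h⟩
    rcases Nat.lt_succ_iff_lt_or_eq.1 hk with hk | rfl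
    exacts [Or.inl ⟨he, k, hk, h⟩, Or.inr ⟨he, h⟩]
  · rintro (⟨he, k, hk, h⟩ | ⟨he, h⟩)
    exacts [⟨he, k, hk.trans (Nat.lt_succ_self m), h⟩, ⟨he, m, Nat.lt_succ_self m, h⟩]

/-- From round `n` on the set contains `X`, so no edge leaves it and no vertex is new. -/
theorem coLiveBefore_eq (h : G.CoopClosed X P) (hd : Odd (maxPrio P X)) :
    G.coLiveBefore X (G.restSet X P) n = G.coLiveEdges X (G.restSet X P) := by
  ext e
  constructor
  · rintro ⟨he, k, -, hk⟩
    exact ⟨he, k, hk⟩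
  · rintro ⟨he, k, hk⟩
    refine ⟨he, k, ?_, hk⟩
    by_contra hn
    have hX := subset_coLiveIter h hd (not_lt.1 hn)
    rcases hk with hk | hk
    · exact hk.2 (hX he.2.1)
    · exact hk.1.2 (hX he.1)

end CoLive

end GameGraph

namespace Ram

open GameGraph

variable {n : ℕ}

/-! ## Running the levels of `ComputeSets` -/

/-- The arrays `b, …, b + 6` store the template `T`. -/
structure Acc (s : Store) (b : ℕ) (T : Template (Fin n)) : Prop where
  safety : IsRel s b T.S
  coLive : IsRel s (b + 1) T.D
  cond : ∃ R, Out s b T.H R ∅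

theorem Acc.frame {s s' : Store} {b : ℕ} {T : Template (Fin n)} {A : List ℕ} (h : Acc s b T)
    (hf : Frame A s s') (hA : ∀ j < 7, b + j ∉ A) : Acc s' b T := by
  obtain ⟨h1, h2, R, h3⟩ := h
  refine ⟨h1.frame hf (hA 0 (by decide)), h2.frame hf (hA 1 (by decide)), R, h3.frame hf ?_⟩
  intro j hj
  refine hA j ?_
  simp only [List.mem_cons, List.not_mem_nil, or_false] at hj
  omega

/-- The arrays that may change in one level. -/
abbrev levelArrays : List ℕ := [6, 7, 8, 9, 10, 11, 13, 14, 15, 16, 17, 18, 19, 22, 23, 24, 26, 27,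
  28, 30, 31, 32, 33, 34, 35, 36, 37, 38]

/-- The state at the beginning of a level. -/
structure LevelStart (G : GameGraph (Fin n)) (i : Fin 2) (C X : Set (Fin n)) (P : Fin n → ℕ)
    (s : Store) : Prop where
  env : Env G i s
  good : IsSet s 21 C
  current : IsSet s 20 X
  prio : IsPrio s P
  top : s 25 0 0 0 = maxPrio P X

theorem LevelStart.frame {G : GameGraph (Fin n)} {i : Fin 2} {C X : Set (Fin n)} {P : Fin n → ℕ}
    {s s' : Store} {A : List ℕ} (h : LevelStart G i C X P s) (hf : Frame A s s')
    (hA : ∀ b ∈ [0, 1, 2, 3, 4, 20, 21, 25], b ∉ A) : LevelStart G i C X P s' where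
  env := h.env.frame hf fun b hb => hA b (by interval_cases b <;> decide)
  good := h.good.frame hf (hA _ (by decide))
  current := h.current.frame hf (hA _ (by decide))
  prio := h.prio.frame hf (hA _ (by decide))
  top := by rw [hf 25 (hA _ (by decide)), h.top]

/-- The edges within the set `20`. -/
def edgeX : Term := .and (edgeT vx vy) (.and (.mem 20 vx) (.mem 20 vy))

/-- The edges collected by one step of `CoLive`. -/
def coLiveT : Term :=
  .and edgeX (.or (.and (.mem 22 vx) (.neg (.mem 22 vy)))
    (.and (.and (.mem 23 vx) (.neg (.mem 22 vx))) (.and (.mem 23 vy) (.neg (.mem 22 vy)))))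

/-- One iteration of `CoLive`. -/
def coLiveBody : Prog :=
  .seq (exP 23 (.and edgeX (.mem 22 vy)))
  (.seq (orP 6 (.and coLiveT (.neg (ownT vx))))
  (.seq (orP 13 (.and coLiveT (ownT vx)))
  (.seq (vecP 28 (.or (.mem 22 vx) (.mem 23 vx)))
    (vecP 22 (.mem 28 vx)))))

/-- A level with an odd largest priority. -/
def oddP : Prog :=
  .seq (vecP 27 (.and (.mem 20 vx) (.neg (.eq (.mem 4 vx) (.var 25)))))
  (.seq (vecP 28 (.and (.mem 21 vx) (.mem 27 vx)))
  (.seq reachP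
  (.seq (vecP 19 (.mem 22 vx))
    (forP 33 coLiveBody))))

section Odd

variable {G : GameGraph (Fin n)} {i : Fin 2} {C X U : Set (Fin n)} {P : Fin n → ℕ} {s : Store}

theorem LevelStart.holds_edgeX (h : LevelStart G i C X P s) {x y : Fin n} (hx : vx.val s = x)
    (hy : vy.val s = y) : edgeX.Holds s ↔ (x, y) ∈ G.edgesIn X := by
  simp only [edgeX, Term.holds_and, h.env.holds_edge hx hy, h.current.holds hx, h.current.holds hy,
    edgesIn, Set.mem_ofPred_eq]
  tauto

theorem LevelStart.holds_coLiveT (h : LevelStart G i C X P s) (hU : IsSet s 22 U)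
    (hU' : IsSet s 23 (G.pre X U)) {x y : Fin n} (hx : vx.val s = x)
    (hy : vy.val s = y) : coLiveT.Holds s ↔ (x, y) ∈ G.coLiveStep X U := by
  simp only [coLiveT, Term.holds_and, Term.holds_or, Term.holds_neg, h.holds_edgeX hx hy,
    hU.holds hx, hU.holds hy, hU'.holds hx, hU'.holds hy, coLiveStep, Set.mem_ofPred_eq,
    Set.mem_sdiff]

theorem coLiveBody_ends {D₁ D₂ : Set (Fin n × Fin n)} (h : LevelStart G i C X P s)
    (hU : IsSet s 22 U) (h6 : IsRel s 6 D₁) (h13 : IsRel s 13 D₂) :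
    Ends coLiveBody s ((n + 1) ^ 2) fun s' => Frame [6, 13, 22, 23, 28, 30, 31] s s' ∧
      IsSet s' 22 (U ∪ G.pre X U) ∧
      IsRel s' 6 (D₁ ∪ {e | e ∈ G.coLiveStep X U ∧ G.owner e.1 = 1 - i}) ∧
      IsRel s' 13 (D₂ ∪ {e | e ∈ G.coLiveStep X U ∧ G.owner e.1 = i}) := by
  refine Ends.seq (exP_ends (fun x y => (x, y) ∈ G.edgesIn X ∧ y ∈ U) h.env.size (by decide)
    (by decide) (by decide) ?_) fun s₁ ⟨hf₁, h₁⟩ => ?_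
  · intro x y s' hf hx hy
    rw [Term.holds_and, (h.frame hf (by decide)).holds_edgeX hx hy,
      (hU.frame hf (by decide)).holds hy]
  have hpre : {x | ∃ y, (x, y) ∈ G.edgesIn X ∧ y ∈ U} = G.pre X U := by
    ext x
    exact exists_congr fun y => and_comm
  rw [hpre] at h₁
  have hl₁ := h.frame hf₁ (by decide)
  have hU₁ := hU.frame hf₁ (by decide)
  refine Ends.seq (orP_ends {e | e ∈ G.coLiveStep X U ∧ G.owner e.1 = 1 - i}
    (h6.frame hf₁ (by decide)) hl₁.env.size (by decide) (by decide) (by decide) ?_)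
    fun s₂ ⟨hf₂, h₂⟩ => ?_
  · intro x y s' hf hx hy
    have hl := hl₁.frame hf (by decide)
    rw [Term.holds_and, hl.holds_coLiveT (hU₁.frame hf (by decide)) (h₁.frame hf (by decide)) hx hy,
      Term.holds_neg, hl.env.holds_own hx, not_owner_iff]
    rfl
  have hl₂ := hl₁.frame hf₂ (by decide)
  have hU₂ := hU₁.frame hf₂ (by decide)
  have h23₂ := h₁.frame hf₂ (by decide)
  refine Ends.seq (orP_ends {e | e ∈ G.coLiveStep X U ∧ G.owner e.1 = i}
    ((h13.frame hf₁ (by decide)).frame hf₂ (by decide)) hl₂.env.size (by decide) (by decide)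
    (by decide) ?_) fun s₃ ⟨hf₃, h₃⟩ => ?_
  · intro x y s' hf hx hy
    have hl := hl₂.frame hf (by decide)
    rw [Term.holds_and, hl.holds_coLiveT (hU₂.frame hf (by decide)) (h23₂.frame hf (by decide))
      hx hy, hl.env.holds_own hx]
    rfl
  have hl₃ := hl₂.frame hf₃ (by decide)
  have hU₃ := hU₂.frame hf₃ (by decide)
  have h23₃ := h23₂.frame hf₃ (by decide)
  refine Ends.seq (vecP_ends (U ∪ G.pre X U) hl₃.env.size (by decide) (by decide) ?_)
    fun s₄ ⟨hf₄, h₄⟩ => ?_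
  · intro x s' hf hx
    rw [Term.holds_or, (hU₃.frame hf (by decide)).holds hx, (h23₃.frame hf (by decide)).holds hx]
    rfl
  refine (vecP_ends (U ∪ G.pre X U) (hl₃.frame hf₄ (by decide)).env.size (by decide) (by decide)
    fun x s' hf hx => (h₄.frame hf (by decide)).holds hx).mono le_rfl fun s₅ ⟨hf₅, h₅⟩ => ?_
  refine ⟨?_, h₅, ?_, ?_⟩
  · exact (hf₁.mono (by simp)).trans ((hf₂.mono (by simp)).trans ((hf₃.mono (by simp)).trans
      ((hf₄.mono (by simp)).trans (hf₅.mono (by simp)))))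
  · exact ((h₂.frame hf₃ (by decide)).frame hf₄ (by decide)).frame hf₅ (by decide)
  · exact (h₃.frame hf₄ (by decide)).frame hf₅ (by decide)

/-- The known good vertices reduce the rest to one cubic reachability query, and CoLive takes `n`
rounds of quadratic cost. -/
theorem oddP_ends {A₁ A₂ : Template (Fin n)} (h : LevelStart G i C X P s)
    (hX : G.CoopClosed X P) (hC : G.GoodInv C X P) (hd : Odd (maxPrio P X))
    (h5 : Acc s 5 A₁) (h12 : Acc s 12 A₂) :
    Ends oddP s ((n + 1) ^ 3) fun s' => Frame levelArrays s s' ∧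
      IsSet s' 19 (G.restSet X P) ∧ Acc s' 5 (A₁.conj (G.levelTemplates i X P).1) ∧
      Acc s' 12 (A₂.conj (G.levelTemplates i X P).2) := by
  have h23 : (n + 1) ^ 2 ≤ (n + 1) ^ 3 := pow_succ_mono n (by decide)
  refine Ends.seq ((vecP_ends (X \ {v | P v = maxPrio P X}) h.env.size (by decide) (by decide)
    ?_).mono h23 fun _ => id) fun s₁ ⟨hf₁, h₁⟩ => ?_
  · intro x s' hf hx
    have hl := h.frame hf (by decide)
    rw [Term.holds_and, Term.holds_neg, Term.holds_eq, hl.current.holds hx, hl.prio.val hx]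
    exact and_congr Iff.rfl (not_congr (by rw [← hl.top]; rfl))
  have hl₁ := h.frame hf₁ (by decide)
  refine Ends.seq ((vecP_ends {v | v ∈ C ∧ v ∈ X ∧ P v ≠ maxPrio P X} hl₁.env.size (by decide)
    (by decide) ?_).mono h23 fun _ => id) fun s₂ ⟨hf₂, h₂⟩ => ?_
  · intro x s' hf hx
    rw [Term.holds_and, (hl₁.frame hf (by decide)).good.holds hx, (h₁.frame hf (by decide)).holds hx]
    rfl
  have hl₂ := hl₁.frame hf₂ (by decide)
  refine Ends.seq (reachP_ends n G i s₂ _ _ hl₂.env h₂ (h₁.frame hf₂ (by decide)))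
    fun s₃ ⟨hf₃, h₃⟩ => ?_
  rw [← hC.restSet_odd hd] at h₃
  have hl₃ := hl₂.frame hf₃ (by decide)
  refine Ends.seq ((vecP_ends (G.restSet X P) hl₃.env.size (by decide) (by decide)
    fun x s' hf hx => (h₃.frame hf (by decide)).holds hx).mono h23 fun _ => id)
    fun s₄ ⟨hf₄, h₄⟩ => ?_
  have hl₄ := hl₃.frame hf₄ (by decide)
  have hf₀₄ : Frame [19, 22, 23, 27, 28, 30, 31, 32] s s₄ := (hf₁.mono (by simp)).trans
    ((hf₂.mono (by simp)).trans ((hf₃.mono (by simp)).trans (hf₄.mono (by simp))))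
  have h5₄ := h5.frame hf₀₄ (by decide)
  have h12₄ := h12.frame hf₀₄ (by decide)
  refine (Ends.forPow (n := n) (k := 2) (fun m s' => (Frame [6, 13, 22, 23, 28, 30, 31, 33] s₄ s' ∧
    s' 33 0 0 0 = m) ∧ IsSet s' 22 (G.coLiveIter X (G.restSet X P) m) ∧
    IsRel s' 6 (A₁.D ∪ {e | e ∈ G.coLiveBefore X (G.restSet X P) m ∧ G.owner e.1 = 1 - i}) ∧
    IsRel s' 13 (A₂.D ∪ {e | e ∈ G.coLiveBefore X (G.restSet X P) m ∧ G.owner e.1 = i}))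
    ?_ ?_ ?_).mono le_rfl ?_
  · have hf : Frame [33] s₄ (s₄.update 33 0 0 0 0) := (Frame.refl _ _).update (by simp)
    refine ⟨⟨hf.mono (by simp), update_same _ _ _ _ _ _⟩, ?_, ?_, ?_⟩
    · rw [coLiveIter_zero hX]
      exact (h₃.frame hf₄ (by decide)).frame hf (by decide)
    · simpa [coLiveBefore_zero] using h5₄.coLive.frame hf (by decide)
    · simpa [coLiveBefore_zero] using h12₄.coLive.frame hf (by decide)
  · exact fun m s' h => ⟨(hl₄.frame h.1.1 (by decide)).env.size, h.1.2⟩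
  · rintro m s₅ - ⟨⟨hf₅, hm⟩, h22, h6, h13⟩
    refine (coLiveBody_ends (hl₄.frame hf₅ (by decide)) h22 h6 h13).mono le_rfl
      fun s₆ ⟨hf₆, g22, g6, g13⟩ => ?_
    have hf : Frame [33] s₆ (s₆.update 33 0 0 0 (s₆ 33 0 0 0 + 1)) :=
      (Frame.refl _ _).update (by simp)
    have hset : ∀ a, {e | e ∈ G.coLiveBefore X (G.restSet X P) (m + 1) ∧ G.owner e.1 = a} =
        {e | e ∈ G.coLiveBefore X (G.restSet X P) m ∧ G.owner e.1 = a} ∪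
        {e | e ∈ G.coLiveStep X (G.coLiveIter X (G.restSet X P) m) ∧ G.owner e.1 = a} := by
      intro a
      rw [coLiveBefore_succ]
      ext e
      exact or_and_right
    refine ⟨⟨(hf₅.trans (hf₆.mono (by simp))).trans (hf.mono (by simp)), ?_⟩, ?_, ?_, ?_⟩
    · rw [update_same, hf₆ 33 (by decide), hm]
    · exact g22.frame hf (by decide)
    · rw [hset, ← Set.union_assoc]
      exact g6.frame hf (by decide)
    · rw [hset, ← Set.union_assoc]
      exact g13.frame hf (by decide)
  · rintro s' ⟨⟨hf, -⟩, -, h6, h13⟩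
    rw [coLiveBefore_eq hX hd] at h6 h13
    rw [levelTemplates_of_odd hd]
    obtain ⟨R₁, hR₁⟩ := h5₄.cond
    obtain ⟨R₂, hR₂⟩ := h12₄.cond
    refine ⟨(hf₀₄.mono (by simp)).trans (hf.mono (by simp)), h₄.frame hf (by decide),
      ⟨?_, h6, R₁, ?_⟩, ⟨?_, h13, R₂, ?_⟩⟩
    · simpa [Template.conj] using h5₄.safety.frame hf (by decide)
    · simpa [Template.conj] using hR₁.frame hf (by decide)
    · simpa [Template.conj] using h12₄.safety.frame hf (by decide)
    · simpa [Template.conj] using hR₂.frame hf (by decide)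

end Odd

end Ram

/-! ### Levels with an even largest priority -/

namespace Ram

open GameGraph

variable {n : ℕ}

/-- The conditional live-groups for the odd priority of the vertex in the scalar `33`. -/
def evenBody : Prog :=
  .seq (rowP 8 (.var 7) (.and (.mem 24 vx) (.eq (.mem 4 vx) (.mem 4 (.var 33)))))
  (.seq (rowP 15 (.var 14) (.and (.mem 24 vx) (.eq (.mem 4 vx) (.mem 4 (.var 33)))))
  (.seq (vecP 22 (.and (.mem 24 vx) (.and (.neg (.bit (.mem 4 vx)))
    (.lt (.mem 4 (.var 33)) (.mem 4 vx)))))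
  (.seq liveP (.seq (finishP 5) (finishP 12)))))

/-- A level with an even largest priority. -/
def evenP : Prog :=
  .seq (vecP 27 (.mem 20 vx))
  (.seq (vecP 28 (.and (.mem 21 vx) (.and (.mem 20 vx) (.eq (.mem 4 vx) (.var 25)))))
  (.seq reachP
  (.seq (vecP 24 (.mem 22 vx))
  (.seq (vecP 19 (.and (.mem 20 vx) (.neg (.mem 24 vx))))
    (forP 33 (.ite (.and (.mem 20 (.var 33)) (.bit (.mem 4 (.var 33)))) evenBody .skip))))))

section Even

variable {G : GameGraph (Fin n)} {i : Fin 2} {C X W : Set (Fin n)} {P : Fin n → ℕ} {s : Store}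
  {H₁ H₂ : Set (Set (Fin n) × Set (Set (Fin n × Fin n)))} {R₁ R₂ : Set (Fin n)}

/-- The arrays that `evenBody` changes. -/
abbrev evenArrays : List ℕ := [7, 8, 9, 10, 11, 14, 15, 16, 17, 18, 22, 26, 30, 31, 34, 35, 36, 37,
  38]

theorem evenBody_ends (h : LevelStart G i C X P s) (hW : IsSet s 24 W) (v : Fin n)
    (hv : s 33 0 0 0 = v) (hr : G.AllReach W (evenTarget W P (P v))) (h5 : Out s 5 H₁ R₁ ∅)
    (h12 : Out s 12 H₂ R₂ ∅) :
    Ends evenBody s ((n + 1) ^ 2 * (2 * W.ncard + 1)) fun s' => Frame evenArrays s s' ∧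
      (∃ R, Out s' 5 (insert ({x | x ∈ W ∧ P x = P v},
        G.liveAssump W i (evenTarget W P (P v))) H₁) R ∅) ∧
      ∃ R, Out s' 12 (insert ({x | x ∈ W ∧ P x = P v},
        G.liveStrat W i (evenTarget W P (P v))) H₂) R ∅ := by
  have hB : (n + 1) ^ 2 ≤ (n + 1) ^ 2 * (2 * W.ncard + 1) :=
    Nat.le_mul_of_pos_right _ (Nat.succ_pos _)
  have h1B := (one_le_pow_succ n 2).trans hB
  refine Ends.seq ((rowP_cond_ends {x | x ∈ W ∧ P x = P v} h.env.size (by decide) h5 ?_).mono hB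
    fun _ => id) fun s₁ ⟨hf₁, h₁⟩ => ?_
  · intro x s' hf hx
    have hl := h.frame hf (by decide)
    have hv' : Term.val s' (.var 33) = v := (congrFun₃ (hf 33 (by decide)) 0 0 0).trans hv
    rw [Term.holds_and, Term.holds_eq, (hW.frame hf (by decide)).holds hx, hl.prio.val hx,
      hl.prio.val hv']
    rfl
  have hl₁ := h.frame hf₁ (by decide)
  have hW₁ := hW.frame hf₁ (by decide)
  have hv₁ := (congrFun₃ (hf₁ 33 (by decide)) 0 0 0).trans hv
  refine Ends.seq ((rowP_cond_ends {x | x ∈ W ∧ P x = P v} hl₁.env.size (by decide)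
    (h12.frame hf₁ (by decide)) ?_).mono hB fun _ => id) fun s₂ ⟨hf₂, h₂⟩ => ?_
  · intro x s' hf hx
    have hl := hl₁.frame hf (by decide)
    have hv' : Term.val s' (.var 33) = v := (congrFun₃ (hf 33 (by decide)) 0 0 0).trans hv₁
    rw [Term.holds_and, Term.holds_eq, (hW₁.frame hf (by decide)).holds hx, hl.prio.val hx,
      hl.prio.val hv']
    rfl
  have hl₂ := hl₁.frame hf₂ (by decide)
  have hW₂ := hW₁.frame hf₂ (by decide)
  have hv₂ := (congrFun₃ (hf₂ 33 (by decide)) 0 0 0).trans hv₁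
  refine Ends.seq ((vecP_ends (evenTarget W P (P v)) hl₂.env.size (by decide) (by decide)
    ?_).mono hB fun _ => id) fun s₃ ⟨hf₃, h₃⟩ => ?_
  · intro x s' hf hx
    have hl := hl₂.frame hf (by decide)
    have hv' : Term.val s' (.var 33) = v := (congrFun₃ (hf 33 (by decide)) 0 0 0).trans hv₂
    rw [Term.holds_and, Term.holds_and, Term.holds_neg, Term.holds_bit, Term.holds_lt,
      (hW₂.frame hf (by decide)).holds hx, hl.prio.val hx, hl.prio.val hv', Nat.not_odd_iff_even]
    rfl
  have hl₃ := hl₂.frame hf₃ (by decide)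
  refine Ends.seq (liveP_ends hl₃.env (hW₂.frame hf₃ (by decide)) h₃ evenTarget_subset hr
    ((h₁.frame hf₂ (by decide)).frame hf₃ (by decide)) (h₂.frame hf₃ (by decide)))
    fun s₄ ⟨hf₄, g5, g12⟩ => ?_
  refine Ends.seq (finishP_ends h1B g5) fun s₅ ⟨hf₅, R, k5⟩ => ?_
  refine (finishP_ends h1B (g12.frame hf₅ (by decide))).mono le_rfl fun s₆ ⟨hf₆, k12⟩ => ?_
  refine ⟨?_, ⟨R, k5.frame hf₆ (by decide)⟩, k12⟩
  exact (hf₁.mono (by simp)).trans ((hf₂.mono (by simp)).trans ((hf₃.mono (by simp)).trans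
    ((hf₄.mono (by simp)).trans ((hf₅.mono (by simp)).trans (hf₆.mono (by simp))))))

/-- The conditional live-groups for the odd priorities of the first `m` vertices. -/
def condsBefore (X W : Set (Fin n)) (P : Fin n → ℕ)
    (L : Set (Fin n) → Set (Set (Fin n × Fin n))) (m : ℕ) :
    Set (Set (Fin n) × Set (Set (Fin n × Fin n))) :=
  {c | ∃ v : Fin n, v < m ∧ v ∈ X ∧ Odd (P v) ∧
    c = ({x | x ∈ W ∧ P x = P v}, L (evenTarget W P (P v)))}

theorem condsBefore_zero (L : Set (Fin n) → Set (Set (Fin n × Fin n))) :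
    condsBefore X W P L 0 = ∅ := by
  ext c
  simp [condsBefore]

theorem condsBefore_succ (L : Set (Fin n) → Set (Set (Fin n × Fin n))) (v : Fin n) (hv : v ∈ X)
    (ho : Odd (P v)) : condsBefore X W P L (v + 1) =
      insert ({x | x ∈ W ∧ P x = P v}, L (evenTarget W P (P v))) (condsBefore X W P L v) := by
  ext c
  constructor
  · rintro ⟨w, hw, h⟩
    rcases Nat.lt_succ_iff_lt_or_eq.1 hw with hw | hw
    · exact Or.inr ⟨w, hw, h⟩
    · obtain rfl := Fin.ext hw
      exact Or.inl h.2.2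
  · rintro (rfl | ⟨w, hw, h⟩)
    · exact ⟨v, Nat.lt_succ_self _, hv, ho, rfl⟩
    · exact ⟨w, hw.trans (Nat.lt_succ_self _), h⟩

theorem condsBefore_succ_of_not (L : Set (Fin n) → Set (Set (Fin n × Fin n))) (v : Fin n)
    (hv : ¬ (v ∈ X ∧ Odd (P v))) : condsBefore X W P L (v + 1) = condsBefore X W P L v := by
  ext c
  refine exists_congr fun w => ⟨fun ⟨hw, h⟩ => ⟨?_, h⟩,
    fun ⟨hw, h⟩ => ⟨hw.trans (Nat.lt_succ_self _), h⟩⟩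
  refine lt_of_le_of_ne (Nat.lt_succ_iff.1 hw) fun hwv => hv ?_
  obtain rfl := Fin.ext hwv
  exact ⟨h.1, h.2.1⟩

/-- Vertices of equal priority write the same conditional live-group repeatedly. The output is read
as a set, so running through vertices replaces running through distinct priorities. -/
theorem condsBefore_eq (L : Set (Fin n) → Set (Set (Fin n × Fin n))) :
    condsBefore X W P L n = {c | ∃ l ∈ P '' X, Odd l ∧
      c = ({x | x ∈ W ∧ P x = l}, L (evenTarget W P l))} := by
  ext c
  constructor
  · rintro ⟨v, -, hv, ho, rfl⟩
    exact ⟨_, ⟨v, hv, rfl⟩, ho, rfl⟩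
  · rintro ⟨_, ⟨v, hv, rfl⟩, ho, rfl⟩
    exact ⟨v, v.2, hv, ho, rfl⟩

/-- At most `n` runs of `liveP` are made, each of cost proportional to `(n + 1) ^ 2 * (2 * W.ncard +
1)`. The size of `W` is kept instead of `n`, because only its sum over all levels is linear. -/
theorem evenP_ends {A₁ A₂ : Template (Fin n)} (h : LevelStart G i C X P s)
    (hC : G.GoodInv C X P) (hd : ¬ Odd (maxPrio P X)) (h5 : Acc s 5 A₁) (h12 : Acc s 12 A₂) :
    Ends evenP s ((n + 1) ^ 3 * (2 * (X \ G.restSet X P).ncard + 1)) fun s' =>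
      Frame levelArrays s s' ∧
      IsSet s' 19 (G.restSet X P) ∧ Acc s' 5 (A₁.conj (G.levelTemplates i X P).1) ∧
      Acc s' 12 (A₂.conj (G.levelTemplates i X P).2) := by
  set W := X \ G.restSet X P with hWdef
  have hB : (n + 1) ^ 3 ≤ (n + 1) ^ 3 * (2 * W.ncard + 1) :=
    Nat.le_mul_of_pos_right _ (Nat.succ_pos _)
  have h23 := (pow_succ_mono n (show 2 ≤ 3 by decide)).trans hB
  refine Ends.seq ((vecP_ends X h.env.size (by decide) (by decide) fun x s' hf hx =>
    (h.current.frame hf (by decide)).holds hx).mono h23 fun _ => id) fun s₁ ⟨hf₁, h₁⟩ => ?_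
  have hl₁ := h.frame hf₁ (by decide)
  refine Ends.seq ((vecP_ends {v | v ∈ C ∧ v ∈ X ∧ P v = maxPrio P X} hl₁.env.size (by decide)
    (by decide) ?_).mono h23 fun _ => id) fun s₂ ⟨hf₂, h₂⟩ => ?_
  · intro x s' hf hx
    have hl := hl₁.frame hf (by decide)
    rw [Term.holds_and, Term.holds_and, Term.holds_eq, hl.good.holds hx, hl.current.holds hx,
      hl.prio.val hx]
    refine and_congr Iff.rfl (and_congr Iff.rfl ?_)
    rw [← hl.top]
    rfl
  have hl₂ := hl₁.frame hf₂ (by decide)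
  refine Ends.seq ((reachP_ends n G i s₂ _ _ hl₂.env h₂ (h₁.frame hf₂ (by decide))).mono hB
    fun _ => id) fun s₃ ⟨hf₃, h₃⟩ => ?_
  rw [← hC.diff_restSet_even hd, ← hWdef] at h₃
  have hl₃ := hl₂.frame hf₃ (by decide)
  refine Ends.seq ((vecP_ends W hl₃.env.size (by decide) (by decide)
    fun x s' hf hx => (h₃.frame hf (by decide)).holds hx).mono h23 fun _ => id)
    fun s₄ ⟨hf₄, h₄⟩ => ?_
  have hl₄ := hl₃.frame hf₄ (by decide)
  refine Ends.seq ((vecP_ends (G.restSet X P) hl₄.env.size (by decide) (by decide)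
    ?_).mono h23 fun _ => id) fun s₅ ⟨hf₅, h₅⟩ => ?_
  · intro x s' hf hx
    rw [Term.holds_and, Term.holds_neg, (hl₄.frame hf (by decide)).current.holds hx,
      (h₄.frame hf (by decide)).holds hx, hWdef, ← Set.mem_sdiff,
      sdiff_sdiff_eq_self (G.restSet_subset X P)]
  have hl₅ := hl₄.frame hf₅ (by decide)
  have hW₅ := h₄.frame hf₅ (by decide)
  have hf₀₅ : Frame [19, 22, 23, 24, 27, 28, 30, 31, 32] s s₅ := (hf₁.mono (by simp)).trans
    ((hf₂.mono (by simp)).trans ((hf₃.mono (by simp)).trans ((hf₄.mono (by simp)).trans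
    (hf₅.mono (by simp)))))
  have h5₅ := h5.frame hf₀₅ (by decide)
  have h12₅ := h12.frame hf₀₅ (by decide)
  refine (Ends.forP (n := n) (B := (n + 1) ^ 2 * (2 * W.ncard + 1))
    (fun m s' => (Frame (33 :: evenArrays) s₅ s' ∧ s' 33 0 0 0 = m) ∧
    (∃ R, Out s' 5 (A₁.H ∪ condsBefore X W P (G.liveAssump W i) m) R ∅) ∧
    (∃ R, Out s' 12 (A₂.H ∪ condsBefore X W P (G.liveStrat W i) m) R ∅))
    ((one_le_pow_succ n 2).trans (Nat.le_mul_of_pos_right _ (Nat.succ_pos _))) ?_ ?_ ?_).mono ?_ ?_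
  · have hf : Frame [33] s₅ (s₅.update 33 0 0 0 0) := (Frame.refl _ _).update (by simp)
    obtain ⟨R₁, hR₁⟩ := h5₅.cond
    obtain ⟨R₂, hR₂⟩ := h12₅.cond
    refine ⟨⟨hf.mono (by simp), update_same _ _ _ _ _ _⟩, ⟨R₁, ?_⟩, ⟨R₂, ?_⟩⟩
    · simpa [condsBefore_zero] using hR₁.frame hf (by decide)
    · simpa [condsBefore_zero] using hR₂.frame hf (by decide)
  · exact fun m s' h => ⟨(hl₅.frame h.1.1 (by decide)).env.size, h.1.2⟩
  · rintro m s₆ hmn ⟨⟨hf₆, hm⟩, ⟨R₁, h5⟩, ⟨R₂, h12⟩⟩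
    have hl₆ := hl₅.frame hf₆ (by decide)
    have hv : Term.val s₆ (.var 33) = (⟨m, hmn⟩ : Fin n) := hm
    have hB1 : 1 ≤ (n + 1) ^ 2 * (2 * W.ncard + 1) :=
      (one_le_pow_succ n 2).trans (Nat.le_mul_of_pos_right _ (Nat.succ_pos _))
    have hcond : (Term.and (.mem 20 (.var 33)) (.bit (.mem 4 (.var 33)))).Holds s₆ ↔
        (⟨m, hmn⟩ : Fin n) ∈ X ∧ Odd (P ⟨m, hmn⟩) := by
      rw [Term.holds_and, Term.holds_bit, hl₆.current.holds hv, hl₆.prio.val hv]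
    refine Ends.ite hB1 (fun hc => ?_) (fun hc => ?_)
    · obtain ⟨hvX, ho⟩ := hcond.1 hc
      refine (evenBody_ends hl₆ (hW₅.frame hf₆ (by decide)) ⟨m, hmn⟩ hm
        (allReach_evenTarget hd ⟨_, hvX, rfl⟩ ho) h5 h12).mono le_rfl
        fun s₇ ⟨hf₇, ⟨R₁, g5⟩, ⟨R₂, g12⟩⟩ => ?_
      have hf : Frame [33] s₇ (s₇.update 33 0 0 0 (s₇ 33 0 0 0 + 1)) :=
        (Frame.refl _ _).update (by simp)
      refine ⟨⟨(hf₆.trans (hf₇.mono (by simp))).trans (hf.mono (by simp)), ?_⟩, ⟨R₁, ?_⟩,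
        ⟨R₂, ?_⟩⟩
      · rw [update_same, hf₇ 33 (by decide), hm]
      · rw [condsBefore_succ _ ⟨m, hmn⟩ hvX ho, Set.union_insert]
        exact g5.frame hf (by decide)
      · rw [condsBefore_succ _ ⟨m, hmn⟩ hvX ho, Set.union_insert]
        exact g12.frame hf (by decide)
    · have hc' : ¬ ((⟨m, hmn⟩ : Fin n) ∈ X ∧ Odd (P ⟨m, hmn⟩)) := fun h' => hcond.2 h' hc
      refine Ends.skip hB1 ?_
      have hf : Frame [33] s₆ (s₆.update 33 0 0 0 (s₆ 33 0 0 0 + 1)) :=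
        (Frame.refl _ _).update (by simp)
      refine ⟨⟨hf₆.trans (hf.mono (by simp)), ?_⟩, ⟨R₁, ?_⟩, ⟨R₂, ?_⟩⟩
      · rw [update_same, hm]
      · rw [condsBefore_succ_of_not _ ⟨m, hmn⟩ hc']
        exact h5.frame hf (by decide)
      · rw [condsBefore_succ_of_not _ ⟨m, hmn⟩ hc']
        exact h12.frame hf (by decide)
  · rw [pow_succ _ 2, mul_right_comm]
  · rintro s' ⟨⟨hf, -⟩, h5, h12⟩
    rw [condsBefore_eq] at h5 h12
    rw [levelTemplates_of_even hd]
    refine ⟨(hf₀₅.mono (by simp)).trans (hf.mono (by simp)), h₅.frame hf (by decide),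
      ⟨?_, ?_, h5⟩, ⟨?_, ?_, h12⟩⟩
    · simpa [Template.conj] using h5₅.safety.frame hf (by decide)
    · simpa [Template.conj] using h5₅.coLive.frame hf (by decide)
    · simpa [Template.conj] using h12₅.safety.frame hf (by decide)
    · simpa [Template.conj] using h12₅.coLive.frame hf (by decide)

end Even

end Ram

namespace Ram

open GameGraph

variable {n : ℕ}

/-! ## The whole program -/

/-- Merges the priority in the scalar `25` into the priority `0`. -/
def mergeP : Prog :=
  forP 30 (.ite (.eq (.mem 4 vx) (.var 25)) (.set 4 vx (.lit 0) (.lit 0) (.lit 0)) .skip)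

theorem mergeP_ends {P : Fin n → ℕ} {d : ℕ} {s : Store} (hn : s 0 0 0 0 = n) (hP : IsPrio s P)
    (hd : s 25 0 0 0 = d) : Ends mergeP s ((n + 1) ^ 2) fun s' =>
      Frame [4, 30] s s' ∧ IsPrio s' (mergePrio P d) := by
  refine (Ends.forPow (n := n) (k := 1) (fun m s' => (Frame [4, 30] s s' ∧ s' 30 0 0 0 = m) ∧
    ∀ v : Fin n, s' 4 v 0 0 = if (v : ℕ) < m then mergePrio P d v else P v) ?_ ?_ ?_).mono le_rfl ?_
  · refine ⟨⟨(Frame.refl _ s).update (by simp), update_same _ _ _ _ _ _⟩, fun v => ?_⟩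
    rw [update_of_ne _ _ _ _ _ (by decide), hP]
    simp
  · exact fun m s' h => ⟨by rw [h.1.1 0 (by decide), hn], h.1.2⟩
  · rintro m s₁ hm ⟨⟨hf, hm₁⟩, h⟩
    have h25 : Term.val s₁ (.var 25) = d := (congrFun₃ (hf 25 (by decide)) 0 0 0).trans hd
    have h4 : Term.val s₁ (.mem 4 vx) = P ⟨m, hm⟩ := by
      rw [Term.val_mem, show Term.val s₁ vx = m from hm₁]
      simpa using h ⟨m, hm⟩
    have hc : (Term.eq (.mem 4 vx) (.var 25)).Holds s₁ ↔ P ⟨m, hm⟩ = d := by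
      rw [Term.holds_eq, h4, h25]
    refine Ends.ite (one_le_pow_succ n 1) (fun hc' => ?_) (fun hc' => ?_)
    · have hPd := hc.1 hc'
      refine Ends.set (one_le_pow_succ n 1) ?_
      rw [show Term.val s₁ vx = m from hm₁]
      refine ⟨⟨(hf.update (by simp)).update (by simp), ?_⟩, fun v => ?_⟩
      · rw [update_same, update_of_ne _ _ _ _ _ (by decide), hm₁]
      · rw [update_of_ne _ _ _ _ _ (by decide)]
        by_cases hv : (v : ℕ) = m
        · obtain rfl : v = ⟨m, hm⟩ := Fin.ext hv
          rw [if_pos (Nat.lt_succ_self _), mergePrio, if_pos hPd]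
          exact update_same _ _ _ _ _ _
        · refine (update_apply_of_ne _ fun heq => hv (congrArg Prod.fst heq)).trans ?_
          rw [h v]
          exact if_congr (by omega) rfl rfl
    · have hPd : P ⟨m, hm⟩ ≠ d := fun h' => hc.2 h' hc'
      refine Ends.skip (one_le_pow_succ n 1) ?_
      refine ⟨⟨hf.update (by simp), ?_⟩, fun v => ?_⟩
      · rw [update_same, hm₁]
      · rw [update_of_ne _ _ _ _ _ (by decide), h v]
        by_cases hv : (v : ℕ) = m
        · obtain rfl : v = ⟨m, hm⟩ := Fin.ext hv
          rw [if_pos (Nat.lt_succ_self _), if_neg (lt_irrefl _), mergePrio_of_ne hPd]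
        · exact if_congr (by omega) rfl rfl
  · rintro s' ⟨⟨hf, -⟩, h⟩
    exact ⟨hf, fun v => (h v).trans (if_pos v.2)⟩

/-- One level of `ComputeSets`. -/
def levelP : Prog :=
  .seq (.ite (.bit (.var 25)) oddP evenP) (.seq mergeP (.seq (vecP 20 (.mem 19 vx)) maxP))

/-- The invariant of the main loop: the templates found so far and those of the remaining levels
yield `T₁` and `T₂`. -/
structure MainInv (G : GameGraph (Fin n)) (i : Fin 2) (C : Set (Fin n)) (T₁ T₂ : Template (Fin n))
    (X : Set (Fin n)) (P : Fin n → ℕ) (s : Store) : Prop where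
  start : LevelStart G i C X P s
  closed : G.CoopClosed X P
  good : G.GoodInv C X P
  templates : ∃ A₁ A₂ : Template (Fin n), Acc s 5 A₁ ∧ Acc s 12 A₂ ∧
    A₁.conj (G.computeSets i X P).1 = T₁ ∧ A₂.conj (G.computeSets i X P).2 = T₂

theorem conj_assoc {V : Type*} (A B C : Template V) :
    (A.conj B).conj C = A.conj (B.conj C) := by
  ext1 <;> exact Set.union_assoc _ _ _

section Main

variable {G : GameGraph (Fin n)} {i : Fin 2} {C X : Set (Fin n)} {P : Fin n → ℕ} {s : Store}
  {T₁ T₂ : Template (Fin n)}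

theorem levelP_ends (h : MainInv G i C T₁ T₂ X P s) (hpos : 0 < maxPrio P X) :
    Ends levelP s ((n + 1) ^ 3 * (2 * (X \ G.restSet X P).ncard + 1))
      (MainInv G i C T₁ T₂ (G.restSet X P) (mergePrio P (maxPrio P X))) := by
  obtain ⟨A₁, A₂, h5, h12, e₁, e₂⟩ := h.templates
  have hB : (n + 1) ^ 3 ≤ (n + 1) ^ 3 * (2 * (X \ G.restSet X P).ncard + 1) :=
    Nat.le_mul_of_pos_right _ (Nat.succ_pos _)
  have h2B := (pow_succ_mono n (show 2 ≤ 3 by decide)).trans hB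
  have hodd : (Term.bit (.var 25)).Holds s ↔ Odd (maxPrio P X) := by
    rw [Term.holds_bit, ← h.start.top]
    rfl
  refine Ends.seq (Ends.ite ((one_le_pow_succ n 3).trans hB)
    (fun hc => (oddP_ends h.start h.closed h.good (hodd.1 hc) h5 h12).mono hB fun _ => id)
    (fun hc => evenP_ends h.start h.good (fun ho => hodd.2 ho hc) h5 h12))
    fun s₁ ⟨hf₁, h19, g5, g12⟩ => ?_
  have hl₁ := h.start.frame hf₁ (by decide)
  refine Ends.seq ((mergeP_ends hl₁.env.size hl₁.prio hl₁.top).mono h2B fun _ => id)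
    fun s₂ ⟨hf₂, hP₂⟩ => ?_
  have he₂ := hl₁.env.frame hf₂ (by decide)
  have h19₂ := h19.frame hf₂ (by decide)
  refine Ends.seq ((vecP_ends (G.restSet X P) he₂.size (by decide) (by decide)
    fun x s' hf hx => (h19₂.frame hf (by decide)).holds hx).mono h2B fun _ => id)
    fun s₃ ⟨hf₃, h20⟩ => ?_
  have he₃ := he₂.frame hf₃ (by decide)
  have hP₃ := hP₂.frame hf₃ (by decide)
  refine (maxP_ends n G i s₃ _ _ he₃ hP₃ h20).mono h2B fun s₄ ⟨hf₄, h25⟩ => ?_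
  have hf : Frame [4, 20, 25, 30] s₁ s₄ :=
    (hf₂.mono (by simp)).trans ((hf₃.mono (by simp)).trans (hf₄.mono (by simp)))
  refine ⟨⟨he₃.frame hf₄ (by decide), hl₁.good.frame hf (by decide), h20.frame hf₄ (by decide),
    hP₃.frame hf₄ (by decide), h25⟩, h.closed.restSet, h.good.restSet, _, _,
    g5.frame hf (by decide), g12.frame hf (by decide), ?_, ?_⟩
  · rw [conj_assoc, ← e₁, computeSets_of_pos hpos]
  · rw [conj_assoc, ← e₂, computeSets_of_pos hpos]

/-- The weight of the remaining levels. -/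
noncomputable def levelPot (X : Set (Fin n)) (P : Fin n → ℕ) : ℕ :=
  (n + 1) ^ 3 * (2 * X.ncard + {v | P v ≠ 0}.ncard)

/-- The removed vertices pay `2 * |W|`. The remaining unit is paid by a vertex of the largest
priority, which merging turns into `0`. -/
theorem levelPot_restSet (hpos : 0 < maxPrio P X) :
    (n + 1) ^ 3 * (2 * (X \ G.restSet X P).ncard + 1) +
      levelPot (G.restSet X P) (mergePrio P (maxPrio P X)) ≤ levelPot X P := by
  obtain ⟨v, hv, hvd⟩ := exists_eq_maxPrio hpos
  have h1 := Set.ncard_sdiff_add_ncard_of_subset (G.restSet_subset X P) (Set.toFinite X)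
  have h2 : {w | mergePrio P (maxPrio P X) w ≠ 0}.ncard < {w | P w ≠ 0}.ncard := by
    have hsub : {w | mergePrio P (maxPrio P X) w ≠ 0} ⊆ {w | P w ≠ 0} := fun w hw h0 =>
      hw (by rw [mergePrio, h0, ite_self])
    exact Set.ncard_lt_ncard ((Set.ssubset_iff_of_subset hsub).2
      ⟨v, fun h0 => by omega, fun hw => hw (if_pos hvd)⟩) (Set.toFinite _)
  rw [levelPot, levelPot, ← mul_add]
  exact Nat.mul_le_mul_left _ (by omega)

/-- Without positive priorities there are no odd ones, so the last level contributes nothing and the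
main loop may stop before it. -/
theorem computeSets_eq_empty_of_zero (h0 : ¬ 0 < maxPrio P X) :
    G.computeSets i X P = (⟨∅, ∅, ∅⟩, ⟨∅, ∅, ∅⟩) := by
  have h0' : maxPrio P X = 0 := Nat.eq_zero_of_not_pos h0
  have hno : ∀ l ∈ P '' X, ¬ Odd l := by
    rintro _ ⟨v, hv, rfl⟩ ho
    have := le_maxPrio (P := P) hv
    have := ho.pos
    omega
  rw [computeSets_of_zero h0, levelTemplates_of_even (by simp [h0'])]
  refine Prod.ext (Template.ext rfl rfl ?_) (Template.ext rfl rfl ?_)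
  all_goals
    ext c
    exact ⟨fun ⟨l, hl, ho, _⟩ => (hno l hl ho).elim, fun h => h.elim⟩

theorem Acc.readTemplate_eq {b : ℕ} {T : Template (Fin n)} (h : Acc s b T) :
    readTemplate n s b = T := by
  obtain ⟨R, hR⟩ := h.cond
  exact Template.ext (Set.ext fun e => h.safety e.1 e.2) (Set.ext fun e => h.coLive e.1 e.2) hR.conds

theorem conj_empty {V : Type*} (A : Template V) : A.conj ⟨∅, ∅, ∅⟩ = A := by
  ext1 <;> exact Set.union_empty _

theorem levels_ends (h : MainInv G i C T₁ T₂ X P s) :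
    Ends (.loop (.var 25) levelP) s (levelPot X P + 1) fun s' => output n s' = (T₁, T₂) := by
  refine (Ends.loop (fun p : Set (Fin n) × (Fin n → ℕ) => MainInv G i C T₁ T₂ p.1 p.2)
    (fun p => levelPot p.1 p.2) ?_ (X, P) s h).mono le_rfl ?_
  · rintro ⟨X, P⟩ s h hc
    have hpos : 0 < maxPrio P X := by
      rw [← h.start.top]
      exact Nat.pos_of_ne_zero hc
    exact ⟨_, (one_le_pow_succ n 3).trans (Nat.le_mul_of_pos_right _ (Nat.succ_pos _)),
      (levelP_ends h hpos).mono le_rfl fun s' h' => ⟨(_, _), h', levelPot_restSet hpos⟩⟩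
  · rintro s' ⟨⟨X, P⟩, h, hc⟩
    have h0 : ¬ 0 < maxPrio P X := by
      rw [← h.start.top]
      exact fun hpos => hpos.ne' hc
    obtain ⟨A₁, A₂, h5, h12, e₁, e₂⟩ := h.templates
    rw [computeSets_eq_empty_of_zero h0, conj_empty] at e₁ e₂
    rw [output, h5.readTemplate_eq, h12.readTemplate_eq, e₁, e₂]

/-- The edges from the set `20` to its complement. -/
def leaveT : Term := .and (edgeT vx vy) (.and (.mem 20 vx) (.neg (.mem 20 vy)))

/-- The program for `ParityTemp`. -/
def parityTempP : Prog :=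
  .seq goodP
  (.seq (vecP 27 (.lit 1))
  (.seq (vecP 28 (.mem 21 vx))
  (.seq reachP
  (.seq (vecP 20 (.mem 22 vx))
  (.seq (orP 5 (.and leaveT (.neg (ownT vx))))
  (.seq (orP 12 (.and leaveT (ownT vx)))
  (.seq maxP
    (.loop (.var 25) levelP))))))))

theorem holds_leaveT {Z : Set (Fin n)} (he : Env G i s) (hZ : IsSet s 20 Z) {x y : Fin n}
    (hx : vx.val s = x) (hy : vy.val s = y) :
    ((Term.and leaveT (.neg (ownT vx))).Holds s ↔ (x, y) ∈ G.unsafeEdges Z (1 - i)) ∧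
    ((Term.and leaveT (ownT vx)).Holds s ↔ (x, y) ∈ G.unsafeEdges Z i) := by
  simp only [leaveT, Term.holds_and, Term.holds_neg, he.holds_edge hx hy, hZ.holds hx, hZ.holds hy,
    he.holds_own hx, not_owner_iff, unsafeEdges, Set.mem_ofPred_eq]
  constructor <;> tauto

theorem parityTempP_ends (he : Env G i s) (hP : IsPrio s P) (h5 : Acc s 5 (⟨∅, ∅, ∅⟩ : Template (Fin n)))
    (h12 : Acc s 12 (⟨∅, ∅, ∅⟩ : Template (Fin n))) :
    Ends parityTempP s (3 * (n + 1) ^ 4) fun s' => output n s' = G.parityTemp P i := by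
  have h4B : (n + 1) ^ 4 ≤ 3 * (n + 1) ^ 4 := by omega
  have hB : ∀ {k}, k ≤ 4 → (n + 1) ^ k ≤ 3 * (n + 1) ^ 4 :=
    fun hk => (pow_succ_mono n hk).trans h4B
  refine Ends.seq ((goodP_ends n G i s P he hP).mono h4B fun _ => id) fun s₁ ⟨hf₁, h₁⟩ => ?_
  have he₁ := he.frame hf₁ (by decide)
  refine Ends.seq ((vecP_ends Set.univ he₁.size (by decide) (by decide) fun x s' _ _ => ?_).mono
    (hB (by decide)) fun _ => id) fun s₂ ⟨hf₂, h₂⟩ => ?_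
  · simp
  have he₂ := he₁.frame hf₂ (by decide)
  have h21₂ := h₁.frame hf₂ (by decide)
  refine Ends.seq ((vecP_ends {v | G.GoodIn Set.univ P v} he₂.size (by decide) (by decide)
    fun x s' hf hx => (h21₂.frame hf (by decide)).holds hx).mono (hB (by decide)) fun _ => id)
    fun s₃ ⟨hf₃, h₃⟩ => ?_
  have he₃ := he₂.frame hf₃ (by decide)
  refine Ends.seq ((reachP_ends n G i s₃ _ _ he₃ h₃ (h₂.frame hf₃ (by decide))).mono
    (hB (by decide)) fun _ => id) fun s₄ ⟨hf₄, h₄⟩ => ?_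
  rw [← coopRegionIn_parity_eq] at h₄
  have he₄ := he₃.frame hf₄ (by decide)
  set Z := G.coopRegionIn Set.univ (Parity P) with hZ
  refine Ends.seq ((vecP_ends Z he₄.size (by decide) (by decide)
    fun x s' hf hx => (h₄.frame hf (by decide)).holds hx).mono (hB (by decide)) fun _ => id)
    fun s₅ ⟨hf₅, h₅⟩ => ?_
  have he₅ := he₄.frame hf₅ (by decide)
  have hf₀₅ : Frame [20, 21, 22, 23, 27, 28, 29, 30, 31, 32, 33] s s₅ := (hf₁.mono (by simp)).trans
    ((hf₂.mono (by simp)).trans ((hf₃.mono (by simp)).trans ((hf₄.mono (by simp)).trans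
    (hf₅.mono (by simp)))))
  have h5₅ := h5.frame hf₀₅ (by decide)
  have h12₅ := h12.frame hf₀₅ (by decide)
  refine Ends.seq ((orP_ends (G.unsafeEdges Z (1 - i)) h5₅.safety he₅.size (by decide) (by decide)
    (by decide) fun x y s' hf hx hy => (holds_leaveT (he₅.frame hf (by decide))
      (h₅.frame hf (by decide)) hx hy).1).mono (hB (by decide)) fun _ => id)
    fun s₆ ⟨hf₆, h₆⟩ => ?_
  have he₆ := he₅.frame hf₆ (by decide)
  have h20₆ := h₅.frame hf₆ (by decide)
  refine Ends.seq ((orP_ends (G.unsafeEdges Z i) (h12₅.safety.frame hf₆ (by decide)) he₆.size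
    (by decide) (by decide) (by decide) fun x y s' hf hx hy => (holds_leaveT
      (he₆.frame hf (by decide)) (h20₆.frame hf (by decide)) hx hy).2).mono (hB (by decide))
    fun _ => id) fun s₇ ⟨hf₇, h₇⟩ => ?_
  have he₇ := he₆.frame hf₇ (by decide)
  have hf₀₇ : Frame [5, 12, 20, 21, 22, 23, 27, 28, 29, 30, 31, 32, 33] s s₇ :=
    (hf₀₅.mono (by simp)).trans ((hf₆.mono (by simp)).trans (hf₇.mono (by simp)))
  have hP₇ := hP.frame hf₀₇ (by decide)
  have h20₇ := h20₆.frame hf₇ (by decide)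
  refine Ends.seq ((maxP_ends n G i s₇ P Z he₇ hP₇ h20₇).mono (hB (by decide)) fun _ => id)
    fun s₈ ⟨hf₈, h₈⟩ => ?_
  have hf₅₈ : Frame [22, 23, 20, 27, 28, 30, 31, 32, 5, 12, 25] s₁ s₈ :=
    (hf₂.mono (by simp)).trans ((hf₃.mono (by simp)).trans ((hf₄.mono (by simp)).trans
    ((hf₅.mono (by simp)).trans ((hf₆.mono (by simp)).trans ((hf₇.mono (by simp)).trans
    (hf₈.mono (by simp)))))))
  obtain ⟨R₁, hR₁⟩ := h5.cond
  obtain ⟨R₂, hR₂⟩ := h12.cond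
  have hinv : MainInv G i {v | G.GoodIn Set.univ P v} (G.parityTemp P i).1 (G.parityTemp P i).2 Z P
      s₈ := by
    refine ⟨⟨he₇.frame hf₈ (by decide), h₁.frame hf₅₈ (by decide), h20₇.frame hf₈ (by decide),
      hP₇.frame hf₈ (by decide), h₈⟩, coopClosed_coopRegionIn _ _, goodInv_coopRegionIn,
      ⟨G.unsafeEdges Z (1 - i), ∅, ∅⟩, ⟨G.unsafeEdges Z i, ∅, ∅⟩, ⟨?_, ?_, R₁, ?_⟩,
      ⟨?_, ?_, R₂, ?_⟩, rfl, rfl⟩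
    · simpa using (h₆.frame hf₇ (by decide)).frame hf₈ (by decide)
    · exact (h5.coLive.frame hf₀₇ (by decide)).frame hf₈ (by decide)
    · exact (hR₁.frame hf₀₇ (by decide)).frame hf₈ (by decide)
    · simpa using h₇.frame hf₈ (by decide)
    · exact (h12.coLive.frame hf₀₇ (by decide)).frame hf₈ (by decide)
    · exact (hR₂.frame hf₀₇ (by decide)).frame hf₈ (by decide)
  refine (levels_ends hinv).mono ?_ fun s' hs' => hs'
  have hZn : Z.ncard ≤ n := by simpa using Set.ncard_le_card Z
  have hPn : {v | P v ≠ 0}.ncard ≤ n := by simpa using Set.ncard_le_card {v | P v ≠ 0}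
  -- Both `Z` and the set of vertices with nonzero priority have at most `n` elements, hence `3 *
  -- n`.
  calc levelPot Z P + 1 ≤ (n + 1) ^ 3 * (3 * n) + (n + 1) ^ 3 * 3 :=
        Nat.add_le_add (Nat.mul_le_mul_left _ (by omega))
          ((one_le_pow_succ n 3).trans (Nat.le_mul_of_pos_right _ (by decide)))
    _ = 3 * (n + 1) ^ 4 := by ring

end Main

/-! ### The initial store and the constant -/

section Input

variable (G : GameGraph (Fin n)) (P : Fin n → ℕ) (i : Fin 2)

theorem env_input : Env G i (input G P i) where
  size := by simp [input]
  player := by simp [input]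
  owner v := by simp [input]
  adj v w := by simp [input]

theorem isPrio_input : IsPrio (input G P i) P := fun v => by simp [input]

theorem input_eq_zero {a : ℕ} (ha : 5 ≤ a) (x y z : ℕ) : input G P i a x y z = 0 := by
  have h0 : a ≠ 0 := by omega
  have h1 : a ≠ 1 := by omega
  have h2 : a ≠ 2 := by omega
  have h3 : a ≠ 3 := by omega
  have h4 : a ≠ 4 := by omega
  simp [input, h0, h1, h2, h3, h4]

/-- Arrays of zeros encode the empty template: zero matrices, and both counters zero. -/
theorem acc_input {b : ℕ} (hb : 5 ≤ b) :
    Acc (input G P i) b (⟨∅, ∅, ∅⟩ : Template (Fin n)) := by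
  have hz : ∀ j x y z, input G P i (b + j) x y z = 0 := fun j =>
    input_eq_zero G P i (by omega)
  have hz0 := hz 0
  rw [add_zero] at hz0
  have hg : ∀ k, groupsOf n (input G P i) b k = ∅ := fun k => by simp [groupsOf, hz]
  exact ⟨fun v w => by simp [hz0], fun v w => by simp [hz], _,
    by simp [condsOf, hz], rfl, hg _, fun k _ => hg k⟩

end Input

theorem exists_prog_parityTemp : ∃ (prog : Prog) (C : ℕ),
    ∀ (n : ℕ) (G : GameGraph (Fin n)) (P : Fin n → ℕ) (i : Fin 2), ∃ (t : ℕ) (s : Store),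
      Runs prog (input G P i) t s ∧ t ≤ C * (n ^ 4 + 1) ∧ output n s = G.parityTemp P i := by
  -- The number 48 is `3 * 16`: the factor 3 of `parityTempP_ends`, and 16 from `(n + 1) ^ 4 ≤ 16 *
  -- (n ^ 4 + 1)`.
  refine ⟨parityTempP, parityTempP.wt * 48, fun n G P i => ?_⟩
  obtain ⟨t, s, hr, ht, hs⟩ := parityTempP_ends (env_input G P i) (isPrio_input G P i)
    (acc_input G P i (by decide)) (acc_input G P i (by decide))
  refine ⟨t, s, hr, ht.trans ?_, hs⟩
  rw [mul_assoc]
  refine Nat.mul_le_mul_left _ ?_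
  have h : (n + 1) ^ 4 ≤ 16 * (n ^ 4 + 1) := by
    rcases Nat.eq_zero_or_pos n with rfl | hn
    · decide
    · have h1 : (n + 1) ^ 4 ≤ (2 * n) ^ 4 := Nat.pow_le_pow_left (by omega) 4
      rw [mul_pow] at h1
      omega
  omega

end Ram

theorem mainTheorem3 :
    (∀ (V : Type u) [Finite V] (G : GameGraph V) (P : V → ℕ) (i : Fin 2),
      G.IsCSM i (G.parityTemp P i) ∧
      G.AdequatelyPermissive i (Parity P) (G.parityTemp P i)) ∧
    ∃ (prog : Ram.Prog) (C : ℕ),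
      ∀ (n : ℕ) (G : GameGraph (Fin n)) (P : Fin n → ℕ) (i : Fin 2),
        ∃ (t : ℕ) (s : Ram.Store),
          Ram.Runs prog (Ram.input G P i) t s ∧
          t ≤ C * (n ^ 4 + 1) ∧
          Ram.output n s = G.parityTemp P i :=
  ⟨fun _ _ G P i => ⟨G.isCSM_parityTemp P i, G.adequatelyPermissive_parityTemp P i⟩,
    Ram.exists_prog_parityTemp⟩
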